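/- **Theorem 1.4.** Let $\Sigma=\Sigma^d\subset\mathbb{R}^N$ be a closed (compact, without boundary) smooth embedded submanifold, $g$ the metric induced by the embedding, $d\mathrm{vol}$ its Riemannian volume measure, $\nabla$ its Levi-Civita connection, and $\Delta_g f=g^{ij}\nabla_i\nabla_j f$. For $t>0$ and $f:\Sigma\to\mathbb{R}$ put $$\theta_t(x)=\int_\Sigma e^{-\frac{\|x-y\|^2}{2t}}\,d\mathrm{vol}(y),\qquad L_tf(x)=\frac{2}{t\,\theta_t(x)}\int_\Sigma\bigl(f(y)-f(x)\bigr)e^{-\frac{\|x-y\|^2}{2t}}\,d\mathrm{vol}(y),$$ where $\|x-y\|$ is the distance in the ambient space $\mathbb{R}^N$. For an operator $L$ on functions put $$\Gamma(L,u,v)=\tfrac12\bigl(L(uv)-L(u)v-uL(v)\bigr),\qquad \Gamma_2(L,u,v)=\tfrac12\bigl(L(\Gamma(L,u,v))-\Gamma(L,Lu,v)-\Gamma(L,u,Lv)\bigr).$$ For $f\in C^5(\Sigma)$ let $\|f\|_{C^5}=\sup_{x\in\Sigma}\max_{0\le k\le 5}|D^kf(x)|$, where $D^kf(x)$ is the $k$-th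 derivative at the origin, measured in the operator norm of multilinear maps, of $f$ written as a function on the tangent plane $T_x\Sigma$, near $x$, through the representation of $\Sigma$ as a graph over $T_x\Sigma$. Then there is a function $K\mapsto C_1(\Sigma,K)$, depending only on the submanifold $\Sigma$, such that every $f\in C^5(\Sigma)$ has $\|f\|_{C^5}<\infty$ and, whenever $\|f\|_{C^5}\le K<\infty$, $$\sup_{x\in\Sigma}\bigl|\Gamma_2(\Delta_g,f,f)(x)-\Gamma_2(L_t,f,f)(x)\bigr|<C_1(\Sigma,K)\,t^{1/2}\qquad\text{for all }t>0 .$$ In particular $\Gamma_2(L_t,f,f)\to\Gamma_2(\Delta_g,f,f)$ uniformly on $\Sigma$ as $t\to0$. -/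

import Mathlib

open MeasureTheory Set Filter Topology Manifold
open scoped ContDiff ENNReal NNReal

noncomputable section

namespace CoarseRicci

/-! ## Carré du champ operators -/

section CarreDuChamp

variable {X : Type*}

/-- The carré du champ `Γ(L, u, v) = ½ (L(uv) - L(u) v - u L(v))` of an operator on functions. -/
def carreDuChamp (L : (X → ℝ) → X → ℝ) (u v : X → ℝ) (x : X) : ℝ :=
  1 / 2 * (L (fun y => u y * v y) x - L u x * v x - u x * L v x)

/-- The iterated carré du champ
`Γ₂(L, u, v) = ½ (L(Γ(L, u, v)) - Γ(L, L u, v) - Γ(L, u, L v))`. -/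
def iteratedCarreDuChamp (L : (X → ℝ) → X → ℝ) (u v : X → ℝ) (x : X) : ℝ :=
  1 / 2 * (L (carreDuChamp L u v) x - carreDuChamp L (L u) v x - carreDuChamp L u (L v) x)

end CarreDuChamp

/-! ## The operators `L_t` of a metric measure space -/

section HeatKernel

variable {X : Type*} [MeasurableSpace X]

/-- `θ_t(x) = ∫ exp(-ρ(x,y)² / 2t) dμ(y)`, for a distance function `ρ` and a measure `μ`. -/
def heatDensity (ρ : X → X → ℝ) (μ : Measure X) (t : ℝ) (x : X) : ℝ :=
  ∫ y, Real.exp (-(ρ x y ^ 2) / (2 * t)) ∂μ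

/-- `L_t f(x) = 2 / (t θ_t(x)) ∫ (f(y) - f(x)) exp(-ρ(x,y)² / 2t) dμ(y)`. -/
def heatOperator (ρ : X → X → ℝ) (μ : Measure X) (t : ℝ) (f : X → ℝ) (x : X) : ℝ :=
  2 / (t * heatDensity ρ μ t x) *
    ∫ y, (f y - f x) * Real.exp (-(ρ x y ^ 2) / (2 * t)) ∂μ

end HeatKernel

/-! ## Local Riemannian geometry of a parametrized submanifold

Here `P : ℝᵈ → ℝᴺ` is a local parametrization, and `h : ℝᵈ → ℝ` is a function written in the
corresponding coordinates. -/

section Coordinates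

variable {d N : ℕ}

/-- The `i`-th partial derivative of `h` at `z`. -/
def partialDeriv (i : Fin d) (h : EuclideanSpace ℝ (Fin d) → ℝ)
    (z : EuclideanSpace ℝ (Fin d)) : ℝ :=
  fderiv ℝ h z (EuclideanSpace.single i 1)

/-- The matrix `g_ij = ⟨∂_i P, ∂_j P⟩` of the metric induced by the parametrization `P`. -/
def inducedMetric (P : EuclideanSpace ℝ (Fin d) → EuclideanSpace ℝ (Fin N))
    (z : EuclideanSpace ℝ (Fin d)) : Matrix (Fin d) (Fin d) ℝ :=
  Matrix.of fun i j => inner ℝ (fderiv ℝ P z (EuclideanSpace.single i 1))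
    (fderiv ℝ P z (EuclideanSpace.single j 1))

/-- The Christoffel symbol `Γᵏ_ij = ½ gᵏˡ (∂_i g_jl + ∂_j g_il - ∂_l g_ij)` of the Levi-Civita
connection of the induced metric. -/
def christoffel (P : EuclideanSpace ℝ (Fin d) → EuclideanSpace ℝ (Fin N))
    (z : EuclideanSpace ℝ (Fin d)) (k i j : Fin d) : ℝ :=
  1 / 2 * ∑ l, (inducedMetric P z)⁻¹ k l *
    (partialDeriv i (fun w => inducedMetric P w j l) z
      + partialDeriv j (fun w => inducedMetric P w i l) z
      - partialDeriv l (fun w => inducedMetric P w i j) z)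

/-- The components `∇_i ∇_j h = ∂_i ∂_j h - Γᵏ_ij ∂_k h` of the covariant Hessian. -/
def covariantHessian (P : EuclideanSpace ℝ (Fin d) → EuclideanSpace ℝ (Fin N))
    (h : EuclideanSpace ℝ (Fin d) → ℝ) (z : EuclideanSpace ℝ (Fin d)) (i j : Fin d) : ℝ :=
  partialDeriv i (partialDeriv j h) z - ∑ k, christoffel P z k i j * partialDeriv k h z

/-- The Laplacian `Δ_g h = gⁱʲ ∇_i ∇_j h` in coordinates. -/
def coordLaplacian (P : EuclideanSpace ℝ (Fin d) → EuclideanSpace ℝ (Fin N))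
    (h : EuclideanSpace ℝ (Fin d) → ℝ) (z : EuclideanSpace ℝ (Fin d)) : ℝ :=
  ∑ i, ∑ j, (inducedMetric P z)⁻¹ i j * covariantHessian P h z i j

/-- The volume density `√(det g_ij)`. -/
def volumeDensity (P : EuclideanSpace ℝ (Fin d) → EuclideanSpace ℝ (Fin N))
    (z : EuclideanSpace ℝ (Fin d)) : ℝ :=
  √(inducedMetric P z).det

end Coordinates

/-! ## Embedded submanifolds

A `d`-dimensional submanifold of `ℝᴺ` is given as a manifold `M` with an embedding
`F : M → ℝᴺ`. -/

section Submanifold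

variable {d N : ℕ} {M : Type*} [TopologicalSpace M] [ChartedSpace (EuclideanSpace ℝ (Fin d)) M]

/-- The local parametrization of the submanifold given by the preferred chart at `p`. -/
def localParam (F : M → EuclideanSpace ℝ (Fin N)) (p : M) :
    EuclideanSpace ℝ (Fin d) → EuclideanSpace ℝ (Fin N) :=
  fun z => F ((chartAt (EuclideanSpace ℝ (Fin d)) p).symm z)

/-- The rough Laplacian (Laplace-Beltrami operator) `Δ_g f = gⁱʲ ∇_i ∇_j f` of the metric `g`
induced by `F`; at the point `x` it is computed in the preferred chart at `x`. -/
def laplacian (F : M → EuclideanSpace ℝ (Fin N)) (f : M → ℝ) (x : M) : ℝ :=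
  coordLaplacian (localParam (d := d) F x)
    (fun z => f ((chartAt (EuclideanSpace ℝ (Fin d)) x).symm z))
    (chartAt (EuclideanSpace ℝ (Fin d)) x x)

/-- The distance in the ambient Euclidean space. -/
def chordalDist (F : M → EuclideanSpace ℝ (Fin N)) (x y : M) : ℝ :=
  dist (F x) (F y)

/-- The measure `√(det g_ij) dz¹ ⋯ dzᵈ` in the preferred chart at `p`, carried over to `M`.
It lives on the domain of that chart. -/
def chartVolume [MeasurableSpace M] (F : M → EuclideanSpace ℝ (Fin N)) (p : M) : Measure M :=
  ((volume.restrict (chartAt (EuclideanSpace ℝ (Fin d)) p).target).withDensity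
    (fun z => ENNReal.ofReal (volumeDensity (localParam (d := d) F p) z))).map
      (chartAt (EuclideanSpace ℝ (Fin d)) p).symm

/-- The Riemannian volume measure of the metric induced by `F`: the measure obtained by gluing
the measures `√(det g_ij) dz¹ ⋯ dzᵈ` of the charts. By the change of variables formula these
agree where the charts overlap, so the glued measure, whose restriction to the domain of each chart
is the measure of this chart, is their supremum in the lattice of measures. -/
def riemannianVolume [MeasurableSpace M] (F : M → EuclideanSpace ℝ (Fin N)) : Measure M :=
  ⨆ p : M, chartVolume (d := d) F p

/-- `ψ` parametrizes the submanifold near `x` as a graph over its tangent plane at `x`: for some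
linear isometry `e` of `ℝᵈ` onto the tangent plane, the orthogonal projection of `F (ψ w) - F x`
to the tangent plane is `e w`, for all `w` near `0`. -/
def IsTangentGraph (F : M → EuclideanSpace ℝ (Fin N)) (x : M)
    (ψ : EuclideanSpace ℝ (Fin d) → M) : Prop :=
  ψ 0 = x ∧ ContMDiffAt (𝓡 d) (𝓡 d) ∞ ψ 0 ∧
  ∃ e : EuclideanSpace ℝ (Fin d) →ₗᵢ[ℝ] EuclideanSpace ℝ (Fin N),
    range e = range (mfderiv (𝓡 d) (𝓡 N) F x) ∧
    ∀ᶠ w in 𝓝 (0 : EuclideanSpace ℝ (Fin d)), ∀ v : EuclideanSpace ℝ (Fin d),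
      inner ℝ (e v) (F (ψ w) - F x) = inner ℝ v w

/-- The size `|Dᵏ f(x)|` of the `k`-th derivative of `f` at `x`, in coordinates on the tangent plane
at `x`. (Two graph parametrizations at `x` differ near `0` by a linear isometry of `ℝᵈ`,
so that all of them give the same value.) -/
def jetSize (F : M → EuclideanSpace ℝ (Fin N)) (f : M → ℝ) (k : ℕ) (x : M) : ℝ≥0∞ :=
  ⨆ (ψ : EuclideanSpace ℝ (Fin d) → M) (_ : IsTangentGraph F x ψ),
    ‖iteratedFDeriv ℝ k (fun w => f (ψ w)) 0‖ₑ

/-- The `Cᵐ` norm `sup_x max_{k ≤ m} |Dᵏ f(x)|`. -/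
def cNorm (F : M → EuclideanSpace ℝ (Fin N)) (m : ℕ) (f : M → ℝ) : ℝ≥0∞ :=
  ⨆ (x : M) (k : Fin (m + 1)), jetSize (d := d) F f k x

end Submanifold

end CoarseRicci

end

/-! Put `t = ε²`. In a chart the submanifold is given by a parametrization `P`, and the substitution
`w = z + ε u` turns the heat integral into an integral over `u` against `heatWeight`. Since `P (z +
ε u) - P z` is `ε` times a smooth function, this weight is smooth in `(z, ε)` up to and including `ε
= 0`, with Gaussian decay in `u`. Hence `L_t h = 2 * heatNum / (ε² * heatDen)`, where `heatDen` is
bounded below. The numerator vanishes at `ε = 0` and, by the symmetry `u ↦ -u`, is even in `ε`;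
Hadamard's lemma applied twice (`CkBound.exists_div_sq`) divides it by `ε²` at the price of two
derivatives.

At `ε = 0` the quotient is a combination of Gaussian moments. The derivative of the volume density
(Jacobi's formula) cancels part of the fourth moment, the Christoffel term survives, and the value
is the Laplacian (`tendsto_heatNum_div_sq`). So the family `L_{ε²}`, completed by `Δ_g` at `ε = 0`,
maps `C^{n+2}` to `C^n` jointly in `(z, ε)` (`exists_ckBound_flowOp`). The function acted upon may
itself depend on `ε`, so the statement can be iterated: `Γ₂` applies the operator twice, 5 = 2 + 2 +
1, and the one derivative left over makes `Γ₂` Lipschitz in `ε = √t` (`exists_model_estimate`).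
Bounds linear in each function give a constant quadratic in `K`.

The model lives on all of `ℝᵈ`: each local parametrization is extended to a bi-Lipschitz immersion
with bounded derivatives (`exists_tame_extension`). Replacing the submanifold by the model changes
`L_t` by less than any power of `t`, because the kernel is exponentially small off the diagonal and
an embedded submanifold does not return close to itself
(`LocalModel.exists_abs_heatOperator_sub_le`).

Three points of geometry connect the model to the statement. The supremum of the chart measures
restricts to each chart measure, by change of variables. The Laplacian does not depend on the chart,
because in every chart it is the limit of the same operators `L_t`. Derivatives in charts and in
graph coordinates over tangent planes control each other, by the inverse function theorem with
uniform bounds. Compactness then yields one constant for `t ≤ 1`, and a crude bound on `Γ₂(L_t)`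
settles `t > 1`. -/

noncomputable section

namespace CoarseRicci

/-! ### Derivative bounds for compositions and products at a point -/

section Pointwise

variable {E F G : Type} [NormedAddCommGroup E] [NormedSpace ℝ E]
  [NormedAddCommGroup F] [NormedSpace ℝ F] [NormedAddCommGroup G] [NormedSpace ℝ G]

/-- Iterated derivatives of a composition, for maps that are only differentiable near a point. -/
theorem norm_iteratedFDeriv_comp_le_of_contDiffAt {g : F → G} {f : E → F} {n : ℕ} {x : E}
    (hg : ContDiffAt ℝ n g (f x)) (hf : ContDiffAt ℝ n f x) {C D : ℝ}
    (hC : ∀ i ≤ n, ‖iteratedFDeriv ℝ i g (f x)‖ ≤ C)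
    (hD : ∀ i, 1 ≤ i → i ≤ n → ‖iteratedFDeriv ℝ i f x‖ ≤ D ^ i) :
    ‖iteratedFDeriv ℝ n (g ∘ f) x‖ ≤ n.factorial * C * D ^ n := by
  obtain ⟨t, htm, ht⟩ := hg.contDiffOn le_rfl (by simp)
  obtain ⟨t', ht't, ht'o, hft'⟩ := mem_nhds_iff.1 (by simpa using htm)
  obtain ⟨s, hsm, hs⟩ := hf.contDiffOn le_rfl (by simp)
  have hsm' : s ∩ f ⁻¹' t' ∈ 𝓝 x :=
    inter_mem (by simpa using hsm) (hf.continuousAt.preimage_mem_nhds (ht'o.mem_nhds hft'))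
  obtain ⟨s', hs's, hs'o, hxs'⟩ := mem_nhds_iff.1 hsm'
  have key := norm_iteratedFDerivWithin_comp_le (n := n) (N := n) (C := C) (D := D)
    (ht.mono (fun y hy => ht't hy))
    (hs.mono (fun y hy => (hs's hy).1)) le_rfl ht'o.uniqueDiffOn hs'o.uniqueDiffOn
    (fun y hy => (hs's hy).2) hxs'
    (fun i hi => by rw [iteratedFDerivWithin_of_isOpen i ht'o hft']; exact hC i hi)
    (fun i h1 hi => by rw [iteratedFDerivWithin_of_isOpen i hs'o hxs']; exact hD i h1 hi)
  rwa [iteratedFDerivWithin_of_isOpen n hs'o hxs'] at key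

/-- Since `1 ≤ D`, a uniform bound `D` implies the bounds `D ^ i` that the Faà di Bruno estimate
requires. The loss is harmless because only the existence of constants matters. -/
theorem norm_iteratedFDeriv_comp_le_of_bound {g : F → G} {f : E → F} {n : ℕ} {x : E}
    (hg : ContDiffAt ℝ n g (f x)) (hf : ContDiffAt ℝ n f x) {C D : ℝ} (hD1 : 1 ≤ D)
    (hC : ∀ i ≤ n, ‖iteratedFDeriv ℝ i g (f x)‖ ≤ C)
    (hD : ∀ i, 1 ≤ i → i ≤ n → ‖iteratedFDeriv ℝ i f x‖ ≤ D) :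
    ∀ i ≤ n, ‖iteratedFDeriv ℝ i (g ∘ f) x‖ ≤ n.factorial * C * D ^ n := by
  intro i hi
  have hC0 : 0 ≤ C := (norm_nonneg _).trans (hC 0 (Nat.zero_le _))
  have h := norm_iteratedFDeriv_comp_le_of_contDiffAt (n := i) (C := C) (D := D)
    (hg.of_le (by exact_mod_cast hi)) (hf.of_le (by exact_mod_cast hi))
    (fun j hj => hC j (hj.trans hi))
    (fun j h1 hj => (hD j h1 (hj.trans hi)).trans (le_self_pow₀ hD1 (by omega)))
  refine h.trans ?_
  have h1 : (i.factorial : ℝ) ≤ n.factorial := by exact_mod_cast Nat.factorial_le hi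
  have h2 : D ^ i ≤ D ^ n := pow_le_pow_right₀ hD1 hi
  have hD0 : 0 ≤ D := by linarith
  gcongr

/-- Bounds for the derivatives of a continuous bilinear expression at a point. -/
theorem norm_iteratedFDeriv_bilinear_le_of_contDiffAt {H : Type} [NormedAddCommGroup H]
    [NormedSpace ℝ H] (L : F →L[ℝ] G →L[ℝ] H) {f : E → F} {g : E → G} {n : ℕ} {x : E}
    (hf : ContDiffAt ℝ n f x) (hg : ContDiffAt ℝ n g x) {B C : ℝ}
    (hB : ∀ i ≤ n, ‖iteratedFDeriv ℝ i f x‖ ≤ B) (hC : ∀ i ≤ n, ‖iteratedFDeriv ℝ i g x‖ ≤ C) :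
    ∀ i ≤ n, ‖iteratedFDeriv ℝ i (fun y => L (f y) (g y)) x‖ ≤ ‖L‖ * 2 ^ n * B * C := by
  intro i hi
  have hB0 : 0 ≤ B := (norm_nonneg _).trans (hB 0 (Nat.zero_le _))
  have hC0 : 0 ≤ C := (norm_nonneg _).trans (hC 0 (Nat.zero_le _))
  obtain ⟨t, htm, ht⟩ := hf.contDiffOn le_rfl (by simp)
  obtain ⟨s, hsm, hs⟩ := hg.contDiffOn le_rfl (by simp)
  obtain ⟨s', hs's, hs'o, hxs'⟩ := mem_nhds_iff.1
    (inter_mem (show t ∈ 𝓝 x by simpa using htm) (show s ∈ 𝓝 x by simpa using hsm))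
  have key := L.norm_iteratedFDerivWithin_le_of_bilinear (n := i) (N := n)
    (ht.mono (fun y hy => (hs's hy).1)) (hs.mono (fun y hy => (hs's hy).2)) hs'o.uniqueDiffOn hxs'
    (by exact_mod_cast hi)
  simp only [iteratedFDerivWithin_of_isOpen _ hs'o hxs'] at key
  refine key.trans ?_
  rw [mul_assoc, mul_assoc]
  gcongr
  calc _ ≤ ∑ j ∈ Finset.range (i + 1), (i.choose j : ℝ) * (B * C) := by
        refine Finset.sum_le_sum fun j hj => ?_
        rw [mul_assoc]
        have := hB j (by grind)
        have := hC (i - j) (by omega)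
        gcongr
    _ = 2 ^ i * (B * C) := by
        rw [← Finset.sum_mul]
        congr 1
        exact_mod_cast Nat.sum_range_choose i
    _ ≤ _ := by gcongr; norm_num

end Pointwise

/-! ### Calculus of functions with globally bounded derivatives -/

section CkBound

variable {E F G H : Type} [NormedAddCommGroup E] [NormedSpace ℝ E]
  [NormedAddCommGroup F] [NormedSpace ℝ F] [NormedAddCommGroup G] [NormedSpace ℝ G]
  [NormedAddCommGroup H] [NormedSpace ℝ H]

/-- `g` is `Cⁿ` and its derivatives up to order `n` are bounded by `B`. -/
def CkBound (n : ℕ) (B : ℝ) (g : E → F) : Prop :=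
  ContDiff ℝ n g ∧ ∀ j ≤ n, ∀ x, ‖iteratedFDeriv ℝ j g x‖ ≤ B

namespace CkBound

variable {n m : ℕ} {B C : ℝ} {f g : E → F}

theorem nonneg (hf : CkBound n B f) : 0 ≤ B :=
  (norm_nonneg _).trans (hf.2 0 (Nat.zero_le _) 0)

theorem norm_le (hf : CkBound n B f) (x : E) : ‖f x‖ ≤ B := by
  simpa using hf.2 0 (Nat.zero_le _) x

theorem mono (hf : CkBound n B f) (hm : m ≤ n) (hB : B ≤ C) : CkBound m C f :=
  ⟨hf.1.of_le (by exact_mod_cast hm), fun j hj x => (hf.2 j (hj.trans hm) x).trans hB⟩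

theorem mono_right (hf : CkBound n B f) (hB : B ≤ C) : CkBound n C f := hf.mono le_rfl hB

theorem const (c : F) : CkBound n ‖c‖ (fun _ : E => c) := by
  refine ⟨contDiff_const, fun j _ x => ?_⟩
  rcases Nat.eq_zero_or_pos j with rfl | hj
  · simp
  · rw [iteratedFDeriv_const_of_ne hj.ne']
    simp

theorem add (hf : CkBound n B f) (hg : CkBound n C g) : CkBound n (B + C) (fun x => f x + g x) := by
  refine ⟨hf.1.add hg.1, fun j hj x => ?_⟩
  have := iteratedFDeriv_add_apply (i := j) (x := x)
    (hf.1.of_le (by exact_mod_cast hj)).contDiffAt (hg.1.of_le (by exact_mod_cast hj)).contDiffAt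
  change iteratedFDeriv ℝ j (fun x => f x + g x) x = _ at this
  rw [this]
  exact (norm_add_le _ _).trans (add_le_add (hf.2 j hj x) (hg.2 j hj x))

theorem bilinear {f : E → F} {g : E → G} (L : F →L[ℝ] G →L[ℝ] H) (hf : CkBound n B f)
    (hg : CkBound n C g) : CkBound n (‖L‖ * 2 ^ n * B * C) (fun x => L (f x) (g x)) :=
  ⟨(L.isBoundedBilinearMap.contDiff.comp (hf.1.prodMk hg.1)), fun i hi x =>
    norm_iteratedFDeriv_bilinear_le_of_contDiffAt L hf.1.contDiffAt hg.1.contDiffAt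
      (fun j hj => hf.2 j hj x) (fun j hj => hg.2 j hj x) i hi⟩

theorem clm_comp {f : E → F} (L : F →L[ℝ] G) (hf : CkBound n B f) :
    CkBound n (‖L‖ * B) (fun x => L (f x)) := by
  refine ⟨L.contDiff.comp hf.1, fun j hj x => ?_⟩
  have := L.norm_iteratedFDeriv_comp_left (f := f) (x := x) (n := j) (N := n)
    hf.1.contDiffAt (by exact_mod_cast hj)
  exact this.trans (by gcongr; exact hf.2 j hj x)

theorem neg (hf : CkBound n B f) : CkBound n B (fun x => -f x) := by
  refine ⟨hf.1.neg, fun j hj x => ?_⟩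
  have : iteratedFDeriv ℝ j (fun x => -f x) x = -iteratedFDeriv ℝ j f x := by
    have := iteratedFDeriv_neg (𝕜 := ℝ) (i := j) (f := f)
    exact congrFun this x
  rw [this, norm_neg]
  exact hf.2 j hj x

theorem sub (hf : CkBound n B f) (hg : CkBound n C g) : CkBound n (B + C) (fun x => f x - g x) := by
  simpa [sub_eq_add_neg] using hf.add hg.neg

theorem mul {f g : E → ℝ} (hf : CkBound n B f) (hg : CkBound n C g) :
    CkBound n (2 ^ n * B * C) (fun x => f x * g x) := by
  have h := hf.bilinear (ContinuousLinearMap.mul ℝ ℝ) hg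
  have h1 : ‖ContinuousLinearMap.mul ℝ ℝ‖ = 1 := by simp
  simpa [h1] using h

theorem const_mul {f : E → ℝ} (hf : CkBound n B f) (c : ℝ) :
    CkBound n (|c| * B) (fun x => c * f x) := by
  have h := hf.clm_comp (c • ContinuousLinearMap.id ℝ ℝ)
  refine (h.mono_right ?_)
  have := hf.nonneg
  gcongr
  refine (norm_smul_le c (ContinuousLinearMap.id ℝ ℝ)).trans ?_
  calc ‖c‖ * ‖ContinuousLinearMap.id ℝ ℝ‖ ≤ ‖c‖ * 1 := by
        gcongr; exact ContinuousLinearMap.norm_id_le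
    _ = |c| := by simp

/-- The base `1 + ‖L‖` is at least one, so its `n`-th power serves all orders `j ≤ n`. The explicit
dependence on `‖L‖` matters: for the substitution `z + ε u` it produces polynomial growth in `‖u‖`,
which a Gaussian absorbs. -/
theorem comp_clm {f : F → G} (hf : CkBound n B f) (L : E →L[ℝ] F) :
    CkBound n (B * (1 + ‖L‖) ^ n) (fun x => f (L x)) := by
  refine ⟨hf.1.comp L.contDiff, fun j hj x => ?_⟩
  have h := L.iteratedFDeriv_comp_right (f := f) hf.1 x (i := j) (by exact_mod_cast hj)
  change iteratedFDeriv ℝ j (fun x => f (L x)) x = _ at h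
  rw [h]
  refine (ContinuousMultilinearMap.norm_compContinuousLinearMap_le _ _).trans ?_
  have hB := hf.nonneg
  have h1 : 1 ≤ 1 + ‖L‖ := by linarith [norm_nonneg L]
  simp only [Finset.prod_const, Finset.card_univ, Fintype.card_fin]
  calc _ ≤ B * (1 + ‖L‖) ^ j := by
        gcongr
        · exact hf.2 j hj _
        · linarith
    _ ≤ _ := by gcongr

/-- Composition with a function that is smooth near a compact set. -/
theorem exists_comp_of_isCompact [FiniteDimensional ℝ F] {φ : F → G} {U K : Set F} (hU : IsOpen U)
    (hφ : ContDiffOn ℝ ∞ φ U) (hK : IsCompact K) (hKU : K ⊆ U) (n : ℕ) (B : ℝ) :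
    ∃ C, ∀ {E : Type} [NormedAddCommGroup E] [NormedSpace ℝ E] (f : E → F),
      CkBound n B f → (∀ x, f x ∈ K) → CkBound n C (fun x => φ (f x)) := by
  have hb : ∀ i : ℕ, ∃ Ci, ∀ y ∈ K, ‖iteratedFDeriv ℝ i φ y‖ ≤ Ci := by
    intro i
    have hc : ContinuousOn (iteratedFDeriv ℝ i φ) U :=
      ((hφ.continuousOn_iteratedFDerivWithin (m := i) (by exact_mod_cast le_top)
        hU.uniqueDiffOn)).congr (fun y hy => (iteratedFDerivWithin_of_isOpen i hU hy).symm)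
    obtain ⟨Ci, hCi⟩ := hK.exists_bound_of_continuousOn (hc.mono hKU)
    exact ⟨Ci, hCi⟩
  choose c hc using hb
  refine ⟨n.factorial * (∑ i ∈ Finset.range (n + 1), |c i|) * (max B 1) ^ n, ?_⟩
  intro E _ _ f hf hfK
  have hφat : ∀ x, ContDiffAt ℝ n φ (f x) := fun x =>
    (hφ.contDiffAt (hU.mem_nhds (hKU (hfK x)))).of_le (by exact_mod_cast le_top)
  refine ⟨contDiff_iff_contDiffAt.2 fun x => (hφat x).comp x hf.1.contDiffAt, fun j hj x => ?_⟩
  refine norm_iteratedFDeriv_comp_le_of_bound (hφat x) hf.1.contDiffAt (le_max_right B 1)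
    (fun i hi => ?_) (fun i _ hi => (hf.2 i hi x).trans (le_max_left _ _)) j hj
  refine (hc i _ (hfK x)).trans ((le_abs_self _).trans ?_)
  exact Finset.single_le_sum (f := fun i => |c i|) (fun i _ => abs_nonneg _) (by grind)

/-- Every derivative of the exponential is again the exponential, so an upper bound for `f` alone
controls the outer function. Keeping `M` apart from `D` preserves Gaussian decay when `f` is very
negative but has large derivatives. -/
theorem exp {f : E → ℝ} {M D : ℝ} (hfs : ContDiff ℝ n f) (hM : ∀ x, f x ≤ M) (hD1 : 1 ≤ D)
    (hD : ∀ i ≤ n, 1 ≤ i → ∀ x, ‖iteratedFDeriv ℝ i f x‖ ≤ D) :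
    CkBound n (n.factorial * Real.exp M * D ^ n) (fun x => Real.exp (f x)) := by
  refine ⟨Real.contDiff_exp.comp hfs, fun j hj x => ?_⟩
  refine norm_iteratedFDeriv_comp_le_of_bound Real.contDiff_exp.contDiffAt hfs.contDiffAt hD1
    (fun i hi => ?_) (fun i h1 hi => hD i hi h1 x) j hj
  rw [norm_iteratedFDeriv_eq_norm_iteratedDeriv, iteratedDeriv_eq_iterate, Real.iter_deriv_exp]
  simpa using hM x

theorem fderiv_right (hf : CkBound (n + 1) B f) : CkBound n B (fderiv ℝ f) := by
  refine ⟨hf.1.fderiv_right (by norm_cast), fun j hj x => ?_⟩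
  rw [norm_iteratedFDeriv_fderiv]
  exact hf.2 (j + 1) (by omega) x

theorem of_fderiv (hd : Differentiable ℝ f) (hb : ∀ x, ‖f x‖ ≤ B) (hf : CkBound n B (fderiv ℝ f)) :
    CkBound (n + 1) B f := by
  refine ⟨by exact_mod_cast contDiff_succ_iff_fderiv.2 ⟨hd, by simp, hf.1⟩, fun j hj x => ?_⟩
  rcases j with _ | j
  · simpa using hb x
  · rw [← norm_iteratedFDeriv_fderiv]
    exact hf.2 j (by omega) x

theorem differentiable (hf : CkBound (n + 1) B f) : Differentiable ℝ f :=
  hf.1.differentiable (by simp)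

theorem norm_sub_le (hf : CkBound (n + 1) B f) (x y : E) : ‖f x - f y‖ ≤ B * ‖x - y‖ :=
  convex_univ.norm_image_sub_le_of_norm_fderiv_le (fun z _ => hf.differentiable z)
    (fun z _ => hf.fderiv_right.norm_le z) (mem_univ y) (mem_univ x)

end CkBound

end CkBound

end CoarseRicci

end

noncomputable section

namespace CoarseRicci

/-! ### Smoothness of parametric integrals -/

section Integral

variable {E F U : Type} [NormedAddCommGroup E] [NormedSpace ℝ E]
  [NormedAddCommGroup U] [NormedSpace ℝ U]

theorem contDiff_uncurry_fderiv [NormedAddCommGroup F] [NormedSpace ℝ F] {n : ℕ}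
    {Ψ : U → E → F} (hΨ : ContDiff ℝ (n + 1 : ℕ) (Function.uncurry Ψ)) :
    ContDiff ℝ n (Function.uncurry fun u => fderiv ℝ (Ψ u)) := by
  refine ContDiff.fderiv (f := fun (q : U × E) => Ψ q.1) (g := Prod.snd) (m := (n + 1 : ℕ))
    ?_ contDiff_snd (by norm_cast)
  exact hΨ.comp ((contDiff_fst.comp contDiff_fst).prodMk contDiff_snd)

variable [MeasurableSpace U] [BorelSpace U] [SecondCountableTopology U] {μ : Measure U}

omit [NormedSpace ℝ E] [NormedSpace ℝ U] in
theorem aestronglyMeasurable_partial {F : Type} [NormedAddCommGroup F] {Ψ : U → E → F}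
    (hΨ : Continuous (Function.uncurry Ψ)) (x : E) :
    AEStronglyMeasurable (fun u => Ψ u x) μ :=
  (hΨ.comp (Continuous.prodMk continuous_id continuous_const)).aestronglyMeasurable

theorem integrable_partial [NormedAddCommGroup F] [NormedSpace ℝ F] {n : ℕ} {Ψ : U → E → F}
    (hΨ : ContDiff ℝ n (Function.uncurry Ψ)) {b : U → ℝ} (hb : Integrable b μ)
    (h : ∀ᵐ u ∂μ, CkBound n (b u) (Ψ u)) (x : E) : Integrable (fun u => Ψ u x) μ :=
  hb.mono' (aestronglyMeasurable_partial hΨ.continuous x) (h.mono fun _ hu => hu.norm_le x)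

/-- Differentiation under the integral sign. -/
theorem hasFDerivAt_integral_of_ckBound [NormedAddCommGroup F] [NormedSpace ℝ F] {n : ℕ}
    {Ψ : U → E → F}
    (hΨ : ContDiff ℝ (n + 1 : ℕ) (Function.uncurry Ψ)) {b : U → ℝ} (hb : Integrable b μ)
    (h : ∀ᵐ u ∂μ, CkBound (n + 1) (b u) (Ψ u)) (x : E) :
    HasFDerivAt (fun p => ∫ u, Ψ u p ∂μ) (∫ u, fderiv ℝ (Ψ u) x ∂μ) x := by
  have hcont : Continuous fun q : U × E => fderiv ℝ (Ψ q.1) q.2 := by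
    refine (ContDiff.fderiv (f := fun (q : U × E) => Ψ q.1) (g := Prod.snd) (n := 0)
      (m := (n + 1 : ℕ)) ?_ contDiff_snd ?_).continuous
    · exact hΨ.comp ((contDiff_fst.comp contDiff_fst).prodMk contDiff_snd)
    · norm_cast; omega
  refine hasFDerivAt_integral_of_dominated_of_fderiv_le (bound := b)
    (F' := fun p u => fderiv ℝ (Ψ u) p) (s := univ) univ_mem
    (Eventually.of_forall fun p => aestronglyMeasurable_partial hΨ.continuous p)
    (integrable_partial hΨ hb h x)
    (hcont.comp (Continuous.prodMk continuous_id continuous_const)).aestronglyMeasurable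
    ?_ hb ?_
  · filter_upwards [h] with u hu y _ using hu.fderiv_right.norm_le y
  · filter_upwards [h] with u hu y _ using (hu.differentiable y).hasFDerivAt

/-- A parametric integral is as smooth as its integrand. -/
theorem CkBound.integral {n : ℕ} : ∀ {F : Type} [NormedAddCommGroup F] [NormedSpace ℝ F]
    {Ψ : U → E → F} (_ : ContDiff ℝ n (Function.uncurry Ψ)) {b : U → ℝ} (_ : Integrable b μ)
    (_ : ∀ᵐ u ∂μ, CkBound n (b u) (Ψ u)),
    CkBound n (∫ u, b u ∂μ) (fun x => ∫ u, Ψ u x ∂μ) := by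
  -- The target space is quantified inside the induction, because the induction step passes to
  -- `fderiv ℝ (Ψ u)`, which takes values in a space of linear maps.
  induction n with
  | zero =>
    intro F _ _ Ψ hΨ b hb h
    have hbd : ∀ x, ‖∫ u, Ψ u x ∂μ‖ ≤ ∫ u, b u ∂μ := fun x =>
      norm_integral_le_of_norm_le hb (h.mono fun u hu => hu.norm_le x)
    refine ⟨?_, fun j hj x => ?_⟩
    · refine contDiff_zero.2 (continuous_of_dominated
        (fun x => aestronglyMeasurable_partial hΨ.continuous x)
        (fun x => h.mono fun u hu => hu.norm_le x) hb (h.mono fun u hu => hu.1.continuous))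
    · obtain rfl : j = 0 := by omega
      simpa using hbd x
  | succ n ih =>
    intro F _ _ Ψ hΨ b hb h
    have hd := fun x => hasFDerivAt_integral_of_ckBound hΨ hb h x
    refine CkBound.of_fderiv (fun x => (hd x).differentiableAt) (fun x =>
      norm_integral_le_of_norm_le hb (h.mono fun u hu => hu.norm_le x)) ?_
    rw [show fderiv ℝ (fun x => ∫ u, Ψ u x ∂μ) = fun x => ∫ u, fderiv ℝ (Ψ u) x ∂μ from
      funext fun x => (hd x).fderiv]
    exact ih (contDiff_uncurry_fderiv hΨ) hb (h.mono fun u hu => hu.fderiv_right)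

end Integral

/-! ### Hadamard's lemma: division by `ε` and `ε²` -/

section Hadamard

variable {E F : Type} [NormedAddCommGroup E] [NormedSpace ℝ E]
  [NormedAddCommGroup F] [NormedSpace ℝ F]

/-- The averaged derivative `∫₀¹ g(x + s v) ds` of a bounded family. -/
theorem CkBound.average {n : ℕ} {B : ℝ} {g : E → F} (hg : CkBound n B g) {E' : Type}
    [NormedAddCommGroup E'] [NormedSpace ℝ E'] (L₀ L₁ : E' →L[ℝ] E) :
    CkBound n (B * (1 + (‖L₀‖ + ‖L₁‖)) ^ n) 
      (fun x => ∫ s in Icc (0 : ℝ) 1, g (L₀ x + s • L₁ x)) := by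
  have h := CkBound.integral (μ := volume.restrict (Icc (0 : ℝ) 1)) (n := n)
    (Ψ := fun (s : ℝ) (x : E') => g (L₀ x + s • L₁ x))
    (b := fun _ => B * (1 + (‖L₀‖ + ‖L₁‖)) ^ n) ?_ ?_ ?_
  · simpa using h
  · exact hg.1.comp (by fun_prop)
  · exact integrable_const _
  · filter_upwards [ae_restrict_mem measurableSet_Icc] with s hs
    have h := hg.comp_clm (L₀ + s • L₁)
    simp only [add_apply, smul_apply] at h
    refine h.mono_right ?_
    have := hg.nonneg
    have h2 : ‖L₀ + s • L₁‖ ≤ ‖L₀‖ + ‖L₁‖ := by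
      refine (norm_add_le _ _).trans ?_
      gcongr
      rw [norm_smul, Real.norm_eq_abs, abs_of_nonneg hs.1]
      exact mul_le_of_le_one_left (norm_nonneg _) hs.2
    gcongr

theorem setIntegral_Icc_deriv_eq [CompleteSpace F] {γ : ℝ → F} (hγ : ContDiff ℝ 1 γ) :
    ∫ s in Icc (0 : ℝ) 1, deriv γ s = γ 1 - γ 0 := by
  rw [integral_Icc_eq_integral_Ioc, ← intervalIntegral.integral_of_le zero_le_one]
  exact intervalIntegral.integral_deriv_eq_sub (fun x _ => hγ.differentiable (by simp) x)
    ((hγ.continuous_deriv le_rfl).intervalIntegrable _ _)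

theorem setIntegral_Icc_fderiv_apply_eq [CompleteSpace F] {g : E → F} (hg : ContDiff ℝ 1 g) (x v : E) :
    ∫ s in Icc (0 : ℝ) 1, fderiv ℝ g (x + s • v) v = g (x + v) - g x := by
  have h := setIntegral_Icc_deriv_eq (γ := fun s : ℝ => g (x + s • v)) (hg.comp (by fun_prop))
  have hd : ∀ s : ℝ, deriv (fun s : ℝ => g (x + s • v)) s = fderiv ℝ g (x + s • v) v := by
    intro s
    have h1 : HasDerivAt (fun s : ℝ => x + s • v) v s := by
      simpa using ((hasDerivAt_id s).smul_const v).const_add x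
    exact ((hg.differentiable (by simp) (x + s • v)).hasFDerivAt.comp_hasDerivAt s h1).deriv
  simp only [hd] at h
  simpa using h

/-- Hadamard's lemma: a function vanishing for `ε = 0` is divisible by `ε`. -/
theorem CkBound.exists_div [CompleteSpace F] (n : ℕ) : ∃ C, ∀ (B : ℝ) (H : E × ℝ → F),
    CkBound (n + 1) B H → (∀ p, H (p, 0) = 0) →
    ∃ H' : E × ℝ → F, CkBound n (C * B) H' ∧ ∀ p ε, H (p, ε) = ε • H' (p, ε) := by
  let L₀ : E × ℝ →L[ℝ] E × ℝ := (ContinuousLinearMap.inl ℝ E ℝ).comp (ContinuousLinearMap.fst ℝ E ℝ)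
  let L₁ : E × ℝ →L[ℝ] E × ℝ := (ContinuousLinearMap.inr ℝ E ℝ).comp (ContinuousLinearMap.snd ℝ E ℝ)
  let ev : (E × ℝ →L[ℝ] F) →L[ℝ] F := ContinuousLinearMap.apply ℝ F ((0 : E), (1 : ℝ))
  refine ⟨‖ev‖ * (1 + (‖L₀‖ + ‖L₁‖)) ^ n, fun B H hH h0 => ?_⟩
  have hG : CkBound n (‖ev‖ * B) (fun q => ev (fderiv ℝ H q)) := hH.fderiv_right.clm_comp ev
  -- The quotient is the mean of `∂H/∂ε` over the segment from `(p, 0)` to `(p, ε)`, which `L₀ q + s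
  -- • L₁ q` traces out.
  refine ⟨fun q => ∫ s in Icc (0 : ℝ) 1, ev (fderiv ℝ H (L₀ q + s • L₁ q)), ?_, fun p ε => ?_⟩
  · refine (hG.average L₀ L₁).mono_right (le_of_eq (by ring))
  · have h := setIntegral_Icc_fderiv_apply_eq (hH.1.of_le (by norm_cast; omega)) (p, (0 : ℝ)) (0, ε)
    simp only [Prod.mk_add_mk, add_zero, zero_add, h0, sub_zero] at h
    rw [← h, ← integral_smul]
    congr 1
    ext s
    have : ((0 : E), ε) = ε • ((0 : E), (1 : ℝ)) := by simp
    nth_rw 2 [this]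
    rw [map_smul]
    simp [L₀, L₁, ev]

/-- A function that is even in `ε` and vanishes for `ε = 0` is divisible by `ε²`. -/
theorem CkBound.exists_div_sq [CompleteSpace F] (n : ℕ) : ∃ C, ∀ (B : ℝ) (H : E × ℝ → F),
    CkBound (n + 2) B H → (∀ p, H (p, 0) = 0) → (∀ p ε, H (p, -ε) = H (p, ε)) →
    ∃ S : E × ℝ → F, CkBound n (C * B) S ∧ ∀ p ε, H (p, ε) = ε ^ 2 • S (p, ε) := by
  obtain ⟨C₁, hC₁⟩ := CkBound.exists_div (E := E) (F := F) (n + 1)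
  obtain ⟨C₂, hC₂⟩ := CkBound.exists_div (E := E) (F := F) n
  refine ⟨C₂ * C₁, fun B H hH h0 heven => ?_⟩
  obtain ⟨H', hH', hHH'⟩ := hC₁ B H hH h0
  have hodd : ∀ p ε, ε ≠ 0 → H' (p, -ε) = - H' (p, ε) := by
    intro p ε hε
    have h := heven p ε
    rw [hHH', hHH', neg_smul, ← smul_neg] at h
    rw [← smul_right_injective F hε h, neg_neg]
  -- Oddness of the first quotient is known only for `ε ≠ 0`; letting `ε → 0` in it gives `H' (p, 0)
  -- = -H' (p, 0)`, so a second division is possible.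
  have hz : ∀ p, H' (p, 0) = 0 := by
    intro p
    have hc : Continuous fun ε : ℝ => H' (p, ε) := hH'.1.continuous.comp (by fun_prop)
    have hc' : Continuous fun ε : ℝ => H' (p, -ε) := hc.comp continuous_neg
    have l1 : Tendsto (fun ε : ℝ => H' (p, ε)) (𝓝[≠] 0) (𝓝 (H' (p, 0))) :=
      (hc.tendsto 0).mono_left nhdsWithin_le_nhds
    have l2 : Tendsto (fun ε : ℝ => H' (p, -ε)) (𝓝[≠] 0) (𝓝 (H' (p, 0))) := by
      have := (hc'.tendsto 0).mono_left (nhdsWithin_le_nhds (s := {0}ᶜ))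
      simpa using this
    have l3 := l1.neg.congr' (f₂ := fun ε : ℝ => H' (p, -ε))
      (eventually_mem_nhdsWithin.mono fun ε hε => (hodd p ε hε).symm)
    have h2 : (2 : ℝ) • H' (p, 0) = 0 := by
      rw [two_smul]
      exact eq_neg_iff_add_eq_zero.1 (tendsto_nhds_unique l2 l3)
    simpa using h2
  obtain ⟨S, hS, hHS⟩ := hC₂ (C₁ * B) H' hH' hz
  refine ⟨S, by rwa [mul_assoc], fun p ε => ?_⟩
  rw [hHH', hHS, smul_smul, sq]

end Hadamard

end CoarseRicci

end

noncomputable section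

namespace CoarseRicci

/-! ### Gaussian decay against polynomial growth -/

section GaussianBounds

/-- Half of the Gaussian exponent pays for the polynomial: the power is at most a multiple of `exp
(3 + x)`, and `x ≤ a/2 x² + 1/(2a)` by completing the square. The base `3 + x` leaves room for all
the factors `1 + ‖L‖` with `‖L‖ ≤ 1 + ‖u‖` that occur later. -/
theorem exists_pow_mul_exp_le (k : ℕ) {a : ℝ} (ha : 0 < a) :
    ∃ C > 0, ∀ x : ℝ, 0 ≤ x →
      (3 + x) ^ k * Real.exp (-(a * x ^ 2)) ≤ C * Real.exp (-(a / 2 * x ^ 2)) := by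
  refine ⟨k.factorial * Real.exp (3 + 1 / (2 * a)), by positivity, fun x hx => ?_⟩
  have h1 : (3 + x) ^ k ≤ k.factorial * Real.exp (3 + x) := by
    have := Real.pow_div_factorial_le_exp (3 + x) (by linarith) k
    rwa [div_le_iff₀ (by positivity), mul_comm] at this
  have h2 : x ≤ a / 2 * x ^ 2 + 1 / (2 * a) := by
    have h : a / 2 * x ^ 2 + 1 / (2 * a) - x = (a * x - 1) ^ 2 / (2 * a) := by
      field_simp
      ring
    have : 0 ≤ (a * x - 1) ^ 2 / (2 * a) := by positivity
    linarith
  calc (3 + x) ^ k * Real.exp (-(a * x ^ 2))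
      ≤ k.factorial * Real.exp (3 + x) * Real.exp (-(a * x ^ 2)) := by gcongr
    _ = k.factorial * Real.exp (3 + x - a * x ^ 2) := by
        rw [mul_assoc, ← Real.exp_add]; ring_nf
    _ ≤ k.factorial * Real.exp (3 + 1 / (2 * a) + -(a / 2 * x ^ 2)) := by
        gcongr
        linarith
    _ = _ := by rw [Real.exp_add]; ring

theorem integrable_exp_neg_mul_norm_sq {d : ℕ} {a : ℝ} (ha : 0 < a) :
    Integrable fun u : EuclideanSpace ℝ (Fin d) => Real.exp (-(a * ‖u‖ ^ 2)) := by
  have h := GaussianFourier.integrable_cexp_neg_mul_sq_norm_add (V := EuclideanSpace ℝ (Fin d))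
    (b := (a : ℂ)) (by simpa using ha) 0 0
  refine h.re.congr (Eventually.of_forall fun u => ?_)
  simp only [zero_mul, add_zero]
  have : (-(a : ℂ) * (‖u‖ : ℂ) ^ 2) = ((-(a * ‖u‖ ^ 2) : ℝ) : ℂ) := by push_cast; ring
  rw [this]
  exact Complex.exp_ofReal_re _

end GaussianBounds

/-! ### Parametrizations of bounded geometry -/

section Tame

variable {d N : ℕ}

/-- Immersions `ℝᵈ → ℝᴺ` with bounded derivatives that are bi-Lipschitz onto their image. -/
structure Tame (P : EuclideanSpace ℝ (Fin d) → EuclideanSpace ℝ (Fin N)) : Prop where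
  contDiff : ContDiff ℝ ∞ P
  bound : ∀ n, ∃ B, CkBound n B (fderiv ℝ P)
  lower : ∃ c > 0, ∀ z w, c * ‖z - w‖ ≤ ‖P z - P w‖

/-- The Gram matrix of a linear map. -/
def gram (T : EuclideanSpace ℝ (Fin d) →L[ℝ] EuclideanSpace ℝ (Fin N)) :
    Matrix (Fin d) (Fin d) ℝ :=
  Matrix.of fun i j => inner ℝ (T (EuclideanSpace.single i 1)) (T (EuclideanSpace.single j 1))

theorem inducedMetric_eq_gram (P : EuclideanSpace ℝ (Fin d) → EuclideanSpace ℝ (Fin N))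
    (z : EuclideanSpace ℝ (Fin d)) : inducedMetric P z = gram (fderiv ℝ P z) := rfl

theorem sum_smul_single (u : EuclideanSpace ℝ (Fin d)) :
    ∑ i, u i • EuclideanSpace.single i (1 : ℝ) = u := by
  ext j
  simp [Finset.sum_apply, Pi.single_apply]

theorem inner_map_map_eq_gram (T : EuclideanSpace ℝ (Fin d) →L[ℝ] EuclideanSpace ℝ (Fin N))
    (u v : EuclideanSpace ℝ (Fin d)) :
    inner ℝ (T u) (T v) = ∑ i, ∑ j, u i * gram T i j * v j := by
  nth_rw 1 [← sum_smul_single u, ← sum_smul_single v]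
  simp only [map_sum, map_smul, sum_inner, inner_sum, inner_smul_left, inner_smul_right, gram,
    Matrix.of_apply]
  rw [Finset.sum_comm]
  refine Finset.sum_congr rfl fun i _ => ?_
  rw [Finset.mul_sum]
  refine Finset.sum_congr rfl fun j _ => ?_
  simp only [conj_trivial]
  ring

theorem gram_posDef {T : EuclideanSpace ℝ (Fin d) →L[ℝ] EuclideanSpace ℝ (Fin N)}
    (hT : Function.Injective T) : (gram T).PosDef := by
  refine Matrix.PosDef.of_dotProduct_mulVec_pos ?_ fun x hx => ?_
  · ext i j
    simp [gram, real_inner_comm]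
  · have h := inner_map_map_eq_gram T (WithLp.toLp 2 x) (WithLp.toLp 2 x)
    have h2 : star x ⬝ᵥ (gram T).mulVec x = inner ℝ (T (WithLp.toLp 2 x)) (T (WithLp.toLp 2 x)) := by
      rw [h]
      simp [dotProduct, Matrix.mulVec, Finset.mul_sum, mul_assoc]
    rw [h2, real_inner_self_eq_norm_sq]
    have : T (WithLp.toLp 2 x) ≠ 0 := by
      rw [map_ne_zero_iff T hT]
      simpa using hx
    positivity

theorem gram_det_pos {T : EuclideanSpace ℝ (Fin d) →L[ℝ] EuclideanSpace ℝ (Fin N)}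
    (hT : Function.Injective T) : 0 < (gram T).det := (gram_posDef hT).det_pos

theorem contDiff_gram (i j : Fin d) : ContDiff ℝ ∞
    fun T : EuclideanSpace ℝ (Fin d) →L[ℝ] EuclideanSpace ℝ (Fin N) => gram T i j := by
  unfold gram
  simp only [Matrix.of_apply]
  exact ContDiff.inner ℝ (by fun_prop) (by fun_prop)

theorem contDiff_gram_det : ContDiff ℝ ∞
    fun T : EuclideanSpace ℝ (Fin d) →L[ℝ] EuclideanSpace ℝ (Fin N) => (gram T).det := by
  simp only [Matrix.det_apply]
  refine ContDiff.sum fun σ _ => ContDiff.const_smul _ (contDiff_prod fun i _ => contDiff_gram _ _)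

variable {P : EuclideanSpace ℝ (Fin d) → EuclideanSpace ℝ (Fin N)}

/-- The difference quotients in the direction `u` satisfy the bound, and it passes to their limit.
-/
theorem norm_fderiv_apply_ge_of_lower {c : ℝ} {z : EuclideanSpace ℝ (Fin d)}
    (hP : DifferentiableAt ℝ P z) (h : ∀ᶠ w in 𝓝 z, c * ‖z - w‖ ≤ ‖P z - P w‖)
    (u : EuclideanSpace ℝ (Fin d)) : c * ‖u‖ ≤ ‖fderiv ℝ P z u‖ := by
  have h1 : HasDerivAt (fun s : ℝ => z + s • u) u 0 := by
    simpa using ((hasDerivAt_id (0 : ℝ)).smul_const u).const_add z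
  have h2 : HasDerivAt (fun s : ℝ => P (z + s • u)) (fderiv ℝ P z u) 0 := by
    have hP' : HasFDerivAt P (fderiv ℝ P z) (z + (0 : ℝ) • u) := by simpa using hP.hasFDerivAt
    exact hP'.comp_hasDerivAt 0 h1
  have h3 := (hasDerivAt_iff_tendsto_slope.1 h2).norm
  refine ge_of_tendsto h3 ?_
  have h4 : ∀ᶠ s : ℝ in 𝓝 0, c * ‖z - (z + s • u)‖ ≤ ‖P z - P (z + s • u)‖ := by
    have : Tendsto (fun s : ℝ => z + s • u) (𝓝 0) (𝓝 z) := by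
      have := h1.continuousAt.tendsto
      simpa using this
    exact this.eventually h
  filter_upwards [nhdsWithin_le_nhds h4, self_mem_nhdsWithin] with s hs hs0
  have hs0' : 0 < ‖s‖ := norm_pos_iff.2 hs0
  simp only [slope, sub_zero, vsub_eq_sub, zero_smul, add_zero, norm_smul, norm_inv]
  rw [sub_add_cancel_left, norm_neg, norm_smul, norm_sub_rev] at hs
  rw [le_inv_mul_iff₀ hs0']
  linarith

namespace Tame

theorem lower_fderiv (hP : Tame P) : ∃ c > 0, ∀ z u, c * ‖u‖ ≤ ‖fderiv ℝ P z u‖ := by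
  obtain ⟨c, hc, h⟩ := hP.lower
  exact ⟨c, hc, fun z u => norm_fderiv_apply_ge_of_lower
    (hP.contDiff.differentiable (by simp) z) (Eventually.of_forall fun w => h z w) u⟩

theorem injective_fderiv (hP : Tame P) (z : EuclideanSpace ℝ (Fin d)) :
    Function.Injective (fderiv ℝ P z) := by
  obtain ⟨c, hc, h⟩ := hP.lower_fderiv
  refine (injective_iff_map_eq_zero _).2 fun u hu => ?_
  have := h z u
  rw [hu, norm_zero] at this
  exact norm_eq_zero.1 (le_antisymm (nonpos_of_mul_nonpos_right this hc) (norm_nonneg u))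

/-- All differentials of `P` lie in one compact set of injective maps, namely those with a fixed
upper and a fixed lower bound. Smooth functions of the differential, such as `√(gram T).det`,
therefore have bounds uniform in `z`. -/
theorem exists_compact_fderiv_mem (hP : Tame P) :
    ∃ K : Set (EuclideanSpace ℝ (Fin d) →L[ℝ] EuclideanSpace ℝ (Fin N)), IsCompact K ∧
      (∀ T ∈ K, Function.Injective T) ∧ ∀ z, fderiv ℝ P z ∈ K := by
  obtain ⟨c, hc, h⟩ := hP.lower_fderiv
  obtain ⟨B, hB⟩ := hP.bound 0
  refine ⟨Metric.closedBall 0 B ∩ ⋂ u, {T | c * ‖u‖ ≤ ‖T u‖}, ?_, fun T hT => ?_, fun z => ?_⟩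
  · refine (isCompact_closedBall 0 B).inter_right (isClosed_iInter fun u => ?_)
    exact isClosed_le continuous_const (by fun_prop)
  · refine (injective_iff_map_eq_zero _).2 fun u hu => ?_
    have := mem_iInter.1 hT.2 u
    rw [Set.mem_ofPred_eq, hu, norm_zero] at this
    exact norm_eq_zero.1 (le_antisymm (nonpos_of_mul_nonpos_right this hc) (norm_nonneg u))
  · exact ⟨by simpa using hB.norm_le z, mem_iInter.2 fun u => h z u⟩

theorem exists_ckBound_volumeDensity (hP : Tame P) (n : ℕ) :
    ∃ B, CkBound n B (volumeDensity P) := by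
  obtain ⟨K, hK, hKi, hKP⟩ := hP.exists_compact_fderiv_mem
  obtain ⟨B, hB⟩ := hP.bound n
  have hU : IsOpen {T : EuclideanSpace ℝ (Fin d) →L[ℝ] EuclideanSpace ℝ (Fin N) |
      0 < (gram T).det} := isOpen_lt continuous_const contDiff_gram_det.continuous
  obtain ⟨C, hC⟩ := CkBound.exists_comp_of_isCompact (φ := fun T => √(gram T).det) hU
    (fun T hT => ((contDiff_gram_det.contDiffAt).sqrt (ne_of_gt hT)).contDiffWithinAt) hK
    (fun T hT => gram_det_pos (hKi T hT)) n B
  exact ⟨C, hC _ hB hKP⟩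

theorem exists_volumeDensity_ge (hP : Tame P) : ∃ c > 0, ∀ z, c ≤ volumeDensity P z := by
  obtain ⟨K, hK, hKi, hKP⟩ := hP.exists_compact_fderiv_mem
  have hc : ContinuousOn
    (fun T : EuclideanSpace ℝ (Fin d) →L[ℝ] EuclideanSpace ℝ (Fin N) => √(gram T).det) K :=
    (contDiff_gram_det.continuous.sqrt).continuousOn
  obtain ⟨T, hT, hmin⟩ := hK.exists_isMinOn ⟨_, hKP 0⟩ hc
  exact ⟨√(gram T).det, Real.sqrt_pos.2 (gram_det_pos (hKi T hT)), fun z => hmin (hKP z)⟩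

theorem contDiff_volumeDensity (hP : Tame P) : ContDiff ℝ ∞ (volumeDensity P) :=
  contDiff_infty.2 fun n => (hP.exists_ckBound_volumeDensity n).choose_spec.1

end Tame

/-- The averaged derivative `∫₀¹ DP(z + s v) ds` of `P` along the segment from `z` to `z + v`. -/
def meanDeriv (P : EuclideanSpace ℝ (Fin d) → EuclideanSpace ℝ (Fin N))
    (q : EuclideanSpace ℝ (Fin d) × EuclideanSpace ℝ (Fin d)) :
    EuclideanSpace ℝ (Fin d) →L[ℝ] EuclideanSpace ℝ (Fin N) :=
  ∫ s in Icc (0 : ℝ) 1, fderiv ℝ P (q.1 + s • q.2)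

namespace Tame

theorem exists_ckBound_meanDeriv (hP : Tame P) (n : ℕ) : ∃ B, CkBound n B (meanDeriv P) := by
  obtain ⟨B, hB⟩ := hP.bound n
  have h := hB.average (ContinuousLinearMap.fst ℝ (EuclideanSpace ℝ (Fin d)) (EuclideanSpace ℝ (Fin d)))
    (ContinuousLinearMap.snd ℝ (EuclideanSpace ℝ (Fin d)) (EuclideanSpace ℝ (Fin d)))
  exact ⟨_, h⟩

theorem contDiff_meanDeriv (hP : Tame P) : ContDiff ℝ ∞ (meanDeriv P) :=
  contDiff_infty.2 fun n => (hP.exists_ckBound_meanDeriv n).choose_spec.1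

theorem meanDeriv_zero (P : EuclideanSpace ℝ (Fin d) → EuclideanSpace ℝ (Fin N))
    (z : EuclideanSpace ℝ (Fin d)) : meanDeriv P (z, 0) = fderiv ℝ P z := by
  simp [meanDeriv]

theorem meanDeriv_apply (hP : Tame P) (z v : EuclideanSpace ℝ (Fin d)) :
    meanDeriv P (z, v) v = P (z + v) - P z := by
  rw [← setIntegral_Icc_fderiv_apply_eq (hP.contDiff.of_le (by exact_mod_cast le_top)) z v]
  refine ContinuousLinearMap.integral_apply ?_ v
  have hc : Continuous fun s : ℝ => fderiv ℝ P (z + s • v) :=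
    (hP.contDiff.continuous_fderiv (by simp)).comp (by fun_prop)
  exact hc.continuousOn.integrableOn_Icc

/-- The mean derivative is taken along the direction `u` to which it is applied, so `ε` times it is
the chord `P (z + ε • u) - P z`, and the bi-Lipschitz bound can be divided by `|ε|`. This is what
makes the rescaled kernel decay in `u` uniformly in `z` and `ε`. -/
theorem exists_norm_meanDeriv_ge (hP : Tame P) :
    ∃ c > 0, ∀ z u (ε : ℝ), c * ‖u‖ ≤ ‖meanDeriv P (z, ε • u) u‖ := by
  obtain ⟨c, hc, h⟩ := hP.lower
  refine ⟨c, hc, fun z u ε => ?_⟩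
  rcases eq_or_ne ε 0 with rfl | hε
  · rw [zero_smul, meanDeriv_zero]
    exact norm_fderiv_apply_ge_of_lower (hP.contDiff.differentiable (by simp) z)
      (Eventually.of_forall fun w => h z w) u
  · have h1 := hP.meanDeriv_apply z (ε • u)
    have h2 := h (z + ε • u) z
    rw [← h1, map_smul, add_sub_cancel_left, norm_smul, norm_smul] at h2
    have : 0 < ‖ε‖ := norm_pos_iff.2 hε
    have h3 : ‖ε‖ * (c * ‖u‖) ≤ ‖ε‖ * ‖meanDeriv P (z, ε • u) u‖ := by linarith
    exact le_of_mul_le_mul_left h3 this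

end Tame

end Tame

end CoarseRicci

end

noncomputable section

namespace CoarseRicci

/-- The real inner product as a continuous bilinear map. -/
def realInnerCLM (W : Type) [NormedAddCommGroup W] [InnerProductSpace ℝ W] : W →L[ℝ] W →L[ℝ] ℝ :=
  (innerₗ W).mkContinuous₂ 1 fun x y => by simpa using norm_inner_le_norm (𝕜 := ℝ) x y

theorem realInnerCLM_apply {W : Type} [NormedAddCommGroup W] [InnerProductSpace ℝ W] (x y : W) :
    realInnerCLM W x y = inner ℝ x y := rfl

/-! ### The rescaled heat integral, smooth up to `ε = 0` -/

section HeatWeight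

variable {d N : ℕ}

/-- The weight of the heat kernel after the substitution `w = z + ε u`, `t = ε²`; it is smooth in
`(z, ε)`, also for `ε = 0`. -/
def heatWeight (P : EuclideanSpace ℝ (Fin d) → EuclideanSpace ℝ (Fin N))
    (u : EuclideanSpace ℝ (Fin d)) (q : EuclideanSpace ℝ (Fin d) × ℝ) : ℝ :=
  volumeDensity P (q.1 + q.2 • u) * Real.exp (-(1 / 2 * ‖meanDeriv P (q.1, q.2 • u) u‖ ^ 2))

/-- The linear map `(z, ε) ↦ (z, ε u)`. -/
def scaleMap (u : EuclideanSpace ℝ (Fin d)) :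
    EuclideanSpace ℝ (Fin d) × ℝ →L[ℝ] EuclideanSpace ℝ (Fin d) × EuclideanSpace ℝ (Fin d) :=
  (ContinuousLinearMap.fst ℝ _ ℝ).prod ((ContinuousLinearMap.snd ℝ _ ℝ).smulRight u)

theorem scaleMap_apply (u : EuclideanSpace ℝ (Fin d)) (q : EuclideanSpace ℝ (Fin d) × ℝ) :
    scaleMap u q = (q.1, q.2 • u) := rfl

theorem norm_scaleMap_le (u : EuclideanSpace ℝ (Fin d)) : ‖scaleMap u‖ ≤ 1 + ‖u‖ := by
  refine ContinuousLinearMap.opNorm_le_bound _ (by positivity) fun q => ?_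
  rw [scaleMap_apply, Prod.norm_def, norm_smul]
  have h1 := norm_fst_le q
  have h2 := norm_snd_le q
  have h3 := norm_nonneg u
  have h4 := norm_nonneg q
  refine max_le (by nlinarith) (by nlinarith [mul_le_mul_of_nonneg_right h2 h3])

/-- The linear map `(z, ε) ↦ z + ε u`. -/
def shiftMap (u : EuclideanSpace ℝ (Fin d)) :
    EuclideanSpace ℝ (Fin d) × ℝ →L[ℝ] EuclideanSpace ℝ (Fin d) :=
  ContinuousLinearMap.fst ℝ _ ℝ + (ContinuousLinearMap.snd ℝ _ ℝ).smulRight u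

theorem shiftMap_apply (u : EuclideanSpace ℝ (Fin d)) (q : EuclideanSpace ℝ (Fin d) × ℝ) :
    shiftMap u q = q.1 + q.2 • u := rfl

theorem norm_shiftMap_le (u : EuclideanSpace ℝ (Fin d)) : ‖shiftMap u‖ ≤ 1 + ‖u‖ := by
  refine ContinuousLinearMap.opNorm_le_bound _ (by positivity) fun q => ?_
  rw [shiftMap_apply]
  refine (norm_add_le _ _).trans ?_
  rw [norm_smul]
  have h1 := norm_fst_le q
  have h2 := norm_snd_le q
  have h3 := norm_nonneg u
  nlinarith [mul_le_mul_of_nonneg_right h2 h3]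

variable {P : EuclideanSpace ℝ (Fin d) → EuclideanSpace ℝ (Fin N)}

/-- Both factors depend on `u` and `ε` through `ε • u` and the norm of a vector linear in `u`. This
is the source of the evenness of `heatNum`. -/
theorem heatWeight_neg (P : EuclideanSpace ℝ (Fin d) → EuclideanSpace ℝ (Fin N))
    (u z : EuclideanSpace ℝ (Fin d)) (ε : ℝ) :
    heatWeight P (-u) (z, -ε) = heatWeight P u (z, ε) := by
  simp [heatWeight]

theorem contDiff_heatWeight (hP : Tame P) : ContDiff ℝ ∞ (Function.uncurry (heatWeight P)) := by
  have h1 := hP.contDiff_volumeDensity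
  have h2 := hP.contDiff_meanDeriv
  have h3 : ContDiff ℝ ∞ fun x : EuclideanSpace ℝ (Fin d) × EuclideanSpace ℝ (Fin d) × ℝ =>
      meanDeriv P (x.2.1, x.2.2 • x.1) x.1 :=
    (h2.comp (by fun_prop : ContDiff ℝ ∞ fun x : EuclideanSpace ℝ (Fin d) ×
      EuclideanSpace ℝ (Fin d) × ℝ => (x.2.1, x.2.2 • x.1))).clm_apply contDiff_fst
  refine (h1.comp (by fun_prop : ContDiff ℝ ∞ fun x : EuclideanSpace ℝ (Fin d) ×
      EuclideanSpace ℝ (Fin d) × ℝ => x.2.1 + x.2.2 • x.1)).mul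
    (Real.contDiff_exp.comp (contDiff_const.mul (h3.norm_sq ℝ)).neg)

/-- Differentiating in `(z, ε)` produces powers of `‖u‖` through the chain rule for `ε • u`, but the
exponential keeps its decay by `exists_norm_meanDeriv_ge`. Half of the exponent is spent on those
powers. -/
theorem exists_ckBound_heatWeight (hP : Tame P) (n : ℕ) :
    ∃ C > 0, ∃ a > 0, ∀ (u : EuclideanSpace ℝ (Fin d)),
      CkBound n (C * Real.exp (-(a * ‖u‖ ^ 2))) (heatWeight P u) := by
  obtain ⟨c, hc, hlow⟩ := hP.exists_norm_meanDeriv_ge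
  obtain ⟨B₁, hB₁⟩ := hP.exists_ckBound_meanDeriv n
  obtain ⟨B₂, hB₂⟩ := hP.exists_ckBound_volumeDensity n
  have hB₁0 := hB₁.nonneg
  have hB₂0 := hB₂.nonneg
  set κ : ℝ := ‖realInnerCLM (EuclideanSpace ℝ (Fin N))‖ with hκ
  have hκ0 : 0 ≤ κ := ContinuousLinearMap.opNorm_nonneg (realInnerCLM (EuclideanSpace ℝ (Fin N)))
  set A : ℝ := 1 + 1 / 2 * (κ * 2 ^ n * B₁ ^ 2) with hA
  have hA1 : 1 ≤ A := by rw [hA]; nlinarith [show 0 ≤ κ * 2 ^ n * B₁ ^ 2 by positivity]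
  -- The exponent in the weight has derivatives of size `(3 + ‖u‖) ^ (2 * (n + 1))`, which enter to
  -- the power `n` in `CkBound.exp`; the further `n` comes from the volume density at `z + ε • u`.
  obtain ⟨C, hC, hCx⟩ := exists_pow_mul_exp_le (2 * (n + 1) * n + n)
    (a := c ^ 2 / 2) (by positivity)
  refine ⟨2 ^ n * B₂ * (n.factorial * A ^ n) * C + 1, by positivity, c ^ 2 / 2 / 2, by positivity,
    fun u => ?_⟩
  have hy : 1 ≤ 3 + ‖u‖ := by linarith [norm_nonneg u]
  have h1 : CkBound n (B₁ * (3 + ‖u‖) ^ (n + 1))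
      (fun q : EuclideanSpace ℝ (Fin d) × ℝ => meanDeriv P (q.1, q.2 • u) u) := by
    have h := (hB₁.comp_clm (scaleMap u)).clm_comp
      (ContinuousLinearMap.apply ℝ (EuclideanSpace ℝ (Fin N)) u)
    refine h.mono_right ?_
    have h2 : ‖ContinuousLinearMap.apply ℝ (EuclideanSpace ℝ (Fin N)) u‖ ≤ 3 + ‖u‖ := by
      refine ContinuousLinearMap.opNorm_le_bound _ (by positivity) fun T => ?_
      have := T.le_opNorm u
      rw [ContinuousLinearMap.apply_apply]
      nlinarith [norm_nonneg T]
    have h3 : 1 + ‖scaleMap u‖ ≤ 3 + ‖u‖ := by linarith [norm_scaleMap_le u]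
    calc _ ≤ (3 + ‖u‖) * (B₁ * (3 + ‖u‖) ^ n) := by gcongr
      _ = _ := by ring
  have h2 : CkBound n (A * (3 + ‖u‖) ^ (2 * (n + 1))) (fun q : EuclideanSpace ℝ (Fin d) × ℝ =>
      -(1 / 2 * ‖meanDeriv P (q.1, q.2 • u) u‖ ^ 2)) := by
    have h := (((h1.bilinear (realInnerCLM _) h1).const_mul (1 / 2)).neg)
    simp only [realInnerCLM_apply, real_inner_self_eq_norm_sq] at h
    refine h.mono_right ?_
    rw [← hκ, abs_of_pos (by norm_num : (0 : ℝ) < 1 / 2)]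
    calc _ = (1 / 2 * (κ * 2 ^ n * B₁ ^ 2)) * (3 + ‖u‖) ^ (2 * (n + 1)) := by ring
      _ ≤ _ := by gcongr; rw [hA]; linarith
  have h3 := CkBound.exp (M := -(c ^ 2 / 2 * ‖u‖ ^ 2)) h2.1 (fun q => ?_)
    (one_le_mul_of_one_le_of_one_le hA1 (one_le_pow₀ hy)) (fun i hi _ x => h2.2 i hi x)
  swap
  · have h := hlow q.1 u q.2
    have := pow_le_pow_left₀ (by positivity) h 2
    rw [mul_pow] at this
    linarith
  have h4 := (hB₂.comp_clm (shiftMap u)).mul h3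
  refine h4.mono_right ?_
  have h5 : 1 + ‖shiftMap u‖ ≤ 3 + ‖u‖ := by linarith [norm_shiftMap_le u]
  calc 2 ^ n * (B₂ * (1 + ‖shiftMap u‖) ^ n) * (n.factorial * Real.exp (-(c ^ 2 / 2 * ‖u‖ ^ 2)) *
        (A * (3 + ‖u‖) ^ (2 * (n + 1))) ^ n)
      ≤ 2 ^ n * (B₂ * (3 + ‖u‖) ^ n) * (n.factorial * Real.exp (-(c ^ 2 / 2 * ‖u‖ ^ 2)) *
        (A * (3 + ‖u‖) ^ (2 * (n + 1))) ^ n) := by gcongr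
    _ = 2 ^ n * B₂ * (n.factorial * A ^ n) * ((3 + ‖u‖) ^ (2 * (n + 1) * n + n) *
          Real.exp (-(c ^ 2 / 2 * ‖u‖ ^ 2))) := by rw [mul_pow, ← pow_mul, pow_add]; ring
    _ ≤ 2 ^ n * B₂ * (n.factorial * A ^ n) * (C * Real.exp (-(c ^ 2 / 2 / 2 * ‖u‖ ^ 2))) := by
        have := hCx _ (norm_nonneg u)
        gcongr ?_ * ?_
    _ ≤ _ := by
        rw [← mul_assoc]
        gcongr
        linarith

/-- The rescaled total mass of the heat kernel. -/
def heatDen (P : EuclideanSpace ℝ (Fin d) → EuclideanSpace ℝ (Fin N))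
    (q : EuclideanSpace ℝ (Fin d) × ℝ) : ℝ := ∫ u, heatWeight P u q

/-- The rescaled integral of `h(w, δ) - h(z, δ)` against the heat kernel. -/
def heatNum (P : EuclideanSpace ℝ (Fin d) → EuclideanSpace ℝ (Fin N))
    (h : EuclideanSpace ℝ (Fin d) × ℝ → ℝ) (q : (EuclideanSpace ℝ (Fin d) × ℝ) × ℝ) : ℝ :=
  ∫ u, (h (q.1.1 + q.2 • u, q.1.2) - h q.1) * heatWeight P u (q.1.1, q.2)

theorem integrable_heatWeight (hP : Tame P) (q : EuclideanSpace ℝ (Fin d) × ℝ) :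
    Integrable fun u => heatWeight P u q := by
  obtain ⟨C, -, a, ha, h⟩ := exists_ckBound_heatWeight hP 0
  exact integrable_partial ((contDiff_heatWeight hP).of_le (by simp))
    ((integrable_exp_neg_mul_norm_sq ha).const_mul C) (Eventually.of_forall h) q

theorem exists_ckBound_heatDen (hP : Tame P) (n : ℕ) : ∃ B, CkBound n B (heatDen P) := by
  obtain ⟨C, -, a, ha, h⟩ := exists_ckBound_heatWeight hP n
  exact ⟨_, CkBound.integral ((contDiff_heatWeight hP).of_le (by exact_mod_cast le_top))
    ((integrable_exp_neg_mul_norm_sq ha).const_mul C) (Eventually.of_forall h)⟩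

theorem exists_heatDen_ge (hP : Tame P) : ∃ c > 0, ∀ q, c ≤ heatDen P q := by
  obtain ⟨c, hc, h⟩ := hP.exists_volumeDensity_ge
  obtain ⟨B, hB⟩ := hP.exists_ckBound_meanDeriv 0
  -- From `‖meanDeriv P (z, ε • u) u‖ ≤ B * ‖u‖` the weight dominates a fixed Gaussian; the summand
  -- `1` keeps that Gaussian integrable if `B = 0`.
  have ha : (0 : ℝ) < 1 / 2 * (B ^ 2 + 1) := by positivity
  have hi := integrable_exp_neg_mul_norm_sq (d := d) ha
  refine ⟨c * ∫ u : EuclideanSpace ℝ (Fin d), Real.exp (-(1 / 2 * (B ^ 2 + 1) * ‖u‖ ^ 2)),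
    mul_pos hc (integral_exp_pos hi), fun q => ?_⟩
  rw [← integral_const_mul]
  refine integral_mono (hi.const_mul c) (integrable_heatWeight hP q) fun u => ?_
  have h1 := h (q.1 + q.2 • u)
  have h2 : ‖meanDeriv P (q.1, q.2 • u) u‖ ^ 2 ≤ (B ^ 2 + 1) * ‖u‖ ^ 2 := by
    have h3 : ‖meanDeriv P (q.1, q.2 • u) u‖ ≤ B * ‖u‖ :=
      (ContinuousLinearMap.le_opNorm _ _).trans (by gcongr; exact hB.norm_le _)
    have := pow_le_pow_left₀ (norm_nonneg _) h3 2
    nlinarith [sq_nonneg ‖u‖]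
  simp only [heatWeight]
  exact mul_le_mul h1 (Real.exp_le_exp.2 (by linarith)) (Real.exp_pos _).le (by linarith)

theorem heatDen_pos (hP : Tame P) (q : EuclideanSpace ℝ (Fin d) × ℝ) : 0 < heatDen P q := by
  obtain ⟨c, hc, h⟩ := exists_heatDen_ge hP
  exact hc.trans_le (h q)

theorem exists_ckBound_inv_heatDen (hP : Tame P) (n : ℕ) :
    ∃ B, CkBound n B fun q => (heatDen P q)⁻¹ := by
  obtain ⟨B, hB⟩ := exists_ckBound_heatDen hP n
  obtain ⟨c, hc, h⟩ := exists_heatDen_ge hP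
  obtain ⟨C, hC⟩ := CkBound.exists_comp_of_isCompact (φ := fun x : ℝ => x⁻¹) (U := Ioi 0)
    (K := Icc c B) isOpen_Ioi
    (fun x hx => (contDiffAt_inv ℝ (ne_of_gt hx)).contDiffWithinAt) isCompact_Icc
    (fun x hx => hc.trans_le hx.1) n B
  exact ⟨C, hC _ hB fun q => ⟨h q, (le_abs_self _).trans (hB.norm_le q)⟩⟩

/-- The linear map `((z, δ), ε) ↦ (z + ε u, δ)`. -/
def shiftMapParam (u : EuclideanSpace ℝ (Fin d)) :
    (EuclideanSpace ℝ (Fin d) × ℝ) × ℝ →L[ℝ] EuclideanSpace ℝ (Fin d) × ℝ :=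
  ContinuousLinearMap.fst ℝ _ ℝ + (ContinuousLinearMap.snd ℝ _ ℝ).smulRight (u, (0 : ℝ))

theorem shiftMapParam_apply (u : EuclideanSpace ℝ (Fin d))
    (q : (EuclideanSpace ℝ (Fin d) × ℝ) × ℝ) :
    shiftMapParam u q = (q.1.1 + q.2 • u, q.1.2) := by
  ext <;> simp [shiftMapParam]

theorem norm_shiftMapParam_le (u : EuclideanSpace ℝ (Fin d)) : ‖shiftMapParam u‖ ≤ 1 + ‖u‖ := by
  refine ContinuousLinearMap.opNorm_le_bound _ (by positivity) fun q => ?_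
  have : shiftMapParam u q = q.1 + q.2 • (u, (0 : ℝ)) := rfl
  rw [this]
  refine (norm_add_le _ _).trans ?_
  rw [norm_smul]
  have h1 := norm_fst_le q
  have h2 := norm_snd_le q
  have h3 : ‖(u, (0 : ℝ))‖ = ‖u‖ := by simp [Prod.norm_def]
  rw [h3]
  nlinarith [mul_le_mul_of_nonneg_right h2 (norm_nonneg u)]

/-- The linear map `((z, δ), ε) ↦ (z, ε)`. -/
def forgetParam : (EuclideanSpace ℝ (Fin d) × ℝ) × ℝ →L[ℝ] EuclideanSpace ℝ (Fin d) × ℝ :=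
  ((ContinuousLinearMap.fst ℝ _ ℝ).comp (ContinuousLinearMap.fst ℝ _ ℝ)).prod
    (ContinuousLinearMap.snd ℝ _ ℝ)

theorem forgetParam_apply (q : (EuclideanSpace ℝ (Fin d) × ℝ) × ℝ) :
    forgetParam q = (q.1.1, q.2) := rfl

theorem contDiff_heatNum_integrand (hP : Tame P) {n : ℕ} {h : EuclideanSpace ℝ (Fin d) × ℝ → ℝ}
    (hh : ContDiff ℝ n h) :
    ContDiff ℝ n (Function.uncurry fun (u : EuclideanSpace ℝ (Fin d))
      (q : (EuclideanSpace ℝ (Fin d) × ℝ) × ℝ) =>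
      (h (q.1.1 + q.2 • u, q.1.2) - h q.1) * heatWeight P u (q.1.1, q.2)) := by
  have h1 : ContDiff ℝ n (Function.uncurry (heatWeight P)) :=
    (contDiff_heatWeight hP).of_le (by exact_mod_cast le_top)
  have h2 : ContDiff ℝ n fun x : EuclideanSpace ℝ (Fin d) × (EuclideanSpace ℝ (Fin d) × ℝ) × ℝ =>
      (x.2.1.1 + x.2.2 • x.1, x.2.1.2) := by fun_prop
  have h3 : ContDiff ℝ n fun x : EuclideanSpace ℝ (Fin d) × (EuclideanSpace ℝ (Fin d) × ℝ) × ℝ =>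
      (x.1, (x.2.1.1, x.2.2)) := by fun_prop
  have h4 : ContDiff ℝ n fun x : EuclideanSpace ℝ (Fin d) × (EuclideanSpace ℝ (Fin d) × ℝ) × ℝ =>
      x.2.1 := by fun_prop
  have h5 := ((hh.comp h2).sub (hh.comp h4)).mul (h1.comp h3)
  simp only [Function.comp_def, Function.uncurry_def] at h5
  simp only [Function.uncurry_def]
  exact h5

theorem exists_ckBound_heatNum_integrand (hP : Tame P) (n : ℕ) :
    ∃ C, 0 ≤ C ∧ ∃ a > 0, ∀ (B : ℝ) (h : EuclideanSpace ℝ (Fin d) × ℝ → ℝ), CkBound n B h →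
      ∀ u, CkBound n (B * (C * Real.exp (-(a * ‖u‖ ^ 2))))
        fun q : (EuclideanSpace ℝ (Fin d) × ℝ) × ℝ =>
          (h (q.1.1 + q.2 • u, q.1.2) - h q.1) * heatWeight P u (q.1.1, q.2) := by
  obtain ⟨C, hC, a, ha, hW⟩ := exists_ckBound_heatWeight hP n
  obtain ⟨C', hC', hCx⟩ := exists_pow_mul_exp_le n ha
  set κ : ℝ := (1 + ‖forgetParam (d := d)‖) ^ n
  set κ' : ℝ := (1 + ‖ContinuousLinearMap.fst ℝ (EuclideanSpace ℝ (Fin d) × ℝ) ℝ‖) ^ n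
  refine ⟨2 ^ n * (1 + κ') * C * κ * C', by positivity, a / 2, by positivity, fun B h hh u => ?_⟩
  have hB := hh.nonneg
  have h1 := hh.comp_clm (shiftMapParam u)
  have h2 := hh.comp_clm (ContinuousLinearMap.fst ℝ (EuclideanSpace ℝ (Fin d) × ℝ) ℝ)
  have h3 := (hW u).comp_clm forgetParam
  have h4 := (h1.sub h2).mul h3
  simp only [shiftMapParam_apply, forgetParam_apply, ContinuousLinearMap.coe_fst'] at h4
  refine h4.mono_right ?_
  have h5 : 1 + ‖shiftMapParam u‖ ≤ 3 + ‖u‖ := by linarith [norm_shiftMapParam_le u]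
  have h6 : (1 : ℝ) ≤ (3 + ‖u‖) ^ n := one_le_pow₀ (by linarith [norm_nonneg u])
  calc 2 ^ n * (B * (1 + ‖shiftMapParam u‖) ^ n + B * κ') *
        (C * Real.exp (-(a * ‖u‖ ^ 2)) * κ)
      ≤ 2 ^ n * (B * (3 + ‖u‖) ^ n + B * κ' * (3 + ‖u‖) ^ n) *
        (C * Real.exp (-(a * ‖u‖ ^ 2)) * κ) := by
        have : B * κ' ≤ B * κ' * (3 + ‖u‖) ^ n := le_mul_of_one_le_right (by positivity) h6
        gcongr
    _ = B * (2 ^ n * (1 + κ') * C * κ * ((3 + ‖u‖) ^ n * Real.exp (-(a * ‖u‖ ^ 2)))) := by ring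
    _ ≤ B * (2 ^ n * (1 + κ') * C * κ * (C' * Real.exp (-(a / 2 * ‖u‖ ^ 2)))) := by
        have := hCx _ (norm_nonneg u)
        gcongr ?_ * (?_ * ?_)
    _ = _ := by ring

/-- The extra variable `δ` on which `h` may depend is carried along as a parameter, which later
allows operators with the same `ε` to be composed. The bound is linear in that of `h`, and this
linearity is what the final constant inherits. -/
theorem exists_ckBound_heatNum (hP : Tame P) (n : ℕ) :
    ∃ C, ∀ (B : ℝ) (h : EuclideanSpace ℝ (Fin d) × ℝ → ℝ), CkBound n B h →
      CkBound n (C * B) (heatNum P h) := by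
  obtain ⟨C, -, a, ha, hW⟩ := exists_ckBound_heatNum_integrand hP n
  refine ⟨∫ u : EuclideanSpace ℝ (Fin d), C * Real.exp (-(a * ‖u‖ ^ 2)), fun B h hh => ?_⟩
  have h1 := CkBound.integral (contDiff_heatNum_integrand hP hh.1)
    (((integrable_exp_neg_mul_norm_sq ha).const_mul C).const_mul B)
    (Eventually.of_forall (hW B h hh))
  rw [integral_const_mul, mul_comm] at h1
  exact h1

theorem heatNum_zero (P : EuclideanSpace ℝ (Fin d) → EuclideanSpace ℝ (Fin N))
    (h : EuclideanSpace ℝ (Fin d) × ℝ → ℝ) (p : EuclideanSpace ℝ (Fin d) × ℝ) :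
    heatNum P h (p, 0) = 0 := by
  simp [heatNum]

theorem heatNum_neg (P : EuclideanSpace ℝ (Fin d) → EuclideanSpace ℝ (Fin N))
    (h : EuclideanSpace ℝ (Fin d) × ℝ → ℝ) (p : EuclideanSpace ℝ (Fin d) × ℝ) (ε : ℝ) :
    heatNum P h (p, -ε) = heatNum P h (p, ε) := by
  simp only [heatNum]
  rw [← integral_neg_eq_self]
  refine integral_congr_ae (Eventually.of_forall fun u => ?_)
  simp only [heatWeight_neg, smul_neg, neg_smul, neg_neg]

/-- Scaling of the integral against the heat kernel. -/
theorem integral_heatKernel_eq (hP : Tame P) (φ : EuclideanSpace ℝ (Fin d) → ℝ)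
    (z : EuclideanSpace ℝ (Fin d)) {ε : ℝ} (hε : ε ≠ 0) :
    ∫ w, φ w * Real.exp (-(dist (P z) (P w) ^ 2) / (2 * ε ^ 2))
        ∂(volume.withDensity fun w => ENNReal.ofReal (volumeDensity P w))
      = |ε| ^ d * ∫ u, φ (z + ε • u) * heatWeight P u (z, ε) := by
  have hm : Measurable fun w => (volumeDensity P w).toNNReal :=
    hP.contDiff_volumeDensity.continuous.measurable.real_toNNReal
  have h1 := integral_withDensity_eq_integral_smul (μ := volume) hm
    (fun w => φ w * Real.exp (-(dist (P z) (P w) ^ 2) / (2 * ε ^ 2)))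
  have h2 : (volume.withDensity fun w => ENNReal.ofReal (volumeDensity P w)) =
      volume.withDensity fun w => ((volumeDensity P w).toNNReal : ℝ≥0∞) := rfl
  rw [h2, h1, ← integral_add_left_eq_self _ z]
  have h3 := Measure.integral_comp_smul (volume : Measure (EuclideanSpace ℝ (Fin d)))
    (fun w => (volumeDensity P (z + w)).toNNReal •
      (φ (z + w) * Real.exp (-(dist (P z) (P (z + w)) ^ 2) / (2 * ε ^ 2)))) ε
  have h4 : |ε| ^ d * |(ε ^ d)⁻¹| = 1 := by
    rw [abs_inv, abs_pow, mul_inv_cancel₀ (by positivity)]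
  rw [finrank_euclideanSpace_fin] at h3
  have h5 : ∀ I : ℝ, I = |ε| ^ d * (|(ε ^ d)⁻¹| • I) := fun I => by
    rw [smul_eq_mul, ← mul_assoc, h4, one_mul]
  rw [h5 (∫ w, (volumeDensity P (z + w)).toNNReal •
      (φ (z + w) * Real.exp (-(dist (P z) (P (z + w)) ^ 2) / (2 * ε ^ 2)))), ← h3]
  congr 1
  refine integral_congr_ae (Eventually.of_forall fun u => ?_)
  simp only [heatWeight]
  rw [NNReal.smul_def, Real.coe_toNNReal _ (show 0 ≤ volumeDensity P (z + ε • u) from Real.sqrt_nonneg _), smul_eq_mul, dist_comm, dist_eq_norm,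
    ← hP.meanDeriv_apply z (ε • u), map_smul, norm_smul]
  -- The squared length of the chord `ε • meanDeriv P (z, ε • u) u` contributes a factor `ε ^ 2`
  -- that cancels the time `t = ε ^ 2`.
  have : -(‖ε‖ * ‖meanDeriv P (z, ε • u) u‖) ^ 2 / (2 * ε ^ 2) =
      -(1 / 2 * ‖meanDeriv P (z, ε • u) u‖ ^ 2) := by
    rw [mul_pow, Real.norm_eq_abs, sq_abs]
    field_simp
  rw [this]
  ring

/-- The heat operator of the parametrized submanifold `P`. -/
def modelHeat (P : EuclideanSpace ℝ (Fin d) → EuclideanSpace ℝ (Fin N)) (t : ℝ) :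
    (EuclideanSpace ℝ (Fin d) → ℝ) → EuclideanSpace ℝ (Fin d) → ℝ :=
  heatOperator (fun z w => dist (P z) (P w))
    (volume.withDensity fun w => ENNReal.ofReal (volumeDensity P w)) t

theorem heatDensity_model_eq (hP : Tame P) (z : EuclideanSpace ℝ (Fin d)) {ε : ℝ} (hε : ε ≠ 0) :
    heatDensity (fun z w => dist (P z) (P w))
      (volume.withDensity fun w => ENNReal.ofReal (volumeDensity P w)) (ε ^ 2) z =
      |ε| ^ d * heatDen P (z, ε) := by
  have h := integral_heatKernel_eq hP (fun _ => 1) z hε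
  simp only [one_mul] at h
  exact h

/-- The Jacobian `|ε| ^ d` of the substitution cancels between the normalization and the integral.
The only singular factor left is `1 / ε ^ 2`. -/
theorem modelHeat_eq (hP : Tame P) (h : EuclideanSpace ℝ (Fin d) × ℝ → ℝ)
    (z : EuclideanSpace ℝ (Fin d)) (δ : ℝ) {ε : ℝ} (hε : ε ≠ 0) :
    modelHeat P (ε ^ 2) (fun w => h (w, δ)) z =
      2 / (ε ^ 2 * heatDen P (z, ε)) * heatNum P h ((z, δ), ε) := by
  have h1 := integral_heatKernel_eq hP (fun w => h (w, δ) - h (z, δ)) z hε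
  unfold modelHeat heatOperator
  rw [heatDensity_model_eq hP z hε, h1, heatNum]
  have h2 := (heatDen_pos hP (z, ε)).ne'
  have h3 : |ε| ≠ 0 := abs_ne_zero.2 hε
  field_simp

end HeatWeight

end CoarseRicci

end

noncomputable section

namespace CoarseRicci

/-! ### Jacobi's formula for the determinant -/

section Determinant

variable {d : ℕ}

/-- The derivative of the determinant at the identity is the trace. -/
theorem hasDerivAt_det_of_eq_one {M : ℝ → Matrix (Fin d) (Fin d) ℝ} {M' : Matrix (Fin d) (Fin d) ℝ}
    (h : ∀ i j, HasDerivAt (fun s => M s i j) (M' i j) 0) (h1 : M 0 = 1) :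
    HasDerivAt (fun s => (M s).det) M'.trace 0 := by
  simp only [Matrix.det_apply]
  have hσ : ∀ σ : Equiv.Perm (Fin d), HasDerivAt
      (fun s => Equiv.Perm.sign σ • ∏ i, M s (σ i) i) (if σ = 1 then M'.trace else 0) 0 := by
    intro σ
    have hp := (HasDerivAt.fun_finsetProd (u := Finset.univ) (fun i _ => h (σ i) i)).const_smul
      (Equiv.Perm.sign σ)
    refine hp.congr_deriv ?_
    split_ifs with hs
    · subst hs
      simp only [Equiv.Perm.sign_one, one_smul, Equiv.Perm.coe_one, id_eq, h1, Matrix.one_apply_eq,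
        Finset.prod_const_one, Matrix.trace, Matrix.diag_apply]
    · rw [Finset.sum_eq_zero, smul_zero]
      intro i _
      obtain ⟨j, hj⟩ : ∃ j, σ j ≠ j := by
        by_contra hcon
        exact hs (Equiv.ext fun j => by simpa using not_not.1 (not_exists.1 hcon j))
      -- A nonidentity permutation moves both `j` and `σ j`, and these differ. Erasing one index
      -- thus leaves an off-diagonal entry of the identity matrix in the product.
      have hz : ∏ k ∈ Finset.univ.erase i, M 0 (σ k) k = 0 := by
        by_cases hij : j = i
        · refine Finset.prod_eq_zero (i := σ j) ?_ ?_
          · rw [← hij]; simpa using hj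
          · rw [h1, Matrix.one_apply_ne]
            exact fun h => hj (σ.injective h)
        · exact Finset.prod_eq_zero (i := j) (by simpa using hij) (by
            rw [h1, Matrix.one_apply_ne hj])
      rw [hz, zero_smul]
  have := HasDerivAt.fun_sum (u := Finset.univ) (fun σ _ => hσ σ)
  simpa using this

/-- Jacobi's formula. -/
theorem hasDerivAt_det {A : ℝ → Matrix (Fin d) (Fin d) ℝ} {A' : Matrix (Fin d) (Fin d) ℝ}
    (h : ∀ i j, HasDerivAt (fun s => A s i j) (A' i j) 0) (h0 : (A 0).det ≠ 0) :
    HasDerivAt (fun s => (A s).det) ((A 0).det * ((A 0)⁻¹ * A').trace) 0 := by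
  have h1 : HasDerivAt (fun s => ((A 0)⁻¹ * A s).det) (((A 0)⁻¹ * A').trace) 0 := by
    refine hasDerivAt_det_of_eq_one (fun i j => ?_) (Matrix.nonsing_inv_mul _ h0.isUnit)
    simp only [Matrix.mul_apply]
    exact HasDerivAt.fun_sum fun k _ => (h k j).const_mul _
  refine (h1.const_mul (A 0).det).congr_of_eventuallyEq (Eventually.of_forall fun s => ?_)
  simp only [Matrix.det_mul]
  rw [← mul_assoc, Matrix.det_nonsing_inv, Ring.mul_inverse_cancel _ h0.isUnit, one_mul]

end Determinant

/-! ### Second and fourth moments of a Gaussian -/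

section GaussianMoments

variable {d N : ℕ}

/-- The vector dual to a linear form with respect to the inner product pulled back by `T`. -/
def gramDual (T : EuclideanSpace ℝ (Fin d) →L[ℝ] EuclideanSpace ℝ (Fin N))
    (l : EuclideanSpace ℝ (Fin d) →L[ℝ] ℝ) : EuclideanSpace ℝ (Fin d) :=
  ∑ i, (∑ k, (gram T)⁻¹ k i * l (EuclideanSpace.single k 1)) • EuclideanSpace.single i (1 : ℝ)

theorem gramDual_apply (T : EuclideanSpace ℝ (Fin d) →L[ℝ] EuclideanSpace ℝ (Fin N))
    (l : EuclideanSpace ℝ (Fin d) →L[ℝ] ℝ) (i : Fin d) :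
    gramDual T l i = ∑ k, (gram T)⁻¹ k i * l (EuclideanSpace.single k 1) := by
  simp [gramDual, Pi.single_apply]

theorem clm_apply_eq_sum {F : Type} [NormedAddCommGroup F] [NormedSpace ℝ F]
    (l : EuclideanSpace ℝ (Fin d) →L[ℝ] F) (u : EuclideanSpace ℝ (Fin d)) :
    l u = ∑ i, u i • l (EuclideanSpace.single i 1) := by
  nth_rw 1 [← sum_smul_single u]
  simp

/-- This writes an arbitrary linear form as `⟨T b, T u⟩`, the factor that Gaussian integration by
parts removes. For the differential of a function, `b` is its gradient in the pulled back metric. -/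
theorem inner_gramDual {T : EuclideanSpace ℝ (Fin d) →L[ℝ] EuclideanSpace ℝ (Fin N)}
    (hT : Function.Injective T) (l : EuclideanSpace ℝ (Fin d) →L[ℝ] ℝ)
    (u : EuclideanSpace ℝ (Fin d)) : inner ℝ (T (gramDual T l)) (T u) = l u := by
  have hinv : (gram T)⁻¹ * gram T = 1 :=
    Matrix.nonsing_inv_mul _ (gram_det_pos hT).ne'.isUnit
  rw [inner_map_map_eq_gram, clm_apply_eq_sum l u, Finset.sum_comm]
  refine Finset.sum_congr rfl fun j _ => ?_
  have h1 : ∀ k, ∑ i, (gram T)⁻¹ k i * gram T i j = if k = j then 1 else 0 := fun k => by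
    rw [← Matrix.mul_apply, hinv, Matrix.one_apply]
  calc ∑ i, gramDual T l i * gram T i j * u j
      = ∑ i, ∑ k, (gram T)⁻¹ k i * gram T i j * (l (EuclideanSpace.single k 1) * u j) := by
        refine Finset.sum_congr rfl fun i _ => ?_
        rw [gramDual_apply, Finset.sum_mul, Finset.sum_mul]
        exact Finset.sum_congr rfl fun k _ => by ring
    _ = ∑ k, (∑ i, (gram T)⁻¹ k i * gram T i j) * (l (EuclideanSpace.single k 1) * u j) := by
        rw [Finset.sum_comm]
        exact Finset.sum_congr rfl fun k _ => by rw [Finset.sum_mul]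
    _ = u j • l (EuclideanSpace.single j 1) := by
        simp only [h1, ite_mul, one_mul, zero_mul, Finset.sum_ite_eq', Finset.mem_univ, if_true,
          smul_eq_mul]
        ring

/-- The trace of a bilinear form with respect to the inner product pulled back by `T`. -/
def gramTrace (T : EuclideanSpace ℝ (Fin d) →L[ℝ] EuclideanSpace ℝ (Fin N))
    (q : EuclideanSpace ℝ (Fin d) →L[ℝ] EuclideanSpace ℝ (Fin d) →L[ℝ] ℝ) : ℝ :=
  ∑ i, ∑ j, (gram T)⁻¹ i j * q (EuclideanSpace.single i 1) (EuclideanSpace.single j 1)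

/-- The unnormalized Gaussian density with covariance given by `T`. -/
def gaussianWeight (T : EuclideanSpace ℝ (Fin d) →L[ℝ] EuclideanSpace ℝ (Fin N))
    (u : EuclideanSpace ℝ (Fin d)) : ℝ := Real.exp (-(1 / 2 * ‖T u‖ ^ 2))

variable {T : EuclideanSpace ℝ (Fin d) →L[ℝ] EuclideanSpace ℝ (Fin N)}

theorem continuous_gaussianWeight : Continuous (gaussianWeight T) := by
  unfold gaussianWeight
  fun_prop

theorem hasFDerivAt_gaussianWeight (u : EuclideanSpace ℝ (Fin d)) :
    HasFDerivAt (gaussianWeight T)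
      (-(gaussianWeight T u) • (realInnerCLM _ (T u)).comp T) u := by
  have h1 : HasFDerivAt (fun u => ‖T u‖ ^ 2) (2 • (realInnerCLM _ (T u)).comp T) u := by
    have h := (T.hasFDerivAt (x := u)).norm_sq
    refine h.congr_fderiv ?_
    ext v
    rfl
  have h2 := ((h1.const_mul (1 / 2)).neg).exp
  refine h2.congr_fderiv ?_
  ext v
  simp [gaussianWeight]

theorem exists_norm_ge_of_injective (hT : Function.Injective T) :
    ∃ c > 0, ∀ u, c * ‖u‖ ≤ ‖T u‖ := by
  obtain ⟨K, hK, h⟩ := (LinearMap.injective_iff_antilipschitz (T : EuclideanSpace ℝ (Fin d) →ₗ[ℝ]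
    EuclideanSpace ℝ (Fin N))).1 hT
  refine ⟨(K : ℝ)⁻¹, by positivity, fun u => ?_⟩
  have h1 := h.le_mul_dist u 0
  simp only [dist_zero_right, map_zero, ContinuousLinearMap.coe_coe] at h1
  rwa [inv_mul_le_iff₀ (by positivity)]

theorem integrable_mul_gaussianWeight (hT : Function.Injective T)
    {G : EuclideanSpace ℝ (Fin d) → ℝ} (hG : Continuous G) {C : ℝ} {k : ℕ}
    (hb : ∀ u, |G u| ≤ C * (3 + ‖u‖) ^ k) : Integrable fun u => G u * gaussianWeight T u := by
  obtain ⟨c, hc, hTc⟩ := exists_norm_ge_of_injective hT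
  obtain ⟨C', hC', hx⟩ := exists_pow_mul_exp_le k (a := 1 / 2 * c ^ 2) (by positivity)
  have hC : 0 ≤ C := by
    have h := (abs_nonneg _).trans (hb 0)
    simp only [norm_zero, add_zero] at h
    exact nonneg_of_mul_nonneg_left h (by positivity)
  refine ((integrable_exp_neg_mul_norm_sq (a := 1 / 2 * c ^ 2 / 2) (by positivity)).const_mul
    (C * C')).mono' (hG.mul continuous_gaussianWeight).aestronglyMeasurable
    (Eventually.of_forall fun u => ?_)
  have h1 : gaussianWeight T u ≤ Real.exp (-(1 / 2 * c ^ 2 * ‖u‖ ^ 2)) := by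
    have := pow_le_pow_left₀ (by positivity) (hTc u) 2
    refine Real.exp_le_exp.2 ?_
    rw [mul_pow] at this
    linarith
  have h0 : 0 < gaussianWeight T u := Real.exp_pos _
  rw [norm_mul, Real.norm_eq_abs, Real.norm_eq_abs, abs_of_pos h0]
  calc |G u| * gaussianWeight T u
      ≤ C * (3 + ‖u‖) ^ k * Real.exp (-(1 / 2 * c ^ 2 * ‖u‖ ^ 2)) := by
        have := hb u
        gcongr
    _ = C * ((3 + ‖u‖) ^ k * Real.exp (-(1 / 2 * c ^ 2 * ‖u‖ ^ 2))) := by ring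
    _ ≤ C * (C' * Real.exp (-(1 / 2 * c ^ 2 / 2 * ‖u‖ ^ 2))) :=
        mul_le_mul_of_nonneg_left (hx _ (norm_nonneg u)) hC
    _ = _ := by ring

/-- Gaussian integration by parts. -/
theorem integral_inner_mul_gaussianWeight (hT : Function.Injective T)
    {G : EuclideanSpace ℝ (Fin d) → ℝ} (hG : ContDiff ℝ 1 G) {C C' : ℝ} {k k' : ℕ}
    (hb : ∀ u, |G u| ≤ C * (3 + ‖u‖) ^ k) (b : EuclideanSpace ℝ (Fin d))
    (hb' : ∀ u, |fderiv ℝ G u b| ≤ C' * (3 + ‖u‖) ^ k') :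
    ∫ u, inner ℝ (T b) (T u) * G u * gaussianWeight T u
      = ∫ u, fderiv ℝ G u b * gaussianWeight T u := by
  have hfd : ∀ u, fderiv ℝ (gaussianWeight T) u b =
      -(inner ℝ (T b) (T u) * gaussianWeight T u) := by
    intro u
    rw [(hasFDerivAt_gaussianWeight u).fderiv]
    simp [realInnerCLM_apply, real_inner_comm, mul_comm]
  have hcG := hG.continuous
  have hcG' : Continuous fun u => fderiv ℝ G u b := (hG.continuous_fderiv one_ne_zero).clm_apply
    continuous_const
  have hC : 0 ≤ C := by
    have h := (abs_nonneg _).trans (hb 0)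
    simp only [norm_zero, add_zero] at h
    exact nonneg_of_mul_nonneg_left h (by positivity)
  have h1 : Integrable fun u => G u * gaussianWeight T u := integrable_mul_gaussianWeight hT hcG hb
  have h2 : Integrable fun u => fderiv ℝ G u b * gaussianWeight T u :=
    integrable_mul_gaussianWeight hT hcG' hb'
  have h3 : Integrable fun u => (inner ℝ (T b) (T u) * G u) * gaussianWeight T u := by
    refine integrable_mul_gaussianWeight hT (by fun_prop) (C := ‖T b‖ * ‖T‖ * C) (k := k + 1)
      fun u => ?_
    rw [abs_mul]
    calc |inner ℝ (T b) (T u)| * |G u| ≤ (‖T b‖ * (‖T‖ * ‖u‖)) * (C * (3 + ‖u‖) ^ k) := by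
          have := hb u
          gcongr
          exact (abs_real_inner_le_norm _ _).trans (by gcongr; exact T.le_opNorm u)
      _ ≤ (‖T b‖ * (‖T‖ * (3 + ‖u‖))) * (C * (3 + ‖u‖) ^ k) := by gcongr; linarith
      _ = _ := by ring
  have key := integral_mul_fderiv_eq_neg_fderiv_mul_of_integrable (μ := volume) (v := b)
    (f := G) (g := gaussianWeight T) h2 ?_ h1
    (fun u _ => hG.differentiable (by simp) u)
    (fun u _ => (hasFDerivAt_gaussianWeight u).differentiableAt)
  · simp only [hfd, mul_neg, integral_neg] at key
    rw [← neg_inj.1 key]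
    congr 1
    ext u
    ring
  · simp only [hfd]
    refine h3.neg.congr (Eventually.of_forall fun u => ?_)
    simp only [Pi.neg_apply]
    ring

theorem abs_clm_le (l : EuclideanSpace ℝ (Fin d) →L[ℝ] ℝ) (u : EuclideanSpace ℝ (Fin d)) :
    |l u| ≤ ‖l‖ * (3 + ‖u‖) ^ 1 := by
  rw [pow_one]
  refine (l.le_opNorm u).trans ?_
  gcongr
  linarith

theorem integral_clm_mul_clm_mul_gaussianWeight (hT : Function.Injective T)
    (l m : EuclideanSpace ℝ (Fin d) →L[ℝ] ℝ) :
    ∫ u, l u * m u * gaussianWeight T u = m (gramDual T l) * ∫ u, gaussianWeight T u := by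
  have h := integral_inner_mul_gaussianWeight hT (G := m) m.contDiff (abs_clm_le m)
    (gramDual T l) (C' := |m (gramDual T l)|) (k' := 0) (by simp)
  simp only [inner_gramDual hT, ContinuousLinearMap.fderiv, integral_const_mul] at h
  exact h

theorem integrable_bilin_mul_gaussianWeight (hT : Function.Injective T)
    (q : EuclideanSpace ℝ (Fin d) →L[ℝ] EuclideanSpace ℝ (Fin d) →L[ℝ] ℝ) :
    Integrable fun u => q u u * gaussianWeight T u := by
  refine integrable_mul_gaussianWeight hT (by fun_prop) (C := ‖q‖) (k := 2) fun u => ?_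
  refine (q.le_opNorm₂ u u).trans ?_
  rw [mul_assoc, ← sq]
  gcongr
  linarith

/-- Expanding the first argument in coordinates reduces the quadratic form to products of two linear
forms, which are integrated by parts. -/
theorem integral_bilin_mul_gaussianWeight (hT : Function.Injective T)
    (q : EuclideanSpace ℝ (Fin d) →L[ℝ] EuclideanSpace ℝ (Fin d) →L[ℝ] ℝ) :
    ∫ u, q u u * gaussianWeight T u = gramTrace T q * ∫ u, gaussianWeight T u := by
  have hq : ∀ u, q u u * gaussianWeight T u =
      ∑ i, EuclideanSpace.proj i u * q (EuclideanSpace.single i 1) u * gaussianWeight T u := by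
    intro u
    rw [← Finset.sum_mul]
    congr 1
    nth_rw 1 [clm_apply_eq_sum q u]
    simp
  simp only [hq]
  rw [integral_finsetSum]
  · simp only [integral_clm_mul_clm_mul_gaussianWeight hT, ← Finset.sum_mul]
    congr 1
    refine Finset.sum_congr rfl fun i _ => ?_
    rw [clm_apply_eq_sum]
    refine Finset.sum_congr rfl fun j _ => ?_
    rw [gramDual_apply]
    simp
  · intro i _
    refine integrable_mul_gaussianWeight hT (by fun_prop)
      (C := ‖(EuclideanSpace.proj i : EuclideanSpace ℝ (Fin d) →L[ℝ] ℝ)‖ *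
        ‖q (EuclideanSpace.single i 1)‖) (k := 2) fun u => ?_
    rw [abs_mul]
    calc _ ≤ (‖(EuclideanSpace.proj i : EuclideanSpace ℝ (Fin d) →L[ℝ] ℝ)‖ * (3 + ‖u‖) ^ 1) *
          (‖q (EuclideanSpace.single i 1)‖ * (3 + ‖u‖) ^ 1) :=
          mul_le_mul (abs_clm_le _ u) (abs_clm_le _ u) (abs_nonneg _) (by positivity)
      _ = _ := by ring

/-- The bilinear form `(v, w) ↦ ⟨a, Q(v, w)⟩`. -/
def innerLeft (a : EuclideanSpace ℝ (Fin N))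
    (Q : EuclideanSpace ℝ (Fin d) →L[ℝ] EuclideanSpace ℝ (Fin d) →L[ℝ] EuclideanSpace ℝ (Fin N)) :
    EuclideanSpace ℝ (Fin d) →L[ℝ] EuclideanSpace ℝ (Fin d) →L[ℝ] ℝ :=
  (ContinuousLinearMap.compL ℝ _ _ _ (realInnerCLM _ a)).comp Q

theorem innerLeft_apply (a : EuclideanSpace ℝ (Fin N))
    (Q : EuclideanSpace ℝ (Fin d) →L[ℝ] EuclideanSpace ℝ (Fin d) →L[ℝ] EuclideanSpace ℝ (Fin N))
    (v w : EuclideanSpace ℝ (Fin d)) : innerLeft a Q v w = inner ℝ a (Q v w) := rfl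

/-- The bilinear form `(v, w) ↦ ⟨T v, R w⟩`. -/
def innerMaps (T R : EuclideanSpace ℝ (Fin d) →L[ℝ] EuclideanSpace ℝ (Fin N)) :
    EuclideanSpace ℝ (Fin d) →L[ℝ] EuclideanSpace ℝ (Fin d) →L[ℝ] ℝ :=
  (realInnerCLM (EuclideanSpace ℝ (Fin N))).bilinearComp T R

theorem innerMaps_apply (T R : EuclideanSpace ℝ (Fin d) →L[ℝ] EuclideanSpace ℝ (Fin N))
    (v w : EuclideanSpace ℝ (Fin d)) : innerMaps T R v w = inner ℝ (T v) (R w) := rfl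

variable {Q : EuclideanSpace ℝ (Fin d) →L[ℝ] EuclideanSpace ℝ (Fin d) →L[ℝ]
  EuclideanSpace ℝ (Fin N)}

theorem abs_cubic_le (u : EuclideanSpace ℝ (Fin d)) :
    |inner ℝ (T u) (Q u u)| ≤ ‖T‖ * ‖Q‖ * (3 + ‖u‖) ^ 3 := by
  calc |inner ℝ (T u) (Q u u)| ≤ (‖T‖ * ‖u‖) * (‖Q‖ * ‖u‖ * ‖u‖) :=
        (abs_real_inner_le_norm _ _).trans
          (mul_le_mul (T.le_opNorm u) (Q.le_opNorm₂ u u) (norm_nonneg _) (by positivity))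
    _ = ‖T‖ * ‖Q‖ * ‖u‖ ^ 3 := by ring
    _ ≤ _ := by gcongr; linarith

theorem integrable_quartic_mul_gaussianWeight (hT : Function.Injective T)
    (l : EuclideanSpace ℝ (Fin d) →L[ℝ] ℝ) :
    Integrable fun u => l u * inner ℝ (T u) (Q u u) * gaussianWeight T u := by
  refine integrable_mul_gaussianWeight hT (by fun_prop) (C := ‖l‖ * (‖T‖ * ‖Q‖)) (k := 4)
    fun u => ?_
  rw [abs_mul]
  calc _ ≤ (‖l‖ * (3 + ‖u‖) ^ 1) * (‖T‖ * ‖Q‖ * (3 + ‖u‖) ^ 3) :=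
        mul_le_mul (abs_clm_le _ u) (abs_cubic_le u) (abs_nonneg _) (by positivity)
    _ = _ := by ring

/-- One integration by parts uses up `l` and differentiates the cubic in the direction `b = gramDual
T l`; by symmetry of `Q` this leaves `⟨T b, Q u u⟩ + 2 ⟨T u, Q b u⟩`, a second moment. For `Q = D²P`
the first trace is the Christoffel term of the Laplacian, the second is the logarithmic derivative
of the volume density. -/
theorem integral_quartic_mul_gaussianWeight (hT : Function.Injective T)
    (hQ : ∀ v w, Q v w = Q w v) (l : EuclideanSpace ℝ (Fin d) →L[ℝ] ℝ) :
    ∫ u, l u * inner ℝ (T u) (Q u u) * gaussianWeight T u =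
      (gramTrace T (innerLeft (T (gramDual T l)) Q) +
        2 * gramTrace T (innerMaps T (Q (gramDual T l)))) * ∫ u, gaussianWeight T u := by
  set b := gramDual T l with hb
  have hGd : ∀ u, HasFDerivAt (fun u => inner ℝ (T u) (Q u u))
      (((realInnerCLM _ (T u)).comp (Q u + Q.flip u)) +
        (realInnerCLM _ (Q u u)).comp T) u := by
    intro u
    have h1 : HasFDerivAt (fun u => Q u u) (Q u + Q.flip u) u := by
      have := (Q.hasFDerivAt (x := u)).clm_apply (hasFDerivAt_id u)
      refine this.congr_fderiv ?_
      ext v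
      simp
    have h2 := (T.hasFDerivAt (x := u)).inner ℝ h1
    refine h2.congr_fderiv ?_
    ext v
    simp [realInnerCLM_apply, real_inner_comm, fderivInnerCLM_apply, inner_add_right]
  have hfd : ∀ u, fderiv ℝ (fun u => inner ℝ (T u) (Q u u)) u b =
      (innerLeft (T b) Q + (2 : ℝ) • innerMaps T (Q b)) u u := by
    intro u
    rw [(hGd u).fderiv]
    simp only [add_apply, ContinuousLinearMap.comp_apply, ContinuousLinearMap.flip_apply,
      realInnerCLM_apply, innerLeft_apply, innerMaps_apply, smul_apply, smul_eq_mul,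
      inner_add_right]
    rw [hQ u b, real_inner_comm (T b)]
    ring
  have hpoly : ∀ u, |(innerLeft (T b) Q + (2 : ℝ) • innerMaps T (Q b)) u u| ≤
      ‖innerLeft (T b) Q + (2 : ℝ) • innerMaps T (Q b)‖ * (3 + ‖u‖) ^ 2 := by
    intro u
    refine (ContinuousLinearMap.le_opNorm₂ (innerLeft (T b) Q + (2 : ℝ) • innerMaps T (Q b))
      u u).trans ?_
    rw [mul_assoc, ← sq]
    gcongr
    linarith
  have hGc : ContDiff ℝ 1 fun u => inner ℝ (T u) (Q u u) :=
    T.contDiff.inner ℝ (Q.contDiff.clm_apply contDiff_id)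
  have h := integral_inner_mul_gaussianWeight hT (G := fun u => inner ℝ (T u) (Q u u)) hGc
    abs_cubic_le b (by simpa only [hfd] using hpoly)
  simp only [hfd] at h
  simp only [hb, inner_gramDual hT] at h
  rw [h, ← hb, integral_bilin_mul_gaussianWeight hT]
  congr 1
  simp only [gramTrace, add_apply, smul_apply, smul_eq_mul, mul_add, Finset.sum_add_distrib,
    Finset.mul_sum]
  congr 1
  refine Finset.sum_congr rfl fun i _ => Finset.sum_congr rfl fun j _ => by ring

end GaussianMoments

end CoarseRicci

end

noncomputable section

namespace CoarseRicci

/-! ### The Laplacian and the volume density in terms of `DP` and `D²P` -/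

section Laplacian

variable {d N : ℕ}

theorem hasFDerivAt_partialDeriv {h : EuclideanSpace ℝ (Fin d) → ℝ} {z : EuclideanSpace ℝ (Fin d)}
    (hh : ContDiffAt ℝ 2 h z) (i j : Fin d) :
    partialDeriv i (partialDeriv j h) z =
      fderiv ℝ (fderiv ℝ h) z (EuclideanSpace.single i 1) (EuclideanSpace.single j 1) := by
  have hd : DifferentiableAt ℝ (fderiv ℝ h) z :=
    (hh.fderiv_right (m := 1) (by norm_num)).differentiableAt (by simp)
  have h1 := hd.hasFDerivAt.clm_apply
    (hasFDerivAt_const (EuclideanSpace.single j (1 : ℝ)) z)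
  have h2 : partialDeriv j h = fun w => fderiv ℝ h w (EuclideanSpace.single j 1) := rfl
  rw [partialDeriv, h2, h1.fderiv]
  simp

variable {P : EuclideanSpace ℝ (Fin d) → EuclideanSpace ℝ (Fin N)} {z : EuclideanSpace ℝ (Fin d)}

theorem hasFDerivAt_inducedMetric (hP : ContDiffAt ℝ 2 P z) (j l : Fin d) :
    HasFDerivAt (fun w => inducedMetric P w j l)
      ((realInnerCLM _ (fderiv ℝ P z (EuclideanSpace.single j 1))).comp
          ((fderiv ℝ (fderiv ℝ P) z).flip (EuclideanSpace.single l 1)) +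
        (realInnerCLM _ (fderiv ℝ P z (EuclideanSpace.single l 1))).comp
          ((fderiv ℝ (fderiv ℝ P) z).flip (EuclideanSpace.single j 1))) z := by
  have hd : DifferentiableAt ℝ (fderiv ℝ P) z :=
    (hP.fderiv_right (m := 1) (by norm_num)).differentiableAt (by simp)
  have h1 := fun k => hd.hasFDerivAt.clm_apply
    (hasFDerivAt_const (EuclideanSpace.single k (1 : ℝ)) z)
  refine ((h1 j).inner ℝ (h1 l)).congr_fderiv ?_
  ext v
  simp [realInnerCLM_apply, fderivInnerCLM_apply, real_inner_comm]

/-- For an induced metric each derivative of `g` is a sum of two pairings of first with second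
derivatives of `P`. Symmetry of the second derivative cancels four of the six terms and doubles the
remaining pairing. -/
theorem christoffel_eq (hP : ContDiffAt ℝ 2 P z) (k i j : Fin d) :
    christoffel P z k i j = ∑ l, (inducedMetric P z)⁻¹ k l *
      inner ℝ (fderiv ℝ P z (EuclideanSpace.single l 1))
        (fderiv ℝ (fderiv ℝ P) z (EuclideanSpace.single i 1) (EuclideanSpace.single j 1)) := by
  have hs : ∀ v w, fderiv ℝ (fderiv ℝ P) z v w = fderiv ℝ (fderiv ℝ P) z w v :=
    fun v w => (hP.isSymmSndFDerivAt (by simp)).eq v w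
  rw [christoffel, Finset.mul_sum]
  refine Finset.sum_congr rfl fun l _ => ?_
  simp only [partialDeriv, (hasFDerivAt_inducedMetric hP _ _).fderiv, add_apply,
    ContinuousLinearMap.comp_apply, ContinuousLinearMap.flip_apply, realInnerCLM_apply]
  rw [hs (EuclideanSpace.single j 1) (EuclideanSpace.single i 1),
    hs (EuclideanSpace.single l 1) (EuclideanSpace.single i 1),
    hs (EuclideanSpace.single l 1) (EuclideanSpace.single j 1)]
  ring

/-- The first-order term becomes the pairing of the gradient, pushed to the ambient space, with
`D²P`: exactly the shape in which the fourth Gaussian moment produces it. -/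
theorem coordLaplacian_eq {h : EuclideanSpace ℝ (Fin d) → ℝ} (hP : ContDiffAt ℝ 2 P z)
    (hh : ContDiffAt ℝ 2 h z) :
    coordLaplacian P h z = gramTrace (fderiv ℝ P z) (fderiv ℝ (fderiv ℝ h) z) -
      gramTrace (fderiv ℝ P z) (innerLeft
        (fderiv ℝ P z (gramDual (fderiv ℝ P z) (fderiv ℝ h z))) (fderiv ℝ (fderiv ℝ P) z)) := by
  simp only [coordLaplacian, gramTrace, ← Finset.sum_sub_distrib, ← mul_sub]
  refine Finset.sum_congr rfl fun i _ => Finset.sum_congr rfl fun j _ => ?_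
  rw [inducedMetric_eq_gram, covariantHessian, hasFDerivAt_partialDeriv hh, innerLeft_apply]
  congr 2
  simp only [christoffel_eq hP, gramDual, map_sum, map_smul, sum_inner, inner_smul_left,
    conj_trivial, Finset.sum_mul]
  rw [Finset.sum_comm]
  refine Finset.sum_congr rfl fun l _ => Finset.sum_congr rfl fun k _ => ?_
  rw [inducedMetric_eq_gram, partialDeriv]
  ring

/-- Jacobi's formula under the square root. The derivative of the Gram matrix has two transposed
halves with the same trace against the symmetric inverse, so the factor `1/2` of the square root
disappears. -/
theorem fderiv_volumeDensity (hP : ContDiffAt ℝ 2 P z) (hinj : Function.Injective (fderiv ℝ P z))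
    (hd : DifferentiableAt ℝ (volumeDensity P) z) (v : EuclideanSpace ℝ (Fin d)) :
    fderiv ℝ (volumeDensity P) z v = volumeDensity P z *
      gramTrace (fderiv ℝ P z) (innerMaps (fderiv ℝ P z) (fderiv ℝ (fderiv ℝ P) z v)) := by
  set T := fderiv ℝ P z with hT
  set Q := fderiv ℝ (fderiv ℝ P) z with hQ
  have hs : ∀ v w, Q v w = Q w v :=
    fun v w => (hP.isSymmSndFDerivAt (by simp)).eq v w
  have hline : HasDerivAt (fun s : ℝ => z + s • v) v 0 := by
    simpa using ((hasDerivAt_id (0 : ℝ)).smul_const v).const_add z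
  have hz : z + (0 : ℝ) • v = z := by simp
  have hdet : 0 < (gram T).det := gram_det_pos hinj
  let A' : Matrix (Fin d) (Fin d) ℝ := Matrix.of fun i j =>
    inner ℝ (T (EuclideanSpace.single i 1)) (Q v (EuclideanSpace.single j 1)) +
      inner ℝ (T (EuclideanSpace.single j 1)) (Q v (EuclideanSpace.single i 1))
  have hA : HasDerivAt (fun s : ℝ => (inducedMetric P (z + s • v)).det)
      ((gram T).det * ((gram T)⁻¹ * A').trace) 0 := by
    have := hasDerivAt_det (A := fun s : ℝ => inducedMetric P (z + s • v)) (A' := A')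
      (fun i j => ?_) (by rw [hz, inducedMetric_eq_gram]; exact hdet.ne')
    · simpa only [hz, inducedMetric_eq_gram, hT] using this
    · have h1 := hasFDerivAt_inducedMetric hP i j
      rw [← hz] at h1
      refine (h1.comp_hasDerivAt (0 : ℝ) hline).congr_deriv ?_
      rw [hz]
      rfl
  have hsq := hA.sqrt (by rw [hz, inducedMetric_eq_gram]; exact hdet.ne')
  have hdv : HasFDerivAt (volumeDensity P) (fderiv ℝ (volumeDensity P) z) (z + (0 : ℝ) • v) := by
    rw [hz]; exact hd.hasFDerivAt
  have hL := hdv.comp_hasDerivAt (0 : ℝ) hline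
  rw [hL.unique hsq, hz]
  have htr : ((gram T)⁻¹ * A').trace = 2 * gramTrace T (innerMaps T (Q v)) := by
    have hsymm : ∀ i j, (gram T)⁻¹ i j = (gram T)⁻¹ j i := by
      intro i j
      have h1 : (gram T).transpose = gram T := by
        ext i j
        simp [gram, real_inner_comm]
      have h2 : ((gram T)⁻¹).transpose = (gram T)⁻¹ := by
        rw [Matrix.transpose_nonsing_inv, h1]
      nth_rw 1 [← h2]
      rfl
    simp only [Matrix.trace, Matrix.diag_apply, Matrix.mul_apply, gramTrace, innerMaps_apply,
      A', Matrix.of_apply, mul_add, Finset.sum_add_distrib]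
    rw [two_mul]
    congr 1
    rw [Finset.sum_comm]
    refine Finset.sum_congr rfl fun i _ => Finset.sum_congr rfl fun j _ => ?_
    rw [hsymm]
  have hv : volumeDensity P z = √(gram T).det := rfl
  rw [htr, hv, inducedMetric_eq_gram, ← hT]
  have h3 : √(gram T).det ≠ 0 := (Real.sqrt_pos.2 hdet).ne'
  have h4 : (gram T).det = √(gram T).det * √(gram T).det := (Real.mul_self_sqrt hdet.le).symm
  field_simp
  nth_rw 1 [h4]
  ring

end Laplacian

/-! ### Expansion of the heat integral at `ε = 0` -/

section SecondOrder

variable {d N : ℕ}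

/-- The Taylor quotient of second order of a function with vanishing first derivative. -/
theorem tendsto_div_sq_of_hasDerivAt {f f' : ℝ → ℝ} {L : ℝ} (hf : ∀ x, HasDerivAt f (f' x) x)
    (h0 : f 0 = 0) (h0' : f' 0 = 0) (hf' : HasDerivAt f' L 0) :
    Tendsto (fun ε => f ε / ε ^ 2) (𝓝[≠] 0) (𝓝 (L / 2)) := by
  refine HasDerivAt.lhopital_zero_nhdsNE (f' := f') (g' := fun ε => 2 * ε)
    (Eventually.of_forall hf) (Eventually.of_forall fun x => ?_) ?_ ?_ ?_ ?_
  · simpa using hasDerivAt_pow 2 x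
  · filter_upwards [self_mem_nhdsWithin] with x hx
    exact mul_ne_zero two_ne_zero hx
  · have := (hf 0).continuousAt.tendsto
    rw [h0] at this
    exact this.mono_left nhdsWithin_le_nhds
  · have : Tendsto (fun ε : ℝ => ε ^ 2) (𝓝 0) (𝓝 (0 ^ 2)) := (continuous_pow 2).tendsto 0
    simp only [ne_eq, OfNat.ofNat_ne_zero, not_false_eq_true, zero_pow] at this
    exact this.mono_left nhdsWithin_le_nhds
  · have := (hasDerivAt_iff_tendsto_slope.1 hf').div_const 2
    refine this.congr fun ε => ?_
    rw [slope_def_field, h0', sub_zero, sub_zero, div_div, mul_comm]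

variable {E F : Type} [NormedAddCommGroup E] [NormedSpace ℝ E] [NormedAddCommGroup F]
  [NormedSpace ℝ F]

theorem hasDerivAt_add_smul (z u : E) (ε : ℝ) : HasDerivAt (fun s : ℝ => z + s • u) u ε := by
  simpa using ((hasDerivAt_id ε).smul_const u).const_add z

theorem hasDerivAt_comp_add_smul {g : E → F} (hg : Differentiable ℝ g) (z u : E) (ε : ℝ) :
    HasDerivAt (fun s : ℝ => g (z + s • u)) (fderiv ℝ g (z + ε • u) u) ε :=
  (hg (z + ε • u)).hasFDerivAt.comp_hasDerivAt ε (hasDerivAt_add_smul z u ε)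

theorem hasDerivAt_fderiv_add_smul {g : E → F} (hg : Differentiable ℝ (fderiv ℝ g)) (z u : E) :
    HasDerivAt (fun s : ℝ => fderiv ℝ g (z + s • u) u) (fderiv ℝ (fderiv ℝ g) z u u) 0 := by
  have h0 : HasFDerivAt (fderiv ℝ g) (fderiv ℝ (fderiv ℝ g) z) (z + (0 : ℝ) • u) := by
    rw [zero_smul, add_zero]
    exact (hg z).hasFDerivAt
  have h1 : HasDerivAt (fun s : ℝ => fderiv ℝ g (z + s • u)) (fderiv ℝ (fderiv ℝ g) z u) 0 :=
    h0.comp_hasDerivAt (0 : ℝ) (hasDerivAt_add_smul z u 0)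
  exact ((ContinuousLinearMap.apply ℝ F u).hasFDerivAt.comp_hasDerivAt (0 : ℝ) h1)

theorem hasDerivAt_line {g : E × ℝ → F} (hg : Differentiable ℝ g) (p : E) (ε : ℝ) :
    HasDerivAt (fun ε => g (p, ε)) (fderiv ℝ g (p, ε) (0, 1)) ε :=
  (hg (p, ε)).hasFDerivAt.comp_hasDerivAt ε
    ((hasDerivAt_const ε p).prodMk (hasDerivAt_id ε))

variable {P : EuclideanSpace ℝ (Fin d) → EuclideanSpace ℝ (Fin N)}

/-- With `B ε` for the mean derivative applied to `u`, differentiating `ε • B ε = P (z + ε • u) - P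
z` gives `B ε = DP (z + ε • u) u - ε • B' ε`. Differentiating once more at zero yields `B' 0 = D²P u
u - B' 0`, hence the factor `1/2`. -/
theorem hasDerivAt_meanDeriv_apply (hP : Tame P) (z u : EuclideanSpace ℝ (Fin d)) :
    HasDerivAt (fun ε : ℝ => meanDeriv P (z, ε • u) u)
      ((1 / 2 : ℝ) • fderiv ℝ (fderiv ℝ P) z u u) 0 := by
  set B : ℝ → EuclideanSpace ℝ (Fin N) := fun ε => meanDeriv P (z, ε • u) u with hB
  have hBs : ContDiff ℝ ∞ B :=
    (hP.contDiff_meanDeriv.comp (by fun_prop : ContDiff ℝ ∞ fun ε : ℝ => (z, ε • u))).clm_apply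
      contDiff_const
  have hBd : ∀ ε, HasDerivAt B (deriv B ε) ε := fun ε =>
    (hBs.differentiable (by simp) ε).hasDerivAt
  have hB'c : Continuous (deriv B) := hBs.continuous_deriv (by simp)
  have hrel : ∀ ε, ε • B ε = P (z + ε • u) - P z := by
    intro ε
    rw [← hP.meanDeriv_apply z (ε • u), map_smul]
  have h1 : ∀ ε, B ε = fderiv ℝ P (z + ε • u) u - ε • deriv B ε := by
    intro ε
    have e1 : HasDerivAt (fun s : ℝ => s • B s) (ε • deriv B ε + (1 : ℝ) • B ε) ε :=
      (hasDerivAt_id ε).fun_smul (hBd ε)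
    have e2 := (hasDerivAt_comp_add_smul (hP.contDiff.differentiable (by simp)) z u ε).sub_const (P z)
    have e4 := e1.unique (e2.congr_of_eventuallyEq (Eventually.of_forall hrel))
    rw [← e4, one_smul, add_sub_cancel_left]
  have h2 := hasDerivAt_fderiv_add_smul (g := P)
    ((hP.contDiff.fderiv_right (m := 1) (by norm_cast)).differentiable (by simp)) z u
  -- At `ε = 0` continuity of `deriv B` suffices, since the difference quotient of `ε • deriv B ε`
  -- is `deriv B ε` itself.
  have h3 : HasDerivAt (fun ε : ℝ => ε • deriv B ε) (deriv B 0) 0 := by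
    rw [hasDerivAt_iff_tendsto_slope]
    have : Tendsto (deriv B) (𝓝[≠] 0) (𝓝 (deriv B 0)) :=
      (hB'c.tendsto 0).mono_left nhdsWithin_le_nhds
    refine this.congr' ?_
    filter_upwards [self_mem_nhdsWithin] with ε hε
    have hε' : ε ≠ 0 := hε
    simp [slope, smul_smul, hε']
  have h4 : HasDerivAt B (fderiv ℝ (fderiv ℝ P) z u u - deriv B 0) 0 :=
    (h2.sub h3).congr_of_eventuallyEq (Eventually.of_forall h1)
  have h5 := (hBd 0).unique h4
  have h6 : deriv B 0 = (1 / 2 : ℝ) • fderiv ℝ (fderiv ℝ P) z u u := by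
    have : (2 : ℝ) • deriv B 0 = fderiv ℝ (fderiv ℝ P) z u u := by
      rw [two_smul]
      nth_rw 1 [h5]
      abel
    rw [← this, smul_smul]
    norm_num
  rw [← h6]
  exact hBd 0

theorem heatWeight_zero (P : EuclideanSpace ℝ (Fin d) → EuclideanSpace ℝ (Fin N))
    (z u : EuclideanSpace ℝ (Fin d)) :
    heatWeight P u (z, 0) = volumeDensity P z * gaussianWeight (fderiv ℝ P z) u := by
  simp [heatWeight, Tame.meanDeriv_zero, gaussianWeight]

theorem heatDen_zero (P : EuclideanSpace ℝ (Fin d) → EuclideanSpace ℝ (Fin N))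
    (z : EuclideanSpace ℝ (Fin d)) :
    heatDen P (z, 0) = volumeDensity P z * ∫ u, gaussianWeight (fderiv ℝ P z) u := by
  simp only [heatDen, heatWeight_zero, integral_const_mul]

theorem hasDerivAt_heatWeight (hP : Tame P) (z u : EuclideanSpace ℝ (Fin d)) :
    HasDerivAt (fun ε : ℝ => heatWeight P u (z, ε))
      ((fderiv ℝ (volumeDensity P) z u - 1 / 2 * volumeDensity P z *
        inner ℝ (fderiv ℝ P z u) (fderiv ℝ (fderiv ℝ P) z u u)) *
          gaussianWeight (fderiv ℝ P z) u) 0 := by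
  have hline : HasDerivAt (fun s : ℝ => z + s • u) u 0 := by
    simpa using ((hasDerivAt_id (0 : ℝ)).smul_const u).const_add z
  have hz : z + (0 : ℝ) • u = z := by simp
  have h1 : HasDerivAt (fun ε : ℝ => volumeDensity P (z + ε • u))
      (fderiv ℝ (volumeDensity P) z u) 0 := by
    have := (hP.contDiff_volumeDensity.differentiable (by simp)
      (z + (0 : ℝ) • u)).hasFDerivAt.comp_hasDerivAt (0 : ℝ) hline
    rwa [hz] at this
  have h2 := ((((hasDerivAt_meanDeriv_apply hP z u).norm_sq).const_mul (1 / 2)).fun_neg).exp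
  refine (h1.mul h2).congr_deriv ?_
  simp only [zero_smul, add_zero, Tame.meanDeriv_zero, gaussianWeight, inner_smul_right]
  ring

/-- Because `a` vanishes at zero, the second derivative of `a * R` does not involve `R''`. For the
heat integral this means that the weight has to be expanded only to first order. -/
theorem secondDeriv_line_mul {Ψ : E × ℝ → ℝ} (hΨ : ContDiff ℝ 2 Ψ) (p : E) {a a' R : ℝ → ℝ}
    {a'' r : ℝ} (hΨa : ∀ ε, Ψ (p, ε) = a ε * R ε) (ha : ∀ ε, HasDerivAt a (a' ε) ε) (ha0 : a 0 = 0)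
    (ha' : HasDerivAt a' a'' 0) (hR : ContDiff ℝ 2 R) (hR' : HasDerivAt R r 0) :
    fderiv ℝ (fun q => fderiv ℝ Ψ q (0, 1)) (p, 0) (0, 1) = a'' * R 0 + 2 * (a' 0 * r) := by
  have hΨ's : ContDiff ℝ 1 fun q => fderiv ℝ Ψ q (0, 1) :=
    (hΨ.fderiv_right (m := 1) (by norm_num)).clm_apply contDiff_const
  have hRd : ∀ ε, HasDerivAt R (deriv R ε) ε := fun ε =>
    (hR.differentiable (by simp) ε).hasDerivAt
  have hR'd : DifferentiableAt ℝ (deriv R) 0 :=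
    (ContDiff.differentiable_deriv_two hR) 0
  have h1 : ∀ ε, fderiv ℝ Ψ (p, ε) (0, 1) = a' ε * R ε + a ε * deriv R ε := fun ε =>
    (hasDerivAt_line (hΨ.differentiable (by simp)) p ε).unique
      (((ha ε).mul (hRd ε)).congr_of_eventuallyEq (Eventually.of_forall hΨa))
  have h2 := hasDerivAt_line (hΨ's.differentiable (by simp)) p 0
  have h3 := (ha'.mul (hRd 0)).add ((ha 0).mul hR'd.hasDerivAt)
  have h4 := h2.unique (h3.congr_of_eventuallyEq (Eventually.of_forall h1))
  rw [h4, hR'.deriv, ha0]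
  ring

end SecondOrder

end CoarseRicci

end

noncomputable section

namespace CoarseRicci

section SecondOrder

variable {d N : ℕ} {P : EuclideanSpace ℝ (Fin d) → EuclideanSpace ℝ (Fin N)}

theorem contDiff_heatWeight_comp (hP : Tame P) {E : Type} [NormedAddCommGroup E] [NormedSpace ℝ E]
    {f g : E → EuclideanSpace ℝ (Fin d)} {e : E → ℝ} (hf : ContDiff ℝ 2 f) (hg : ContDiff ℝ 2 g)
    (he : ContDiff ℝ 2 e) : ContDiff ℝ 2 fun x => heatWeight P (f x) (g x, e x) := by
  have h0 : ContDiff ℝ 2 (Function.uncurry (heatWeight P)) :=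
    (contDiff_heatWeight hP).of_le (by norm_cast)
  have h := h0.comp (hf.prodMk (hg.prodMk he))
  simp only [Function.comp_def, Function.uncurry_apply_pair] at h
  exact h

/-- The second derivative in `ε` of the integrand of `heatNum` at `ε = 0`. -/
theorem secondDeriv_heatNum_integrand (hP : Tame P) {h : EuclideanSpace ℝ (Fin d) × ℝ → ℝ}
    (hh : ContDiff ℝ 2 h) (p : EuclideanSpace ℝ (Fin d) × ℝ) (u : EuclideanSpace ℝ (Fin d)) :
    fderiv ℝ (fun q => fderiv ℝ (fun q : (EuclideanSpace ℝ (Fin d) × ℝ) × ℝ =>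
        (h (q.1.1 + q.2 • u, q.1.2) - h q.1) * heatWeight P u (q.1.1, q.2)) q (0, 1))
        (p, 0) (0, 1) =
      volumeDensity P p.1 * (fderiv ℝ (fderiv ℝ fun w => h (w, p.2)) p.1 u u *
          gaussianWeight (fderiv ℝ P p.1) u) +
        2 * (fderiv ℝ (fun w => h (w, p.2)) p.1 u * fderiv ℝ (volumeDensity P) p.1 u *
          gaussianWeight (fderiv ℝ P p.1) u) -
        volumeDensity P p.1 * (fderiv ℝ (fun w => h (w, p.2)) p.1 u *
          inner ℝ (fderiv ℝ P p.1 u) (fderiv ℝ (fderiv ℝ P) p.1 u u) *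
          gaussianWeight (fderiv ℝ P p.1) u) := by
  obtain ⟨z, δ⟩ := p
  have hW : ContDiff ℝ 2 fun q : (EuclideanSpace ℝ (Fin d) × ℝ) × ℝ => heatWeight P u (q.1.1, q.2) :=
    contDiff_heatWeight_comp hP contDiff_const (by fun_prop) (by fun_prop)
  have hΨs : ContDiff ℝ 2 fun q : (EuclideanSpace ℝ (Fin d) × ℝ) × ℝ =>
      (h (q.1.1 + q.2 • u, q.1.2) - h q.1) * heatWeight P u (q.1.1, q.2) :=
    ((hh.comp (by fun_prop)).sub (hh.comp contDiff_fst)).mul hW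
  have hRs : ContDiff ℝ 2 fun ε : ℝ => heatWeight P u (z, ε) :=
    contDiff_heatWeight_comp hP contDiff_const contDiff_const contDiff_id
  have hh₀s : ContDiff ℝ 2 fun w => h (w, δ) := hh.comp (by fun_prop)
  have key := secondDeriv_line_mul hΨs (z, δ) (a := fun ε => h (z + ε • u, δ) - h (z, δ))
    (R := fun ε => heatWeight P u (z, ε)) (fun ε => rfl)
    (fun ε => (hasDerivAt_comp_add_smul (hh₀s.differentiable (by simp)) z u ε).sub_const _)
    (by simp) (hasDerivAt_fderiv_add_smul
      ((hh₀s.fderiv_right (m := 1) (by norm_num)).differentiable (by simp)) z u)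
    hRs (hasDerivAt_heatWeight hP z u)
  rw [key]
  simp only [heatWeight_zero, zero_smul, add_zero]
  ring

/-- The limit of the second-order quotient of the heat integral. -/
theorem tendsto_heatNum_div_sq (hP : Tame P) {B : ℝ} {h : EuclideanSpace ℝ (Fin d) × ℝ → ℝ}
    (hh : CkBound 2 B h) (p : EuclideanSpace ℝ (Fin d) × ℝ) :
    Tendsto (fun ε => heatNum P h (p, ε) / ε ^ 2) (𝓝[≠] 0)
      (𝓝 (heatDen P (p.1, 0) * coordLaplacian P (fun w => h (w, p.2)) p.1 / 2)) := by
  obtain ⟨C, -, a, ha, hW⟩ := exists_ckBound_heatNum_integrand hP 2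
  have hb := ((integrable_exp_neg_mul_norm_sq (d := d) ha).const_mul C).const_mul B
  have hj := contDiff_heatNum_integrand (n := 2) hP hh.1
  set Ψ : EuclideanSpace ℝ (Fin d) → (EuclideanSpace ℝ (Fin d) × ℝ) × ℝ → ℝ := fun u q =>
    (h (q.1.1 + q.2 • u, q.1.2) - h q.1) * heatWeight P u (q.1.1, q.2) with hΨ
  let e : (EuclideanSpace ℝ (Fin d) × ℝ) × ℝ := (0, 1)
  let ev : ((EuclideanSpace ℝ (Fin d) × ℝ) × ℝ →L[ℝ] ℝ) →L[ℝ] ℝ := ContinuousLinearMap.apply ℝ ℝ e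
  have hd1 := hasFDerivAt_integral_of_ckBound (μ := volume) (n := 1) hj hb
    (Eventually.of_forall (hW B h hh))
  have hj' : ContDiff ℝ 1 (Function.uncurry fun u q => fderiv ℝ (Ψ u) q e) :=
    (contDiff_uncurry_fderiv (n := 1) hj).clm_apply contDiff_const
  have hW' : ∀ u, CkBound 1 (‖ev‖ * (B * (C * Real.exp (-(a * ‖u‖ ^ 2)))))
      (fun q => fderiv ℝ (Ψ u) q e) := fun u => ((hW B h hh u).fderiv_right (n := 1)).clm_comp ev
  have hd2 := hasFDerivAt_integral_of_ckBound (μ := volume) (n := 0) hj' (hb.const_mul ‖ev‖)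
    (Eventually.of_forall hW')
  have hint1 : ∀ q, Integrable fun u => fderiv ℝ (Ψ u) q := fun q =>
    integrable_partial (contDiff_uncurry_fderiv (n := 1) hj) hb
      (Eventually.of_forall fun u => (hW B h hh u).fderiv_right (n := 1)) q
  have hint2 : ∀ q, Integrable fun u => fderiv ℝ (fun q => fderiv ℝ (Ψ u) q e) q := fun q =>
    integrable_partial (contDiff_uncurry_fderiv (n := 0) hj') (hb.const_mul ‖ev‖)
      (Eventually.of_forall fun u => (hW' u).fderiv_right (n := 0)) q
  have hG : ∀ q, fderiv ℝ (heatNum P h) q e = ∫ u, fderiv ℝ (Ψ u) q e := fun q => by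
    rw [show fderiv ℝ (heatNum P h) q = ∫ u, fderiv ℝ (Ψ u) q from (hd1 q).fderiv]
    exact ContinuousLinearMap.integral_apply (hint1 q) e
  have hf : ∀ ε, HasDerivAt (fun ε => heatNum P h (p, ε)) (∫ u, fderiv ℝ (Ψ u) (p, ε) e) ε := by
    intro ε
    rw [← hG]
    exact hasDerivAt_line (fun q => (hd1 q).differentiableAt) p ε
  -- An even function has vanishing derivative at zero.
  have hf0 : ∫ u, fderiv ℝ (Ψ u) (p, 0) e = 0 := by
    have h1 : HasDerivAt (fun ε => heatNum P h (p, ε)) (∫ u, fderiv ℝ (Ψ u) (p, 0) e) (-0) := by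
      rw [neg_zero]
      exact hf 0
    have h2 := h1.comp (0 : ℝ) (hasDerivAt_neg 0)
    have h3 := h2.unique ((hf 0).congr_of_eventuallyEq
      (Eventually.of_forall fun ε => heatNum_neg P h p ε))
    linarith
  have hf' : HasDerivAt (fun ε => ∫ u, fderiv ℝ (Ψ u) (p, ε) e)
      (∫ u, fderiv ℝ (fun q => fderiv ℝ (Ψ u) q e) (p, 0) e) 0 := by
    have h1 := hasDerivAt_line (fun q => (hd2 q).differentiableAt) p 0
    rw [(hd2 (p, 0)).fderiv, ContinuousLinearMap.integral_apply (hint2 (p, 0))] at h1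
    exact h1
  have hlim := tendsto_div_sq_of_hasDerivAt hf (heatNum_zero P h p) hf0 hf'
  convert hlim using 3
  have hinj := hP.injective_fderiv p.1
  have hP2 : ContDiffAt ℝ 2 P p.1 := hP.contDiff.contDiffAt.of_le (by norm_cast)
  have hh₀ : ContDiff ℝ 2 fun w => h (w, p.2) := hh.1.comp (by fun_prop)
  simp only [hΨ, e, secondDeriv_heatNum_integrand hP hh.1 p]
  have hs : ∀ v w, fderiv ℝ (fderiv ℝ P) p.1 v w = fderiv ℝ (fderiv ℝ P) p.1 w v :=
    fun v w => (hP2.isSymmSndFDerivAt (by simp)).eq v w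
  have i1 := integrable_bilin_mul_gaussianWeight hinj (fderiv ℝ (fderiv ℝ fun w => h (w, p.2)) p.1)
  have i2 : Integrable fun u => fderiv ℝ (fun w => h (w, p.2)) p.1 u *
      fderiv ℝ (volumeDensity P) p.1 u * gaussianWeight (fderiv ℝ P p.1) u := by
    have := integrable_bilin_mul_gaussianWeight hinj
      (((ContinuousLinearMap.mul ℝ ℝ).bilinearComp (fderiv ℝ (fun w => h (w, p.2)) p.1)
        (fderiv ℝ (volumeDensity P) p.1)))
    exact this
  have i3 := integrable_quartic_mul_gaussianWeight (Q := fderiv ℝ (fderiv ℝ P) p.1) hinj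
    (fderiv ℝ (fun w => h (w, p.2)) p.1)
  have i12 := ((i1.const_mul (volumeDensity P p.1)).add (i2.const_mul 2))
  simp only [Pi.add_def] at i12
  -- By Jacobi's formula the mixed term in `dh` and the derivative of the density cancels the second
  -- trace of the fourth moment. What remains is the trace of the Hessian minus the Christoffel
  -- term.
  rw [integral_sub i12 (i3.const_mul _), integral_add (i1.const_mul _) (i2.const_mul _), integral_const_mul, integral_const_mul,
    integral_const_mul, integral_bilin_mul_gaussianWeight hinj,
    integral_clm_mul_clm_mul_gaussianWeight hinj, integral_quartic_mul_gaussianWeight hinj hs,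
    fderiv_volumeDensity hP2 hinj (hP.contDiff_volumeDensity.differentiable (by simp) p.1),
    heatDen_zero, coordLaplacian_eq hP2 hh₀.contDiffAt]
  ring

end SecondOrder

end CoarseRicci

end

noncomputable section

namespace CoarseRicci

/-! ### The estimate for the model on `ℝᵈ` -/

section ModelFlow

variable {d N : ℕ}

/-- The heat operators `L_{ε²}` of the parametrized submanifold `P`, completed by the Laplacian for
`ε = 0`. -/
def flowOp (P : EuclideanSpace ℝ (Fin d) → EuclideanSpace ℝ (Fin N)) (ε : ℝ) :
    (EuclideanSpace ℝ (Fin d) → ℝ) → EuclideanSpace ℝ (Fin d) → ℝ :=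
  if ε = 0 then coordLaplacian P else modelHeat P (ε ^ 2)

variable {P : EuclideanSpace ℝ (Fin d) → EuclideanSpace ℝ (Fin N)}

theorem flowOp_zero : flowOp P 0 = coordLaplacian P := by simp [flowOp]

theorem flowOp_of_ne {ε : ℝ} (hε : ε ≠ 0) : flowOp P ε = modelHeat P (ε ^ 2) := by
  simp [flowOp, hε]

theorem flowOp_sqrt {t : ℝ} (ht : 0 < t) : flowOp P (√t) = modelHeat P t := by
  rw [flowOp_of_ne (Real.sqrt_pos.2 ht).ne', Real.sq_sqrt ht.le]

/-- The heat operators and the Laplacian form one family that is smooth through `ε = 0`: the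
Hadamard quotient of `heatNum` over `heatDen` represents both, and its value at zero is identified
by `tendsto_heatNum_div_sq`. Two derivatives are lost to the division by `ε ^ 2`. Functions
depending on `ε` are admitted so that the result can be applied to its own output. -/
theorem exists_ckBound_flowOp (hP : Tame P) (n : ℕ) :
    ∃ C, 0 ≤ C ∧ ∀ (B : ℝ) (h : EuclideanSpace ℝ (Fin d) × ℝ → ℝ), CkBound (n + 2) B h →
      CkBound n (C * B) fun q : EuclideanSpace ℝ (Fin d) × ℝ => flowOp P q.2 (fun w => h (w, q.2)) q.1 := by
  obtain ⟨C₁, hC₁⟩ := exists_ckBound_heatNum hP (n + 2)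
  obtain ⟨C₂, hC₂⟩ := CkBound.exists_div_sq (E := EuclideanSpace ℝ (Fin d) × ℝ) (F := ℝ) n
  obtain ⟨C₃, hC₃⟩ := exists_ckBound_inv_heatDen hP n
  -- The diagonal `(z, ε) ↦ ((z, ε), ε)` sets the parameter `δ` of the function equal to the scale
  -- `ε` of the kernel.
  let D : EuclideanSpace ℝ (Fin d) × ℝ →L[ℝ] (EuclideanSpace ℝ (Fin d) × ℝ) × ℝ :=
    (ContinuousLinearMap.id ℝ _).prod (ContinuousLinearMap.snd ℝ _ ℝ)
  have hD : ∀ q, D q = (q, q.2) := fun q => rfl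
  refine ⟨|2 * (2 ^ n * (C₂ * C₁ * (1 + ‖D‖) ^ n) * C₃)|, abs_nonneg _, fun B h hh => ?_⟩
  obtain ⟨S, hS, hHS⟩ := hC₂ _ _ (hC₁ B h hh) (heatNum_zero P h) (heatNum_neg P h)
  have h1 := ((hS.comp_clm D).mul hC₃).const_mul 2
  have hB := hh.nonneg
  have hflow : ∀ q : EuclideanSpace ℝ (Fin d) × ℝ, flowOp P q.2 (fun w => h (w, q.2)) q.1 =
      2 * (S (D q) * (heatDen P q)⁻¹) := by
    rintro ⟨z, ε⟩
    have hden := (heatDen_pos hP (z, ε)).ne'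
    rcases eq_or_ne ε 0 with rfl | hε
    · have hlim := tendsto_heatNum_div_sq hP (hh.mono (by omega) le_rfl) (z, (0 : ℝ))
      have hcont : Tendsto (fun ε : ℝ => S ((z, (0 : ℝ)), ε)) (𝓝[≠] 0)
          (𝓝 (S ((z, (0 : ℝ)), 0))) := by
        have : Continuous fun ε : ℝ => S ((z, (0 : ℝ)), ε) := hS.1.continuous.comp (by fun_prop)
        exact (this.tendsto 0).mono_left nhdsWithin_le_nhds
      have heq := tendsto_nhds_unique hlim (hcont.congr' ?_)
      · simp only [flowOp_zero, hD]
        rw [← heq]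
        field_simp
      · filter_upwards [self_mem_nhdsWithin] with ε hε
        have hε' : ε ≠ 0 := hε
        rw [hHS, smul_eq_mul, mul_div_cancel_left₀ _ (pow_ne_zero 2 hε')]
    · simp only [flowOp_of_ne hε, hD]
      rw [modelHeat_eq hP h z ε hε, hHS, smul_eq_mul]
      field_simp
  simp only [hflow]
  refine h1.mono_right ?_
  calc _ = (2 * (2 ^ n * (C₂ * C₁ * (1 + ‖D‖) ^ n) * C₃)) * B := by
        rw [abs_of_pos (by norm_num : (0 : ℝ) < 2)]; ring
    _ ≤ _ := by gcongr; exact le_abs_self _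

theorem exists_ckBound_carreDuChamp_flowOp (hP : Tame P) (n : ℕ) :
    ∃ C, 0 ≤ C ∧ ∀ (B B' : ℝ) (u v : EuclideanSpace ℝ (Fin d) × ℝ → ℝ), CkBound (n + 2) B u →
      CkBound (n + 2) B' v → CkBound n (C * (B * B')) fun q : EuclideanSpace ℝ (Fin d) × ℝ =>
        carreDuChamp (flowOp P q.2) (fun w => u (w, q.2)) (fun w => v (w, q.2)) q.1 := by
  obtain ⟨C, hC0, hC⟩ := exists_ckBound_flowOp hP n
  refine ⟨|1 / 2| * (C * 2 ^ (n + 2) + 2 ^ n * C + 2 ^ n * C), by positivity,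
    fun B B' u v hu hv => ?_⟩
  have h1 := hC _ _ (hu.mul hv)
  have h2 := (hC _ _ hu).mul (hv.mono (m := n) (by omega) le_rfl)
  have h3 := (hu.mono (m := n) (by omega) le_rfl).mul (hC _ _ hv)
  have h4 := ((h1.sub h2).sub h3).const_mul (1 / 2)
  refine h4.mono_right (le_of_eq ?_)
  ring

/-- The count of derivatives: `f` is `C⁵`, the inner operators bring it to `C³`, the outer ones to
`C¹`. The remaining derivative is the one in `ε`. -/
theorem exists_ckBound_iteratedCarreDuChamp_flowOp (hP : Tame P) :
    ∃ C, 0 ≤ C ∧ ∀ (B : ℝ) (f : EuclideanSpace ℝ (Fin d) → ℝ), CkBound 5 B f →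
      CkBound 1 (C * B ^ 2) fun q : EuclideanSpace ℝ (Fin d) × ℝ =>
        iteratedCarreDuChamp (flowOp P q.2) f f q.1 := by
  obtain ⟨C₁, hC₁0, hC₁⟩ := exists_ckBound_flowOp hP 1
  obtain ⟨C₃, hC₃0, hC₃⟩ := exists_ckBound_flowOp hP 3
  obtain ⟨C₁', hC₁'0, hC₁'⟩ := exists_ckBound_carreDuChamp_flowOp hP 1
  obtain ⟨C₃', hC₃'0, hC₃'⟩ := exists_ckBound_carreDuChamp_flowOp hP 3
  set κ := (1 + ‖ContinuousLinearMap.fst ℝ (EuclideanSpace ℝ (Fin d)) ℝ‖) ^ 5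
  refine ⟨|1 / 2| * (C₁ * C₃' * κ ^ 2 + C₁' * C₃ * κ ^ 2 + C₁' * C₃ * κ ^ 2), by positivity,
    fun B f hf => ?_⟩
  have hf' := hf.comp_clm (ContinuousLinearMap.fst ℝ (EuclideanSpace ℝ (Fin d)) ℝ)
  have h1 := hC₁ _ _ (hC₃' _ _ _ _ hf' hf')
  have hf3 := hf'.mono (m := 3) (by omega) le_rfl
  have h2 := hC₁' _ _ _ _ (hC₃ _ _ hf') hf3
  have h3 := hC₁' _ _ _ _ hf3 (hC₃ _ _ hf')
  have h4 := ((h1.sub h2).sub h3).const_mul (1 / 2)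
  refine h4.mono_right (le_of_eq ?_)
  ring

/-- The theorem for a parametrized submanifold of bounded geometry. -/
theorem exists_model_estimate (hP : Tame P) :
    ∃ C, 0 ≤ C ∧ ∀ (B : ℝ) (f : EuclideanSpace ℝ (Fin d) → ℝ), CkBound 5 B f → ∀ z,
      |iteratedCarreDuChamp (coordLaplacian P) f f z| ≤ C * B ^ 2 ∧
      ∀ t, 0 < t → |iteratedCarreDuChamp (coordLaplacian P) f f z -
        iteratedCarreDuChamp (modelHeat P t) f f z| ≤ C * B ^ 2 * √t := by
  obtain ⟨C, hC0, hC⟩ := exists_ckBound_iteratedCarreDuChamp_flowOp hP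
  refine ⟨C, hC0, fun B f hf z => ⟨?_, fun t ht => ?_⟩⟩
  · have := (hC B f hf).norm_le (z, 0)
    simpa only [flowOp_zero, Real.norm_eq_abs] using this
  -- The mean value inequality in the `ε` direction; the two points are at distance `√t`.
  · have := (hC B f hf).norm_sub_le (n := 0) (z, 0) (z, √t)
    simp only [flowOp_zero, flowOp_sqrt ht, Real.norm_eq_abs] at this
    refine this.trans (le_of_eq ?_)
    simp [Prod.norm_def, abs_of_nonneg (Real.sqrt_nonneg t)]

/-- The Laplacian is the slice `ε = 0` of the family, so its mapping properties need no separate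
bounds on the metric and the Christoffel symbols. -/
theorem exists_ckBound_coordLaplacian (hP : Tame P) (n : ℕ) {B : ℝ}
    {h : EuclideanSpace ℝ (Fin d) → ℝ} (hh : CkBound (n + 2) B h) :
    ∃ B', CkBound n B' (coordLaplacian P h) := by
  obtain ⟨C, -, hC⟩ := exists_ckBound_flowOp hP n
  have h1 := (hC _ _ (hh.comp_clm (ContinuousLinearMap.fst ℝ (EuclideanSpace ℝ (Fin d)) ℝ))).comp_clm
    (ContinuousLinearMap.inl ℝ (EuclideanSpace ℝ (Fin d)) ℝ)
  simp only [ContinuousLinearMap.coe_fst', ContinuousLinearMap.inl_apply, flowOp_zero] at h1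
  exact ⟨_, h1⟩

theorem tendsto_modelHeat (hP : Tame P) {B : ℝ} {h : EuclideanSpace ℝ (Fin d) → ℝ}
    (hh : CkBound 2 B h) (z : EuclideanSpace ℝ (Fin d)) :
    Tendsto (fun t => modelHeat P t h z) (𝓝[>] 0) (𝓝 (coordLaplacian P h z)) := by
  obtain ⟨C, -, hC⟩ := exists_ckBound_flowOp hP 0
  have h1 := (hC _ _ (hh.comp_clm (ContinuousLinearMap.fst ℝ (EuclideanSpace ℝ (Fin d)) ℝ))).1.continuous
  have h2 : Continuous fun t : ℝ => flowOp P (√t) h z :=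
    h1.comp (by fun_prop : Continuous fun t : ℝ => (z, √t))
  have h3 := (h2.tendsto 0).mono_left (nhdsWithin_le_nhds (s := Ioi 0))
  simp only [Real.sqrt_zero, flowOp_zero] at h3
  refine h3.congr' ?_
  filter_upwards [self_mem_nhdsWithin] with t ht
  rw [flowOp_sqrt ht]

end ModelFlow

end CoarseRicci

end

noncomputable section

namespace CoarseRicci

/-! ### Crude bounds for the heat operators of any measure -/

section HeatOperator

variable {X : Type*} [MeasurableSpace X] {ρ : X → X → ℝ} {μ : Measure X}

theorem abs_integral_heatKernel_le {h : X → ℝ} {B : ℝ} (hB : ∀ x, |h x| ≤ B) {t : ℝ} {x : X}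
    (hk : Integrable (fun y => Real.exp (-(ρ x y ^ 2) / (2 * t))) μ) :
    |∫ y, (h y - h x) * Real.exp (-(ρ x y ^ 2) / (2 * t)) ∂μ| ≤ 2 * B * heatDensity ρ μ t x := by
  rw [heatDensity, ← integral_const_mul]
  rw [← Real.norm_eq_abs]
  refine norm_integral_le_of_norm_le (hk.const_mul (2 * B)) (Eventually.of_forall fun y => ?_)
  rw [norm_mul, Real.norm_eq_abs, Real.norm_eq_abs, Real.abs_exp]
  gcongr
  calc |h y - h x| ≤ |h y| + |h x| := abs_sub _ _
    _ ≤ 2 * B := by linarith [hB y, hB x]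

theorem heatDensity_nonneg (t : ℝ) (x : X) : 0 ≤ heatDensity ρ μ t x :=
  integral_nonneg fun _ => (Real.exp_pos _).le

theorem abs_heatOperator_le {h : X → ℝ} {B : ℝ} (hB : ∀ x, |h x| ≤ B) {t : ℝ} (ht : 0 < t)
    (x : X) : |heatOperator ρ μ t h x| ≤ 4 * B / t := by
  have hB0 : 0 ≤ B := (abs_nonneg _).trans (hB x)
  unfold heatOperator
  -- If the density vanishes, division by zero makes the operator vanish. This includes a
  -- nonintegrable kernel, whose integral is zero by convention, so otherwise the kernel is
  -- integrable.
  rcases eq_or_ne (heatDensity ρ μ t x) 0 with h0 | h0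
  · rw [h0]
    simp only [mul_zero, div_zero, zero_mul, abs_zero]
    positivity
  · have hθ : 0 < heatDensity ρ μ t x := lt_of_le_of_ne (heatDensity_nonneg t x) h0.symm
    have hk : Integrable (fun y => Real.exp (-(ρ x y ^ 2) / (2 * t))) μ := by
      by_contra hcon
      exact h0 (integral_undef hcon)
    have h1 := abs_integral_heatKernel_le hB hk
    rw [abs_mul, abs_of_pos (by positivity)]
    calc 2 / (t * heatDensity ρ μ t x) * _
        ≤ 2 / (t * heatDensity ρ μ t x) * (2 * B * heatDensity ρ μ t x) := by gcongr
      _ = 4 * B / t := by field_simp; ring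

theorem measurable_heatOperator [SFinite μ] (hρ : Measurable (Function.uncurry ρ)) {h : X → ℝ}
    (hh : Measurable h) (t : ℝ) : Measurable (heatOperator ρ μ t h) := by
  have hk : Measurable fun q : X × X => Real.exp (-(ρ q.1 q.2 ^ 2) / (2 * t)) :=
    Real.measurable_exp.comp (((hρ.pow_const 2).neg).div_const _)
  have h1 : StronglyMeasurable fun x => ∫ y, Real.exp (-(ρ x y ^ 2) / (2 * t)) ∂μ :=
    (hk.stronglyMeasurable).integral_prod_right'
  have h2 : StronglyMeasurable fun x => ∫ y, (h y - h x) * Real.exp (-(ρ x y ^ 2) / (2 * t)) ∂μ :=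
    ((((hh.comp measurable_snd).sub (hh.comp measurable_fst)).mul hk).stronglyMeasurable
      ).integral_prod_right'
  exact ((h1.measurable.const_mul t).const_div 2).mul h2.measurable

theorem abs_carreDuChamp_heatOperator_le {u v : X → ℝ} {B B' : ℝ} (hu : ∀ x, |u x| ≤ B)
    (hv : ∀ x, |v x| ≤ B') {t : ℝ} (ht : 0 < t) (x : X) :
    |carreDuChamp (heatOperator ρ μ t) u v x| ≤ 6 * (B * B') / t := by
  have hB0 : 0 ≤ B := (abs_nonneg _).trans (hu x)
  have hB'0 : 0 ≤ B' := (abs_nonneg _).trans (hv x)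
  have h1 := abs_heatOperator_le (ρ := ρ) (μ := μ) (h := fun y => u y * v y) (B := B * B')
    (fun y => by rw [abs_mul]; exact mul_le_mul (hu y) (hv y) (abs_nonneg _) hB0) ht x
  have h2 := abs_heatOperator_le (ρ := ρ) (μ := μ) hu ht x
  have h3 := abs_heatOperator_le (ρ := ρ) (μ := μ) hv ht x
  have h4 : |heatOperator ρ μ t u x * v x| ≤ 4 * B / t * B' := by
    rw [abs_mul]; exact mul_le_mul h2 (hv x) (abs_nonneg _) (by positivity)
  have h5 : |u x * heatOperator ρ μ t v x| ≤ B * (4 * B' / t) := by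
    rw [abs_mul]; exact mul_le_mul (hu x) h3 (abs_nonneg _) (by positivity)
  unfold carreDuChamp
  rw [abs_mul, abs_of_pos (by norm_num : (0 : ℝ) < 1 / 2)]
  have h6 := abs_sub (heatOperator ρ μ t (fun y => u y * v y) x - heatOperator ρ μ t u x * v x)
    (u x * heatOperator ρ μ t v x)
  have h7 := abs_sub (heatOperator ρ μ t (fun y => u y * v y) x) (heatOperator ρ μ t u x * v x)
  calc _ ≤ 1 / 2 * (4 * (B * B') / t + 4 * B / t * B' + B * (4 * B' / t)) := by gcongr; linarith
    _ = _ := by ring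

theorem measurable_carreDuChamp_heatOperator [SFinite μ] (hρ : Measurable (Function.uncurry ρ))
    {u v : X → ℝ} (hu : Measurable u) (hv : Measurable v) (t : ℝ) :
    Measurable (carreDuChamp (heatOperator ρ μ t) u v) :=
  (((measurable_heatOperator hρ (hu.mul hv) t).sub
    ((measurable_heatOperator hρ hu t).mul hv)).sub
      (hu.mul (measurable_heatOperator hρ hv t))).const_mul _

/-- Each application of the operator costs a factor `1 / t`. This is useless for small `t`, but it
covers all `t > 1`. -/
theorem abs_iteratedCarreDuChamp_heatOperator_le {f : X → ℝ} {B : ℝ} (hf : ∀ x, |f x| ≤ B)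
    {t : ℝ} (ht : 0 < t) (x : X) :
    |iteratedCarreDuChamp (heatOperator ρ μ t) f f x| ≤ 36 * B ^ 2 / t ^ 2 := by
  have h1 := abs_heatOperator_le (ρ := ρ) (μ := μ)
    (abs_carreDuChamp_heatOperator_le (ρ := ρ) (μ := μ) hf hf ht) ht x
  have h2 := abs_carreDuChamp_heatOperator_le (ρ := ρ) (μ := μ)
    (abs_heatOperator_le (ρ := ρ) (μ := μ) hf ht) hf ht x
  have h3 := abs_carreDuChamp_heatOperator_le (ρ := ρ) (μ := μ) hf
    (abs_heatOperator_le (ρ := ρ) (μ := μ) hf ht) ht x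
  unfold iteratedCarreDuChamp
  rw [abs_mul, abs_of_pos (by norm_num : (0 : ℝ) < 1 / 2)]
  have h6 := abs_sub (heatOperator ρ μ t (carreDuChamp (heatOperator ρ μ t) f f) x -
    carreDuChamp (heatOperator ρ μ t) (heatOperator ρ μ t f) f x)
    (carreDuChamp (heatOperator ρ μ t) f (heatOperator ρ μ t f) x)
  have h7 := abs_sub (heatOperator ρ μ t (carreDuChamp (heatOperator ρ μ t) f f) x)
    (carreDuChamp (heatOperator ρ μ t) (heatOperator ρ μ t f) f x)
  calc _ ≤ 1 / 2 * (4 * (6 * (B * B) / t) / t + 6 * (4 * B / t * B) / t +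
        6 * (B * (4 * B / t)) / t) := by gcongr; linarith
    _ = _ := by field_simp; ring

end HeatOperator

/-! ### Tails of the kernel and comparison of quotients -/

section Comparison

variable {d N : ℕ} {P : EuclideanSpace ℝ (Fin d) → EuclideanSpace ℝ (Fin N)}

/-- The volume measure of the parametrized submanifold `P`. -/
def modelVolume (P : EuclideanSpace ℝ (Fin d) → EuclideanSpace ℝ (Fin N)) :
    Measure (EuclideanSpace ℝ (Fin d)) :=
  volume.withDensity fun w => ENNReal.ofReal (volumeDensity P w)

instance : SFinite (modelVolume P) := by unfold modelVolume; infer_instance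

theorem exists_integral_exp_modelVolume_le (hP : Tame P) {α : ℝ} (hα : 0 < α) :
    ∃ C, 0 ≤ C ∧ ∀ z, Integrable (fun w => Real.exp (-(α * ‖z - w‖ ^ 2))) (modelVolume P) ∧
      ∫ w, Real.exp (-(α * ‖z - w‖ ^ 2)) ∂(modelVolume P) ≤ C := by
  obtain ⟨B, hB⟩ := hP.exists_ckBound_volumeDensity 0
  have hi := integrable_exp_neg_mul_norm_sq (d := d) hα
  have hm : Measurable fun w => (volumeDensity P w).toNNReal :=
    hP.contDiff_volumeDensity.continuous.measurable.real_toNNReal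
  have hcoe : ∀ w, ((volumeDensity P w).toNNReal : ℝ) = volumeDensity P w := fun w =>
    Real.coe_toNNReal _ (Real.sqrt_nonneg _)
  have hbd : ∀ w, volumeDensity P w ≤ B := fun w => (le_abs_self _).trans (hB.norm_le w)
  refine ⟨B * ∫ u : EuclideanSpace ℝ (Fin d), Real.exp (-(α * ‖u‖ ^ 2)),
    mul_nonneg hB.nonneg (integral_nonneg fun u => (Real.exp_pos _).le), fun z => ?_⟩
  have hz : Integrable fun w : EuclideanSpace ℝ (Fin d) => Real.exp (-(α * ‖z - w‖ ^ 2)) :=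
    hi.comp_sub_left z
  have hI : Integrable fun w => volumeDensity P w * Real.exp (-(α * ‖z - w‖ ^ 2)) := by
    refine (hz.const_mul B).mono' (by
      have := hP.contDiff_volumeDensity.continuous
      exact (by fun_prop : Continuous fun w => volumeDensity P w *
        Real.exp (-(α * ‖z - w‖ ^ 2))).aestronglyMeasurable) (Eventually.of_forall fun w => ?_)
    rw [norm_mul, Real.norm_eq_abs, Real.norm_eq_abs, Real.abs_exp]
    gcongr
    exact hB.norm_le w
  constructor
  · refine (integrable_withDensity_iff_integrable_smul (μ := volume) hm).2 ?_
    simpa only [NNReal.smul_def, hcoe, smul_eq_mul] using hI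
  · have h1 := integral_withDensity_eq_integral_smul (μ := volume) hm
      (fun w => Real.exp (-(α * ‖z - w‖ ^ 2)))
    have h2 : modelVolume P = volume.withDensity fun w => ((volumeDensity P w).toNNReal : ℝ≥0∞) :=
      rfl
    rw [h2, h1]
    simp only [NNReal.smul_def, hcoe, smul_eq_mul]
    rw [← integral_const_mul, ← integral_sub_left_eq_self _ volume z]
    refine integral_mono (by simpa using hI.comp_sub_left z) (hi.const_mul B) fun u => ?_
    simp only [sub_sub_cancel]
    gcongr
    exact hbd _

/-- The exponent is split in halves: one keeps `1 / t` and is tiny off the diagonal, the other is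
weakened by `t ≤ 1` to a Gaussian with integral bounded independently of `t`. -/
theorem heatKernel_model_le {c : ℝ} (hc : 0 < c) (hlow : ∀ z w, c * ‖z - w‖ ≤ ‖P z - P w‖) {t : ℝ}
    (ht : 0 < t) (ht1 : t ≤ 1) (z w : EuclideanSpace ℝ (Fin d)) :
    Real.exp (-(dist (P z) (P w) ^ 2) / (2 * t)) ≤
      Real.exp (-(c ^ 2 * ‖z - w‖ ^ 2 / 4 / t)) * Real.exp (-(c ^ 2 / 4 * ‖z - w‖ ^ 2)) := by
  rw [← Real.exp_add]
  refine Real.exp_le_exp.2 ?_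
  have h1 := pow_le_pow_left₀ (by positivity) (hlow z w) 2
  rw [← dist_eq_norm (P z), mul_pow] at h1
  have h2 : c ^ 2 / 4 * ‖z - w‖ ^ 2 ≤ c ^ 2 / 4 * ‖z - w‖ ^ 2 / t := by
    rw [le_div_iff₀ ht]
    exact mul_le_of_le_one_right (by positivity) ht1
  have h3 : -(dist (P z) (P w) ^ 2) / (2 * t) ≤ -(c ^ 2 * ‖z - w‖ ^ 2) / (2 * t) := by gcongr
  have h4 : -(c ^ 2 * ‖z - w‖ ^ 2) / (2 * t) =
      -(c ^ 2 * ‖z - w‖ ^ 2 / 4 / t) - c ^ 2 / 4 * ‖z - w‖ ^ 2 / t := by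
    field_simp; ring
  linarith

theorem exists_exp_neg_div_le {b : ℝ} (hb : 0 < b) (k : ℕ) :
    ∃ C, 0 ≤ C ∧ ∀ t, 0 < t → Real.exp (-(b / t)) ≤ C * t ^ k := by
  refine ⟨k.factorial / b ^ k, by positivity, fun t ht => ?_⟩
  have h := Real.pow_div_factorial_le_exp (b / t) (by positivity) k
  rw [Real.exp_neg, inv_le_comm₀ (Real.exp_pos _) (by positivity)]
  refine le_trans (le_of_eq ?_) h
  rw [div_pow]
  field_simp

/-- The difference of `Nu / θ` and `Nu' / θ'` is `((Nu - Nu') + (Nu / θ) * (θ' - θ)) / θ'`. Since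
`|Nu / θ| ≤ 2 * B`, a lower bound is needed only for the density `θ'` of the model. -/
theorem abs_div_sub_div_le {Nu Nu' θ θ' B t : ℝ} (ht : 0 < t) (hB : 0 ≤ B) (hθ : 0 ≤ θ)
    (hθ' : 0 < θ') (hN : |Nu| ≤ 2 * B * θ) :
    |2 / (t * θ) * Nu - 2 / (t * θ') * Nu'| ≤ 2 / (t * θ') * (|Nu - Nu'| + 2 * B * |θ - θ'|) := by
  rcases eq_or_lt_of_le hθ with h0 | h0
  · have hz : Nu = 0 := by
      rw [← h0, mul_zero] at hN
      exact abs_nonpos_iff.1 hN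
    rw [← h0, hz, mul_zero, zero_sub, abs_neg, abs_mul, abs_of_pos (by positivity : 0 < 2 / (t * θ'))]
    simp only [zero_sub, abs_neg]
    have : 0 ≤ 2 * B * |θ'| := by positivity
    gcongr
    linarith
  · have h1 : 2 / (t * θ) * Nu - 2 / (t * θ') * Nu' =
        2 / (t * θ') * ((Nu - Nu') + Nu / θ * (θ' - θ)) := by
      field_simp
      ring
    rw [h1, abs_mul, abs_of_pos (by positivity : 0 < 2 / (t * θ'))]
    gcongr
    refine (abs_add_le _ _).trans ?_
    gcongr
    rw [abs_mul, abs_div, abs_of_pos h0, abs_sub_comm θ' θ]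
    gcongr
    rw [div_le_iff₀ h0]
    exact hN

end Comparison

end CoarseRicci

end

noncomputable section

namespace CoarseRicci

/-! ### Localization: from the submanifold to the model -/

section LocalModel

variable {d N : ℕ} {P : EuclideanSpace ℝ (Fin d) → EuclideanSpace ℝ (Fin N)}
  {M : Type*} [MeasurableSpace M] {μ : Measure M} {F : M → EuclideanSpace ℝ (Fin N)}
  {ψ : EuclideanSpace ℝ (Fin d) → M} {D D' : Set (EuclideanSpace ℝ (Fin d))}

/-- `ψ` identifies the parametrized submanifold `P` over `D` with a piece of the submanifold `F`
carrying the measure `μ`, and `P` over `D'` stays away from the rest of both submanifolds. -/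
structure LocalModel (μ : Measure M) (F : M → EuclideanSpace ℝ (Fin N))
    (P : EuclideanSpace ℝ (Fin d) → EuclideanSpace ℝ (Fin N)) (ψ : EuclideanSpace ℝ (Fin d) → M)
    (D D' : Set (EuclideanSpace ℝ (Fin d))) : Prop where
  measurableSet : MeasurableSet D
  aemeasurable : AEMeasurable ψ ((modelVolume P).restrict D)
  subset : D' ⊆ D
  eqOn : ∀ w ∈ D, F (ψ w) = P w
  separated : ∃ U : Set M, MeasurableSet U ∧ μ.restrict U = ((modelVolume P).restrict D).map ψ ∧
    ∃ a, 0 < a ∧ ∀ z ∈ D', (∀ y ∉ U, a ≤ dist (P z) (F y)) ∧ ∀ w ∉ D, a ≤ ‖z - w‖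

theorem Tame.integrable_heatKernel (hP : Tame P) {t : ℝ} (ht : 0 < t) (ht1 : t ≤ 1)
    (z : EuclideanSpace ℝ (Fin d)) :
    Integrable (fun w => Real.exp (-(dist (P z) (P w) ^ 2) / (2 * t))) (modelVolume P) := by
  obtain ⟨c, hc, hlow⟩ := hP.lower
  obtain ⟨C1, -, hC1⟩ := exists_integral_exp_modelVolume_le hP (show 0 < c ^ 2 / 4 by positivity)
  have hPc := hP.contDiff.continuous
  refine (hC1 z).1.mono' (by
    exact (by fun_prop : Continuous fun w => Real.exp (-(dist (P z) (P w) ^ 2) / (2 * t))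
      ).aestronglyMeasurable) (Eventually.of_forall fun w => ?_)
  rw [Real.norm_eq_abs, Real.abs_exp]
  refine (heatKernel_model_le hc hlow ht ht1 z w).trans ?_
  refine mul_le_of_le_one_left (Real.exp_pos _).le ?_
  rw [Real.exp_le_one_iff]
  have : 0 ≤ c ^ 2 * ‖z - w‖ ^ 2 / 4 / t := by positivity
  linarith

/-- Over `U` and `D` the two integrals are the same up to replacing `g ∘ ψ` by `g'`. Over the
complements the kernel is evaluated at distance at least `a` and is smaller than any power of `t`;
finiteness of `μ` and a Gaussian integral bound what is left. An error `η` is allowed on `D` because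
outputs of the operators agree there only approximately. -/
theorem LocalModel.exists_abs_integral_sub_le [IsFiniteMeasure μ] (hP : Tame P) (hF : Measurable F)
    (H : LocalModel μ F P ψ D D') (m : ℕ) :
    ∃ C, 0 ≤ C ∧ ∀ t, 0 < t → t ≤ 1 → ∀ b η : ℝ, ∀ g : M → ℝ, ∀ g' : EuclideanSpace ℝ (Fin d) → ℝ,
      Measurable g → Measurable g' → (∀ y, |g y| ≤ b) → (∀ w, |g' w| ≤ b) →
      (∀ w ∈ D, |g (ψ w) - g' w| ≤ η) → ∀ z ∈ D',
      |∫ y, g y * Real.exp (-(chordalDist F (ψ z) y ^ 2) / (2 * t)) ∂μ -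
        ∫ w, g' w * Real.exp (-(dist (P z) (P w) ^ 2) / (2 * t)) ∂(modelVolume P)| ≤
      η * heatDensity (fun z w => dist (P z) (P w)) (modelVolume P) t z + C * b * t ^ m := by
  obtain ⟨c, hc, hlow⟩ := hP.lower
  obtain ⟨U, hU, hmap, a, ha, hsep⟩ := H.separated
  obtain ⟨C1, hC1, hI1⟩ := exists_integral_exp_modelVolume_le hP (show 0 < c ^ 2 / 4 by positivity)
  obtain ⟨C2, hC2, hexp2⟩ := exists_exp_neg_div_le (show 0 < a ^ 2 / 2 by positivity) m
  obtain ⟨C3, hC3, hexp3⟩ := exists_exp_neg_div_le (show 0 < c ^ 2 * a ^ 2 / 4 by positivity) m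
  refine ⟨C2 * μ.real univ + C3 * C1, by positivity, ?_⟩
  intro t ht ht1 b η g g' hg hg' hgb hgb' hη z hz
  have hzD := H.subset hz
  have hb : 0 ≤ b := (abs_nonneg _).trans (hgb' z)
  have hη0 : 0 ≤ η := (abs_nonneg _).trans (hη z hzD)
  have hPc := hP.contDiff.continuous
  set k : M → ℝ := fun y => Real.exp (-(chordalDist F (ψ z) y ^ 2) / (2 * t)) with hk
  set k' : EuclideanSpace ℝ (Fin d) → ℝ := fun w => Real.exp (-(dist (P z) (P w) ^ 2) / (2 * t))
    with hk'
  have hkm : Measurable k := by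
    simp only [hk, chordalDist]
    fun_prop
  have hk1 : ∀ y, k y ≤ 1 := fun y => by
    simp only [hk]
    rw [Real.exp_le_one_iff]
    exact div_nonpos_of_nonpos_of_nonneg (neg_nonpos.2 (sq_nonneg _)) (by positivity)
  have hk0 : ∀ y, 0 ≤ k y := fun y => (Real.exp_pos _).le
  have hk0' : ∀ y, 0 ≤ k' y := fun y => (Real.exp_pos _).le
  have hki' : Integrable k' (modelVolume P) := hP.integrable_heatKernel ht ht1 z
  have hgk : Integrable (fun y => g y * k y) μ := by
    refine Integrable.of_bound (hg.mul hkm).aestronglyMeasurable b (Eventually.of_forall fun y => ?_)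
    rw [norm_mul, Real.norm_eq_abs, Real.norm_eq_abs, abs_of_nonneg (hk0 y)]
    calc |g y| * k y ≤ b * 1 := by exact mul_le_mul (hgb y) (hk1 y) (hk0 y) hb
      _ = b := mul_one b
  have hgk' : Integrable (fun y => g' y * k' y) (modelVolume P) :=
    hki'.bdd_mul hg'.aestronglyMeasurable (Eventually.of_forall hgb')
  have hgkm : AEStronglyMeasurable (fun y => g y * k y)
      (((modelVolume P).restrict D).map ψ) := (hg.mul hkm).aestronglyMeasurable
  have hUint : ∫ y in U, g y * k y ∂μ = ∫ w in D, g (ψ w) * k' w ∂(modelVolume P) := by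
    rw [hmap, integral_map H.aemeasurable hgkm]
    refine setIntegral_congr_fun H.measurableSet fun w hw => ?_
    simp only [hk, hk', chordalDist, H.eqOn w hw, H.eqOn z hzD]
  have hDint : IntegrableOn (fun w => g (ψ w) * k' w) D (modelVolume P) := by
    have h1 : IntegrableOn (fun y => g y * k y) U μ := hgk.integrableOn
    rw [IntegrableOn, hmap, integrable_map_measure hgkm H.aemeasurable] at h1
    refine (integrableOn_congr_fun (fun w hw => ?_) H.measurableSet).1 h1
    simp only [hk, hk', chordalDist, H.eqOn w hw, H.eqOn z hzD, Function.comp_apply]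
  have hsplit : ∫ y, g y * k y ∂μ - ∫ w, g' w * k' w ∂(modelVolume P) =
      ∫ w in D, (g (ψ w) - g' w) * k' w ∂(modelVolume P) + ∫ y in Uᶜ, g y * k y ∂μ -
        ∫ w in Dᶜ, g' w * k' w ∂(modelVolume P) := by
    rw [← integral_add_compl hU hgk, ← integral_add_compl H.measurableSet hgk', hUint]
    simp only [sub_mul]
    rw [integral_sub hDint hgk'.integrableOn]
    ring
  have e1 : |∫ w in D, (g (ψ w) - g' w) * k' w ∂(modelVolume P)| ≤
      η * heatDensity (fun z w => dist (P z) (P w)) (modelVolume P) t z := by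
    calc |∫ w in D, (g (ψ w) - g' w) * k' w ∂(modelVolume P)|
        ≤ ∫ w in D, η * k' w ∂(modelVolume P) := by
          rw [← Real.norm_eq_abs]
          refine norm_integral_le_of_norm_le (hki'.const_mul η).integrableOn
            ((ae_restrict_iff' H.measurableSet).2 (Eventually.of_forall fun w hw => ?_))
          rw [norm_mul, Real.norm_eq_abs, Real.norm_eq_abs, abs_of_nonneg (hk0' w)]
          exact mul_le_mul_of_nonneg_right (hη w hw) (hk0' w)
      _ ≤ ∫ w, η * k' w ∂(modelVolume P) :=
          setIntegral_le_integral (hki'.const_mul η)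
            (Eventually.of_forall fun w => mul_nonneg hη0 (hk0' w))
      _ = _ := integral_const_mul _ _
  have e2 : |∫ y in Uᶜ, g y * k y ∂μ| ≤ b * (C2 * t ^ m) * μ.real univ := by
    rw [← Real.norm_eq_abs]
    refine (norm_setIntegral_le_of_norm_le_const (C := b * (C2 * t ^ m)) (measure_lt_top _ _)
      fun y hy => ?_).trans ?_
    · rw [norm_mul, Real.norm_eq_abs, Real.norm_eq_abs, abs_of_nonneg (hk0 y)]
      refine mul_le_mul (hgb y) ?_ (hk0 y) hb
      refine le_trans ?_ (hexp2 t ht)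
      simp only [hk, chordalDist, H.eqOn z hzD]
      have h1 := pow_le_pow_left₀ ha.le ((hsep z hz).1 y hy) 2
      refine Real.exp_le_exp.2 ?_
      calc -(dist (P z) (F y) ^ 2) / (2 * t) ≤ -(a ^ 2) / (2 * t) := by gcongr
        _ = -(a ^ 2 / 2 / t) := by field_simp
    · exact mul_le_mul_of_nonneg_left (measureReal_mono (subset_univ _)) (by positivity)
  have e3 : |∫ w in Dᶜ, g' w * k' w ∂(modelVolume P)| ≤ b * (C3 * t ^ m) * C1 := by
    have hI := (hI1 z).1.const_mul (b * (C3 * t ^ m))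
    calc |∫ w in Dᶜ, g' w * k' w ∂(modelVolume P)|
        ≤ ∫ w in Dᶜ, b * (C3 * t ^ m) * Real.exp (-(c ^ 2 / 4 * ‖z - w‖ ^ 2)) ∂(modelVolume P) := by
          rw [← Real.norm_eq_abs]
          refine norm_integral_le_of_norm_le hI.integrableOn
            ((ae_restrict_iff' H.measurableSet.compl).2 (Eventually.of_forall fun w hw => ?_))
          rw [norm_mul, Real.norm_eq_abs, Real.norm_eq_abs, abs_of_nonneg (hk0' w), mul_assoc b]
          refine mul_le_mul (hgb' w) ?_ (hk0' w) hb
          refine (heatKernel_model_le hc hlow ht ht1 z w).trans ?_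
          gcongr
          refine le_trans ?_ (hexp3 t ht)
          have h1 := pow_le_pow_left₀ ha.le ((hsep z hz).2 w hw) 2
          refine Real.exp_le_exp.2 ?_
          gcongr
      _ ≤ ∫ w, b * (C3 * t ^ m) * Real.exp (-(c ^ 2 / 4 * ‖z - w‖ ^ 2)) ∂(modelVolume P) :=
          setIntegral_le_integral hI (Eventually.of_forall fun w => by positivity)
      _ ≤ b * (C3 * t ^ m) * C1 := by
          rw [integral_const_mul]
          exact mul_le_mul_of_nonneg_left (hI1 z).2 (by positivity)
  rw [hsplit]
  refine (abs_sub _ _).trans ?_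
  have := abs_add_le (∫ w in D, (g (ψ w) - g' w) * k' w ∂(modelVolume P)) (∫ y in Uᶜ, g y * k y ∂μ)
  have h5 : (C2 * μ.real univ + C3 * C1) * b * t ^ m =
    b * (C2 * t ^ m) * μ.real univ + b * (C3 * t ^ m) * C1 := by ring
  linarith

/-- The true order is `t ^ (d / 2)`. The weaker integral power suffices, since the tails it is
compared with beat every power of `t`. -/
theorem Tame.exists_heatDensity_ge (hP : Tame P) : ∃ c, 0 < c ∧ ∀ t, 0 < t → t ≤ 1 → ∀ z,
    c * t ^ d ≤ heatDensity (fun z w => dist (P z) (P w)) (modelVolume P) t z := by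
  obtain ⟨c, hc, h⟩ := exists_heatDen_ge hP
  refine ⟨c, hc, fun t ht ht1 z => ?_⟩
  have hs : 0 < √t := Real.sqrt_pos.2 ht
  have h1 := heatDensity_model_eq hP z hs.ne'
  rw [Real.sq_sqrt ht.le] at h1
  have h2 : heatDensity (fun z w => dist (P z) (P w)) (modelVolume P) t z =
    |√t| ^ d * heatDen P (z, √t) := h1
  rw [h2, abs_of_pos hs, mul_comm]
  have h3 : t ≤ √t := by
    rw [Real.le_sqrt ht.le ht.le]
    nlinarith
  gcongr
  exact h _

theorem LocalModel.exists_abs_heatOperator_sub_le [IsFiniteMeasure μ] (hP : Tame P)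
    (hF : Measurable F) (H : LocalModel μ F P ψ D D') (m : ℕ) :
    ∃ C, 0 ≤ C ∧ ∀ t, 0 < t → t ≤ 1 → ∀ B η : ℝ, ∀ h : M → ℝ, ∀ h' : EuclideanSpace ℝ (Fin d) → ℝ,
      Measurable h → Measurable h' → (∀ y, |h y| ≤ B) → (∀ w, |h' w| ≤ B) →
      (∀ w ∈ D, |h (ψ w) - h' w| ≤ η) → ∀ z ∈ D',
      |heatOperator (chordalDist F) μ t h (ψ z) - modelHeat P t h' z| ≤
        C * (η / t + B * t ^ m) := by
  -- Of these powers, `d` are lost to the lower bound of the density and one to the factor `1 / t`.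
  obtain ⟨C, hC, hmain⟩ := H.exists_abs_integral_sub_le hP hF (m + 1 + d)
  obtain ⟨c, hc, hlow⟩ := hP.exists_heatDensity_ge
  refine ⟨4 + 8 * C / c, by positivity, ?_⟩
  intro t ht ht1 B η h h' hh hh' hB hB' hη z hz
  have hB0 : 0 ≤ B := (abs_nonneg _).trans (hB' z)
  have hη0 : 0 ≤ η := (abs_nonneg _).trans (hη z (H.subset hz))
  have h1 := hmain t ht ht1 (2 * B) (2 * η) (fun y => h y - h (ψ z)) (fun w => h' w - h' z)
    (hh.sub_const _) (hh'.sub_const _)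
    (fun y => (abs_sub _ _).trans (by linarith [hB y, hB (ψ z)]))
    (fun y => (abs_sub _ _).trans (by linarith [hB' y, hB' z]))
    (fun w hw => by
      have e : h (ψ w) - h (ψ z) - (h' w - h' z) = (h (ψ w) - h' w) - (h (ψ z) - h' z) := by ring
      rw [e]
      exact (abs_sub _ _).trans (by linarith [hη w hw, hη z (H.subset hz)])) z hz
  have h2 := hmain t ht ht1 1 0 (fun _ => 1) (fun _ => 1) measurable_const measurable_const
    (by simp) (by simp) (by simp) z hz
  simp only [one_mul, zero_mul, zero_add, mul_one] at h2
  set θ' := heatDensity (fun z w => dist (P z) (P w)) (modelVolume P) t z with hθ'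
  have hl := hlow t ht ht1 z
  rw [← hθ'] at hl
  have hθ'0 : 0 < θ' := lt_of_lt_of_le (by positivity) hl
  have hk : Integrable (fun y => Real.exp (-(chordalDist F (ψ z) y ^ 2) / (2 * t))) μ := by
    refine Integrable.of_bound ?_ 1 (Eventually.of_forall fun y => ?_)
    · simp only [chordalDist]
      exact (by fun_prop : Measurable fun y => Real.exp (-(dist (F (ψ z)) (F y) ^ 2) / (2 * t))
        ).aestronglyMeasurable
    · rw [Real.norm_eq_abs, Real.abs_exp, Real.exp_le_one_iff]
      exact div_nonpos_of_nonpos_of_nonneg (neg_nonpos.2 (sq_nonneg _)) (by positivity)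
  have h3 := abs_div_sub_div_le (Nu' := ∫ w, (h' w - h' z) *
      Real.exp (-(dist (P z) (P w) ^ 2) / (2 * t)) ∂(modelVolume P)) ht hB0
    (heatDensity_nonneg (ρ := chordalDist F) (μ := μ) t (ψ z)) hθ'0
    (abs_integral_heatKernel_le hB hk)
  refine h3.trans ?_
  have h2' : |heatDensity (chordalDist F) μ t (ψ z) - θ'| ≤ C * t ^ (m + 1 + d) := h2
  calc 2 / (t * θ') * _ ≤ 2 / (t * θ') * ((2 * η * θ' + C * (2 * B) * t ^ (m + 1 + d)) +
        2 * B * (C * t ^ (m + 1 + d))) := by gcongr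
    _ = 4 * (η / t) + 8 * C * B * t ^ (m + d) / θ' := by
        field_simp
        ring
    _ ≤ 4 * (η / t) + 8 * C * B * t ^ (m + d) / (c * t ^ d) := by gcongr
    _ = 4 * (η / t) + 8 * C / c * (B * t ^ m) := by
        field_simp
        ring
    _ ≤ (4 + 8 * C / c) * (η / t + B * t ^ m) := by
        have h5 : 0 ≤ η / t := by positivity
        have h6 : 0 ≤ B * t ^ m := by positivity
        have h7 : 0 ≤ 8 * C / c := by positivity
        nlinarith [mul_nonneg h7 h5]

end LocalModel

end CoarseRicci

end

noncomputable section

namespace CoarseRicci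

theorem carreDuChamp_comm {X : Type*} (L : (X → ℝ) → X → ℝ) (u v : X → ℝ) :
    carreDuChamp L u v = carreDuChamp L v u := by
  ext x
  simp only [carreDuChamp]
  rw [show (fun y => u y * v y) = fun y => v y * u y from funext fun y => mul_comm _ _]
  ring

theorem iteratedCarreDuChamp_self {X : Type*} (L : (X → ℝ) → X → ℝ) (f : X → ℝ) (x : X) :
    iteratedCarreDuChamp L f f x = 1 / 2 * L (carreDuChamp L f f) x -
      1 / 2 * (L (fun y => L f y * f y) x - L (L f) x * f x - L f x * L f x) := by
  rw [iteratedCarreDuChamp, carreDuChamp_comm L f (L f)]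
  rw [carreDuChamp.eq_1 L (L f) f]
  ring

/-! ### Localization of `Γ₂` -/

section LocalModel

variable {d N : ℕ} {P : EuclideanSpace ℝ (Fin d) → EuclideanSpace ℝ (Fin N)}
  {M : Type*} [MeasurableSpace M] {μ : Measure M} {F : M → EuclideanSpace ℝ (Fin N)}
  {ψ : EuclideanSpace ℝ (Fin d) → M} {D D' D₁ D₂ : Set (EuclideanSpace ℝ (Fin d))}

/-- The operators are nonlocal, so each application shrinks the region of comparison: `f` and `f'`
agree on `D`, the inner operators are compared on `D₁`, the outer ones on `D₂`. -/
theorem LocalModel.exists_abs_iteratedCarreDuChamp_sub_le [IsFiniteMeasure μ] (hP : Tame P)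
    (hF : Measurable F) (H₁ : LocalModel μ F P ψ D D₁) (H₂ : LocalModel μ F P ψ D₁ D₂) :
    ∃ C, 0 ≤ C ∧ ∀ t, 0 < t → t ≤ 1 → ∀ B : ℝ, ∀ f : M → ℝ, ∀ f' : EuclideanSpace ℝ (Fin d) → ℝ,
      Measurable f → Measurable f' → (∀ y, |f y| ≤ B) → (∀ w, |f' w| ≤ B) →
      (∀ w ∈ D, f (ψ w) = f' w) → ∀ z ∈ D₂,
      |iteratedCarreDuChamp (heatOperator (chordalDist F) μ t) f f (ψ z) -
        iteratedCarreDuChamp (modelHeat P t) f' f' z| ≤ C * B ^ 2 * t := by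
  -- The exponent 2 leaves one power of `t`: the outer operator divides the inner error `t ^ 2` by
  -- `t`, and its input is itself of size `1 / t`.
  obtain ⟨C1, hC1, h1⟩ := H₁.exists_abs_heatOperator_sub_le hP hF 2
  obtain ⟨C2, hC2, h2⟩ := H₂.exists_abs_heatOperator_sub_le hP hF 2
  refine ⟨C2 * (2 * C1 + 7) + 4 * C1, by positivity, ?_⟩
  intro t ht ht1 B f f' hf hf' hfB hfB' hff z hz
  have hB0 : 0 ≤ B := (abs_nonneg _).trans (hfB' z)
  have hρ : Measurable (Function.uncurry (chordalDist F)) := by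
    simp only [Function.uncurry_def, chordalDist]
    fun_prop
  have hPc := hP.contDiff.continuous
  have hρ' : Measurable (Function.uncurry fun z w => dist (P z) (P w)) := by
    simp only [Function.uncurry_def]
    exact (by fun_prop : Continuous fun q : EuclideanSpace ℝ (Fin d) × EuclideanSpace ℝ (Fin d) =>
      dist (P q.1) (P q.2)).measurable
  set L := heatOperator (chordalDist F) μ t with hL
  set L' := modelHeat P t with hL'
  have hD1 : ∀ w ∈ D₁, f (ψ w) = f' w := fun w hw => hff w (H₁.subset hw)
  have hLm : ∀ {u : M → ℝ}, Measurable u → Measurable (L u) := fun hu =>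
    measurable_heatOperator hρ hu t
  have hLm' : ∀ {u : EuclideanSpace ℝ (Fin d) → ℝ}, Measurable u → Measurable (L' u) := fun hu =>
    measurable_heatOperator hρ' hu t
  have hLb : ∀ x, |L f x| ≤ 4 * B / t := abs_heatOperator_le hfB ht
  have hLb' : ∀ x, |L' f' x| ≤ 4 * B / t := abs_heatOperator_le hfB' ht
  have hLf : ∀ w ∈ D₁, |L f (ψ w) - L' f' w| ≤ C1 * (B * t ^ 2) := fun w hw => by
    have := h1 t ht ht1 B 0 f f' hf hf' hfB hfB' (fun w hw => by simp [hff w hw]) w hw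
    simpa using this
  have hLff : ∀ w ∈ D₁, |L (fun y => f y * f y) (ψ w) - L' (fun y => f' y * f' y) w| ≤
      C1 * (B ^ 2 * t ^ 2) := fun w hw => by
    have := h1 t ht ht1 (B ^ 2) 0 (fun y => f y * f y) (fun y => f' y * f' y) (hf.mul hf)
      (hf'.mul hf') (fun y => by rw [abs_mul, ← pow_two]; gcongr; exact hfB y)
      (fun y => by rw [abs_mul, ← pow_two]; gcongr; exact hfB' y)
      (fun w hw => by simp [hff w hw]) w hw
    simpa using this
  have hmulf : ∀ w ∈ D₁, |L f (ψ w) * f (ψ w) - L' f' w * f' w| ≤ C1 * (B ^ 2 * t ^ 2) :=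
    fun w hw => by
    rw [hD1 w hw, ← sub_mul, abs_mul]
    calc _ ≤ C1 * (B * t ^ 2) * B :=
          mul_le_mul (hLf w hw) (hfB' w) (abs_nonneg _) (by positivity)
      _ = _ := by ring
  have hΓ : ∀ w ∈ D₁, |carreDuChamp L f f (ψ w) - carreDuChamp L' f' f' w| ≤
      3 / 2 * C1 * (B ^ 2 * t ^ 2) := fun w hw => by
    have e : carreDuChamp L f f (ψ w) - carreDuChamp L' f' f' w =
        1 / 2 * (L (fun y => f y * f y) (ψ w) - L' (fun y => f' y * f' y) w) -
          (L f (ψ w) * f (ψ w) - L' f' w * f' w) := by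
      simp only [carreDuChamp]; ring
    rw [e]
    refine (abs_sub _ _).trans ?_
    rw [abs_mul, abs_of_pos (by norm_num : (0 : ℝ) < 1 / 2)]
    linarith [hLff w hw, hmulf w hw]
  have hA : |L (carreDuChamp L f f) (ψ z) - L' (carreDuChamp L' f' f') z| ≤ _ := h2 t ht ht1 (6 * (B * B) / t) (3 / 2 * C1 * (B ^ 2 * t ^ 2)) _ _
    (measurable_carreDuChamp_heatOperator hρ hf hf t)
    (measurable_carreDuChamp_heatOperator (μ := modelVolume P) hρ' hf' hf' t)
    (abs_carreDuChamp_heatOperator_le hfB hfB ht) (abs_carreDuChamp_heatOperator_le hfB' hfB' ht)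
    hΓ z hz
  have hbd : ∀ {a b : ℝ}, |a| ≤ 4 * B / t → |b| ≤ B → |a * b| ≤ 4 * B ^ 2 / t := fun ha hb => by
    rw [abs_mul]
    calc _ ≤ 4 * B / t * B := mul_le_mul ha hb (abs_nonneg _) (by positivity)
      _ = _ := by ring
  have hE : |L (fun y => L f y * f y) (ψ z) - L' (fun y => L' f' y * f' y) z| ≤ _ := h2 t ht ht1 (4 * B ^ 2 / t) (C1 * (B ^ 2 * t ^ 2)) (fun y => L f y * f y)
    (fun y => L' f' y * f' y) ((hLm hf).mul hf) ((hLm' hf').mul hf')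
    (fun y => hbd (hLb y) (hfB y)) (fun y => hbd (hLb' y) (hfB' y)) hmulf z hz
  have hG := h2 t ht ht1 (4 * B / t) (C1 * (B * t ^ 2)) (L f) (L' f') (hLm hf) (hLm' hf')
    hLb hLb' hLf z hz
  have hG' : |L (L f) (ψ z) * f (ψ z) - L' (L' f') z * f' z| ≤
      C2 * (C1 * (B * t ^ 2) / t + 4 * B / t * t ^ 2) * B := by
    rw [hD1 z (H₂.subset hz), ← sub_mul, abs_mul]
    exact mul_le_mul hG (hfB' z) (abs_nonneg _) (by positivity)
  have hQ : |L f (ψ z) * L f (ψ z) - L' f' z * L' f' z| ≤ C1 * (B * t ^ 2) * (8 * B / t) := by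
    rw [show L f (ψ z) * L f (ψ z) - L' f' z * L' f' z =
      (L f (ψ z) - L' f' z) * (L f (ψ z) + L' f' z) by ring, abs_mul]
    refine mul_le_mul (hLf z (H₂.subset hz)) ?_ (abs_nonneg _) (by positivity)
    calc _ ≤ |L f (ψ z)| + |L' f' z| := abs_add_le _ _
      _ ≤ 4 * B / t + 4 * B / t := add_le_add (hLb _) (hLb' _)
      _ = _ := by ring
  rw [iteratedCarreDuChamp_self, iteratedCarreDuChamp_self]
  have eA : C2 * (3 / 2 * C1 * (B ^ 2 * t ^ 2) / t + 6 * (B * B) / t * t ^ 2) =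
      C2 * (3 / 2 * C1 + 6) * (B ^ 2 * t) := by field_simp
  have eE : C2 * (C1 * (B ^ 2 * t ^ 2) / t + 4 * B ^ 2 / t * t ^ 2) =
      C2 * (C1 + 4) * (B ^ 2 * t) := by field_simp
  have eG : C2 * (C1 * (B * t ^ 2) / t + 4 * B / t * t ^ 2) * B =
      C2 * (C1 + 4) * (B ^ 2 * t) := by field_simp
  have eQ : C1 * (B * t ^ 2) * (8 * B / t) = 8 * C1 * (B ^ 2 * t) := by field_simp
  rw [eA] at hA
  rw [eE] at hE
  rw [eG] at hG'
  rw [eQ] at hQ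
  have hx : 0 ≤ C2 * C1 * (B ^ 2 * t) := by positivity
  have hy : 0 ≤ C1 * (B ^ 2 * t) := by positivity
  rw [abs_le] at hA hE hG' hQ ⊢
  constructor <;> nlinarith [hA.1, hA.2, hE.1, hE.2, hG'.1, hG'.2, hQ.1, hQ.2]

theorem LocalModel.tendsto_heatOperator [IsFiniteMeasure μ] (hP : Tame P)
    (hF : Measurable F) (H : LocalModel μ F P ψ D D') {B : ℝ} {h : M → ℝ}
    {h' : EuclideanSpace ℝ (Fin d) → ℝ} (hh : Measurable h) (hB : ∀ y, |h y| ≤ B)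
    (hh' : CkBound 2 B h') (heq : ∀ w ∈ D, h (ψ w) = h' w) {z : EuclideanSpace ℝ (Fin d)}
    (hz : z ∈ D') :
    Tendsto (fun t => heatOperator (chordalDist F) μ t h (ψ z)) (𝓝[>] 0)
      (𝓝 (coordLaplacian P h' z)) := by
  obtain ⟨C, hC, hc⟩ := H.exists_abs_heatOperator_sub_le hP hF 1
  have h1 := tendsto_modelHeat hP hh' z
  have h2 : Tendsto (fun t : ℝ => C * (B * t)) (𝓝[>] 0) (𝓝 0) := by
    have : Tendsto (fun t : ℝ => C * (B * t)) (𝓝 0) (𝓝 (C * (B * 0))) :=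
      (Continuous.tendsto (by fun_prop) 0)
    simpa using this.mono_left nhdsWithin_le_nhds
  have h3 : Tendsto (fun t => heatOperator (chordalDist F) μ t h (ψ z) - modelHeat P t h' z)
      (𝓝[>] 0) (𝓝 0) := by
    refine squeeze_zero_norm' ?_ h2
    filter_upwards [Ioc_mem_nhdsGT (show (0 : ℝ) < 1 by norm_num)] with t ht
    have := hc t ht.1 ht.2 B 0 h h' hh hh'.1.continuous.measurable hB
      (fun w => hh'.norm_le w) (fun w hw => by simp [heq w hw]) z hz
    simpa using this
  simpa using h3.add h1

end LocalModel

end CoarseRicci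

end

noncomputable section

namespace CoarseRicci

/-! ### Immersions in charts -/

section Immersion

variable {d N : ℕ} {M : Type*} [TopologicalSpace M] [ChartedSpace (EuclideanSpace ℝ (Fin d)) M]
  [IsManifold (𝓡 d) ∞ M] {F : M → EuclideanSpace ℝ (Fin N)}

theorem contMDiffAt_chartAt_symm (p : M) {z : EuclideanSpace ℝ (Fin d)}
    (hz : z ∈ (chartAt (EuclideanSpace ℝ (Fin d)) p).target) :
    ContMDiffAt (𝓡 d) (𝓡 d) ∞ (chartAt (EuclideanSpace ℝ (Fin d)) p).symm z :=
  contMDiffAt_symm_of_mem_maximalAtlas (IsManifold.chart_mem_maximalAtlas (I := 𝓡 d) p) hz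

theorem contMDiffAt_chartAt (p : M) {x : M}
    (hx : x ∈ (chartAt (EuclideanSpace ℝ (Fin d)) p).source) :
    ContMDiffAt (𝓡 d) (𝓡 d) ∞ (chartAt (EuclideanSpace ℝ (Fin d)) p) x :=
  contMDiffAt_of_mem_maximalAtlas (IsManifold.chart_mem_maximalAtlas (I := 𝓡 d) p) hx

theorem contDiffAt_localParam (hF : ContMDiff (𝓡 d) (𝓡 N) ∞ F) (p : M)
    {z : EuclideanSpace ℝ (Fin d)} (hz : z ∈ (chartAt (EuclideanSpace ℝ (Fin d)) p).target) :
    ContDiffAt ℝ ∞ (localParam (d := d) F p) z :=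
  contMDiffAt_iff_contDiffAt.1
    (hF.contMDiffAt.comp z (contMDiffAt_chartAt_symm p hz))

/-- In the normal form `v ↦ (v, 0)` of an immersion, projecting to the first factor recovers the
chart coordinate smoothly from the ambient point. Injectivity of the differential follows by the
chain rule. -/
theorem exists_smooth_leftInverse {x : M}
    (hF : IsImmersionAt (𝓡 d) (𝓡 N) ∞ F x) (p : M)
    (hx : x ∈ (chartAt (EuclideanSpace ℝ (Fin d)) p).source) :
    ∃ G : EuclideanSpace ℝ (Fin N) → EuclideanSpace ℝ (Fin d), ContDiffAt ℝ ∞ G (F x) ∧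
      ∀ᶠ y in 𝓝 x, G (F y) = chartAt (EuclideanSpace ℝ (Fin d)) p y := by
  set h := hF
  set φ := chartAt (EuclideanSpace ℝ (Fin d)) p
  have hw := h.writtenInCharts
  have key : ∀ y ∈ h.domChart.source, (h.equiv.symm (h.codChart (F y))).1 = h.domChart y := by
    intro y hy
    have h1 := hw (x := h.domChart y) (by simpa using h.domChart.map_source hy)
    simp only [Function.comp_apply, OpenPartialHomeomorph.extend_coe,
      OpenPartialHomeomorph.extend_coe_symm, modelWithCornersSelf_coe, id_eq,
      modelWithCornersSelf_coe_symm, h.domChart.left_inv hy] at h1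
    rw [h1]
    simp
  refine ⟨fun w => φ (h.domChart.symm (h.equiv.symm (h.codChart w)).1), ?_, ?_⟩
  · have hx1 := h.mem_domChart_source
    have e1 : ContMDiffAt (𝓡 N) (𝓡 N) ∞ h.codChart (F x) :=
      contMDiffAt_of_mem_maximalAtlas h.codChart_mem_maximalAtlas h.mem_codChart_source
    have e2 : ContDiffAt ℝ ∞ (fun v => (h.equiv.symm v).1) (h.codChart (F x)) :=
      (contDiff_fst.comp h.equiv.symm.contDiff).contDiffAt
    have e3 : ContMDiffAt (𝓡 N) (𝓡 d) ∞ (fun w => (h.equiv.symm (h.codChart w)).1) (F x) :=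
      (contMDiffAt_iff_contDiffAt.2 e2).comp (F x) e1
    have hk := key x hx1
    have e4 : ContMDiffAt (𝓡 d) (𝓡 d) ∞ h.domChart.symm (h.equiv.symm (h.codChart (F x))).1 := by
      rw [hk]
      exact contMDiffAt_symm_of_mem_maximalAtlas h.domChart_mem_maximalAtlas
        (h.domChart.map_source hx1)
    have e5 : ContMDiffAt (𝓡 d) (𝓡 d) ∞ φ
        (h.domChart.symm (h.equiv.symm (h.codChart (F x))).1) := by
      rw [hk, h.domChart.left_inv hx1]
      exact contMDiffAt_chartAt p hx
    exact contMDiffAt_iff_contDiffAt.1 (e5.comp (F x) (e4.comp (F x) e3))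
  · filter_upwards [h.domChart.open_source.mem_nhds h.mem_domChart_source] with y hy
    simp only [key y hy, h.domChart.left_inv hy]

theorem injective_fderiv_localParam (hF : IsImmersion (𝓡 d) (𝓡 N) ∞ F)
    (hFs : ContMDiff (𝓡 d) (𝓡 N) ∞ F) (p : M)
    {z : EuclideanSpace ℝ (Fin d)} (hz : z ∈ (chartAt (EuclideanSpace ℝ (Fin d)) p).target) :
    Function.Injective (fderiv ℝ (localParam (d := d) F p) z) := by
  set φ := chartAt (EuclideanSpace ℝ (Fin d)) p
  obtain ⟨G, hG, hGF⟩ := exists_smooth_leftInverse (hF.isImmersionAt (φ.symm z)) p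
    (φ.map_target hz)
  have h1 : (fun w => G (localParam (d := d) F p w)) =ᶠ[𝓝 z] id := by
    have hc : ContinuousAt φ.symm z := φ.continuousAt_symm hz
    filter_upwards [hc.eventually hGF, φ.open_target.mem_nhds hz] with w hw hwt
    simp only [localParam]
    rw [hw]
    exact φ.right_inv hwt
  have h2 : HasFDerivAt (fun w => G (localParam (d := d) F p w))
      ((fderiv ℝ G (F (φ.symm z))).comp (fderiv ℝ (localParam (d := d) F p) z)) z :=
    HasFDerivAt.comp z (g := G) (f := localParam (d := d) F p)
      (hG.differentiableAt (by simp)).hasFDerivAt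
      ((contDiffAt_localParam hFs p hz).differentiableAt (by simp)).hasFDerivAt
  have h3 := (h2.congr_of_eventuallyEq h1.symm).unique (hasFDerivAt_id z)
  intro v w hvw
  have h4 := congrArg (fun T => T v) h3
  have h5 := congrArg (fun T => T w) h3
  simp only [ContinuousLinearMap.comp_apply, ContinuousLinearMap.id_apply] at h4 h5
  rw [← h4, ← h5, hvw]

end Immersion

/-! ### The Riemannian volume as a supremum of chart measures -/

section SupMeasure

variable {α : Type*} [MeasurableSpace α]

theorem restrict_iSup_eq {ι : Type*} {μ : ι → Measure α} {i : ι} {s : Set α} (hs : MeasurableSet s)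
    (h : ∀ j, (μ j).restrict s ≤ μ i) : (⨆ j, μ j).restrict s = (μ i).restrict s := by
  refine le_antisymm ?_ (Measure.restrict_mono le_rfl (le_iSup μ i))
  -- The right side is an upper bound of the whole family, hence of the supremum; restricting to `s`
  -- kills its second summand.
  have h1 : ⨆ j, μ j ≤ (μ i).restrict s + (⨆ j, μ j).restrict sᶜ := by
    refine iSup_le fun j => ?_
    rw [← Measure.restrict_add_restrict_compl (μ := μ j) hs]
    refine add_le_add ?_ (Measure.restrict_mono le_rfl (le_iSup μ j))
    have := Measure.restrict_mono (s := s) (s' := s) le_rfl (h j)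
    rwa [Measure.restrict_restrict hs, inter_self] at this
  have h2 := Measure.restrict_mono (s := s) (s' := s) le_rfl h1
  rwa [Measure.restrict_add, Measure.restrict_restrict hs, Measure.restrict_restrict hs, inter_self,
    inter_compl_self, Measure.restrict_empty, add_zero] at h2

end SupMeasure

section ChartVolume

variable {d N : ℕ} {M : Type*} [TopologicalSpace M] [ChartedSpace (EuclideanSpace ℝ (Fin d)) M]
  [MeasurableSpace M] [BorelSpace M] {F : M → EuclideanSpace ℝ (Fin N)}

theorem aemeasurable_chartAt_symm (p : M) {s : Set (EuclideanSpace ℝ (Fin d))}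
    (hs : MeasurableSet s) (hst : s ⊆ (chartAt (EuclideanSpace ℝ (Fin d)) p).target)
    (μ : Measure (EuclideanSpace ℝ (Fin d))) :
    AEMeasurable (chartAt (EuclideanSpace ℝ (Fin d)) p).symm (μ.restrict s) :=
  ((chartAt (EuclideanSpace ℝ (Fin d)) p).continuousOn_symm.mono hst).aemeasurable hs

theorem chartVolume_apply (p : M) {A : Set M} (hA : MeasurableSet A) :
    chartVolume (d := d) F p A = ∫⁻ z in (chartAt (EuclideanSpace ℝ (Fin d)) p).target ∩
      (chartAt (EuclideanSpace ℝ (Fin d)) p).symm ⁻¹' A,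
        ENNReal.ofReal (volumeDensity (localParam (d := d) F p) z) := by
  set φ := chartAt (EuclideanSpace ℝ (Fin d)) p
  have hm : MeasurableSet (φ.target ∩ φ.symm ⁻¹' A) := by
    have := (continuousOn_iff_continuous_domRestrict.1 φ.continuousOn_symm).measurable hA
    have h2 := (MeasurableEmbedding.subtype_coe φ.open_target.measurableSet).measurableSet_image.2
      this
    convert h2 using 1
    ext z
    simp [and_comm]
  have hae : AEMeasurable φ.symm ((volume.restrict φ.target).withDensity
      (fun z => ENNReal.ofReal (volumeDensity (localParam (d := d) F p) z))) :=
    (aemeasurable_chartAt_symm p φ.open_target.measurableSet subset_rfl volume).mono_ac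
      (withDensity_absolutelyContinuous _ _)
  rw [chartVolume, Measure.map_apply_of_aemeasurable hae hA]
  rw [← restrict_withDensity φ.open_target.measurableSet,
    Measure.restrict_apply' φ.open_target.measurableSet, inter_comm, withDensity_apply _ hm]

end ChartVolume

end CoarseRicci

end

noncomputable section

namespace CoarseRicci

section VolumeForm

variable {d N : ℕ}

/-- The Gram matrix transforms by congruence with the matrix of `J`, whose determinant therefore
enters squared. -/
theorem gram_comp_det (T : EuclideanSpace ℝ (Fin d) →L[ℝ] EuclideanSpace ℝ (Fin N))
    (J : EuclideanSpace ℝ (Fin d) →L[ℝ] EuclideanSpace ℝ (Fin d)) :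
    (gram (T.comp J)).det = J.det ^ 2 * (gram T).det := by
  set b := (EuclideanSpace.basisFun (Fin d) ℝ).toBasis with hb
  set A := LinearMap.toMatrix b b (J : EuclideanSpace ℝ (Fin d) →ₗ[ℝ] EuclideanSpace ℝ (Fin d))
    with hA
  have hAe : ∀ k i, A k i = J (EuclideanSpace.single i 1) k := fun k i => by
    simp [hA, hb, LinearMap.toMatrix_apply]
  have h1 : gram (T.comp J) = A.transpose * gram T * A := by
    ext i j
    have := inner_map_map_eq_gram T (J (EuclideanSpace.single i 1)) (J (EuclideanSpace.single j 1))
    simp only [gram, Matrix.of_apply, ContinuousLinearMap.comp_apply] at this ⊢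
    rw [this]
    simp only [Matrix.mul_apply, Matrix.transpose_apply, hAe, Finset.sum_mul, Matrix.of_apply]
    rw [Finset.sum_comm]
  rw [h1, Matrix.det_mul, Matrix.det_mul, Matrix.det_transpose, hA, LinearMap.det_toMatrix]
  rw [ContinuousLinearMap.det]
  ring

theorem volumeDensity_comp {P : EuclideanSpace ℝ (Fin d) → EuclideanSpace ℝ (Fin N)}
    {Q : EuclideanSpace ℝ (Fin d) → EuclideanSpace ℝ (Fin N)}
    {τ : EuclideanSpace ℝ (Fin d) → EuclideanSpace ℝ (Fin d)} {z : EuclideanSpace ℝ (Fin d)}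
    (hP : DifferentiableAt ℝ P (τ z)) (hτ : DifferentiableAt ℝ τ z)
    (hQ : Q =ᶠ[𝓝 z] fun w => P (τ w)) :
    volumeDensity Q z = |(fderiv ℝ τ z).det| * volumeDensity P (τ z) := by
  have h1 : fderiv ℝ Q z = (fderiv ℝ P (τ z)).comp (fderiv ℝ τ z) := by
    rw [hQ.fderiv_eq]
    exact fderiv_comp z hP hτ
  simp only [volumeDensity, inducedMetric_eq_gram, h1, gram_comp_det]
  rw [Real.sqrt_mul (sq_nonneg _), Real.sqrt_sq_eq_abs]

theorem volumeDensity_congr {P Q : EuclideanSpace ℝ (Fin d) → EuclideanSpace ℝ (Fin N)}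
    {z : EuclideanSpace ℝ (Fin d)} (h : P =ᶠ[𝓝 z] Q) : volumeDensity P z = volumeDensity Q z := by
  simp only [volumeDensity, inducedMetric_eq_gram, h.fderiv_eq]

end VolumeForm

/-! ### Agreement of the volume with each chart measure -/

section RiemannianVolume

variable {d N : ℕ} {M : Type*} [TopologicalSpace M] [ChartedSpace (EuclideanSpace ℝ (Fin d)) M]
  [IsManifold (𝓡 d) ∞ M] [MeasurableSpace M] [BorelSpace M] {F : M → EuclideanSpace ℝ (Fin N)}

/-- Change of variables along the transition map `τ`, whose Jacobian is the ratio of the densities.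
An inequality is enough for `restrict_iSup_eq`, so the image of the overlap only has to lie in the
chart at `p`. -/
theorem chartVolume_restrict_le (hF : ContMDiff (𝓡 d) (𝓡 N) ∞ F) (p q : M) :
    (chartVolume (d := d) F q).restrict (chartAt (EuclideanSpace ℝ (Fin d)) p).source ≤
      chartVolume (d := d) F p := by
  set φ := chartAt (EuclideanSpace ℝ (Fin d)) p with hφ
  set χ := chartAt (EuclideanSpace ℝ (Fin d)) q with hχ
  refine Measure.le_iff.2 fun A hA => ?_
  rw [Measure.restrict_apply hA, chartVolume_apply q (hA.inter φ.open_source.measurableSet),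
    chartVolume_apply p hA, ← hφ, ← hχ]
  set s := χ.target ∩ χ.symm ⁻¹' (A ∩ φ.source) with hs
  have hsm : MeasurableSet s := by
    have h1 := (continuousOn_iff_continuous_domRestrict.1 χ.continuousOn_symm).measurable
      (hA.inter φ.open_source.measurableSet)
    have h2 := (MeasurableEmbedding.subtype_coe χ.open_target.measurableSet).measurableSet_image.2
      h1
    convert h2 using 1
    ext z
    simp only [hs, mem_inter_iff, mem_preimage, mem_image, Subtype.exists, domRestrict_apply]
    aesop
  set τ : EuclideanSpace ℝ (Fin d) → EuclideanSpace ℝ (Fin d) := fun z => φ (χ.symm z)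
  have hτd : ∀ z ∈ s, DifferentiableAt ℝ τ z := fun z hz => by
    have : ContDiffAt ℝ ∞ τ z := contMDiffAt_iff_contDiffAt.1
      ((contMDiffAt_chartAt p hz.2.2).comp z (contMDiffAt_chartAt_symm q hz.1))
    exact this.differentiableAt (by simp)
  have hinj : InjOn τ s := fun z hz w hw h => by
    have h1 := φ.injOn hz.2.2 hw.2.2 h
    exact χ.symm.injOn hz.1 hw.1 h1
  have hdens : ∀ z ∈ s, volumeDensity (localParam (d := d) F q) z =
      |(fderiv ℝ τ z).det| * volumeDensity (localParam (d := d) F p) (τ z) := fun z hz => by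
    refine volumeDensity_comp ((contDiffAt_localParam hF p (φ.map_source hz.2.2)).differentiableAt
      (by simp)) (hτd z hz) ?_
    have hc : ContinuousAt χ.symm z := χ.continuousAt_symm hz.1
    filter_upwards [hc.preimage_mem_nhds (φ.open_source.mem_nhds hz.2.2)] with w hw
    simp only [localParam, τ, ← hφ, ← hχ]
    rw [φ.left_inv hw]
  have hcv := lintegral_image_eq_lintegral_abs_det_fderiv_mul volume hsm
    (fun z hz => (hτd z hz).hasFDerivAt.hasFDerivWithinAt) hinj
    (fun z => ENNReal.ofReal (volumeDensity (localParam (d := d) F p) z))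
  rw [setLIntegral_congr_fun hsm (g := fun z => ENNReal.ofReal |(fderiv ℝ τ z).det| *
    ENNReal.ofReal (volumeDensity (localParam (d := d) F p) (τ z))) (fun z hz => by
      rw [hdens z hz, ENNReal.ofReal_mul (abs_nonneg _)]), ← hcv]
  refine lintegral_mono_set ?_
  rintro _ ⟨z, hz, rfl⟩
  refine ⟨φ.map_source hz.2.2, ?_⟩
  simp only [τ, mem_preimage, φ.left_inv hz.2.2]
  exact hz.2.1

theorem riemannianVolume_restrict (hF : ContMDiff (𝓡 d) (𝓡 N) ∞ F) (p : M) :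
    (riemannianVolume (d := d) F).restrict (chartAt (EuclideanSpace ℝ (Fin d)) p).source =
      (chartVolume (d := d) F p).restrict (chartAt (EuclideanSpace ℝ (Fin d)) p).source :=
  restrict_iSup_eq (chartAt (EuclideanSpace ℝ (Fin d)) p).open_source.measurableSet
    (chartVolume_restrict_le hF p)

theorem riemannianVolume_restrict_image (hF : ContMDiff (𝓡 d) (𝓡 N) ∞ F) (p : M)
    {P : EuclideanSpace ℝ (Fin d) → EuclideanSpace ℝ (Fin N)} {D : Set (EuclideanSpace ℝ (Fin d))}
    (hD : IsOpen D) (hDt : D ⊆ (chartAt (EuclideanSpace ℝ (Fin d)) p).target)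
    (hP : ∀ z ∈ D, localParam (d := d) F p z = P z) :
    (riemannianVolume (d := d) F).restrict
      ((chartAt (EuclideanSpace ℝ (Fin d)) p).symm '' D) =
    ((modelVolume P).restrict D).map (chartAt (EuclideanSpace ℝ (Fin d)) p).symm := by
  set φ := chartAt (EuclideanSpace ℝ (Fin d)) p with hφ
  have hU : IsOpen (φ.symm '' D) := φ.symm.isOpen_image_of_subset_source hD hDt
  have hUs : φ.symm '' D ⊆ φ.source := by
    rintro _ ⟨z, hz, rfl⟩
    exact φ.map_target (hDt hz)
  ext A hA
  have hae : AEMeasurable φ.symm ((modelVolume P).restrict D) :=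
    aemeasurable_chartAt_symm p hD.measurableSet hDt _
  have hm : MeasurableSet (φ.symm ⁻¹' A ∩ D) := by
    have h1 := (continuousOn_iff_continuous_domRestrict.1 (φ.continuousOn_symm.mono hDt)).measurable
      hA
    have h2 := (MeasurableEmbedding.subtype_coe hD.measurableSet).measurableSet_image.2 h1
    convert h2 using 1
    ext z
    simp [and_comm]
  rw [Measure.map_apply_of_aemeasurable hae hA, Measure.restrict_apply' hD.measurableSet,
    modelVolume, withDensity_apply _ hm]
  have h1 : ((riemannianVolume (d := d) F).restrict φ.source).restrict (φ.symm '' D) =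
      (riemannianVolume (d := d) F).restrict (φ.symm '' D) := by
    rw [Measure.restrict_restrict hU.measurableSet, inter_eq_left.2 hUs]
  rw [← h1, hφ, riemannianVolume_restrict hF p, ← hφ, Measure.restrict_restrict hU.measurableSet,
    inter_eq_left.2 hUs, Measure.restrict_apply hA, chartVolume_apply p (hA.inter hU.measurableSet)]
  have hset : φ.target ∩ φ.symm ⁻¹' (A ∩ φ.symm '' D) = φ.symm ⁻¹' A ∩ D := by
    ext z
    constructor
    · rintro ⟨hz, hzA, w, hw, hwz⟩
      refine ⟨hzA, ?_⟩
      rwa [← φ.symm.injOn (hDt hw) hz hwz]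
    · rintro ⟨hzA, hz⟩
      exact ⟨hDt hz, hzA, z, hz, rfl⟩
  rw [← hφ, hset]
  refine setLIntegral_congr_fun hm fun z hz => ?_
  rw [volumeDensity_congr (P := localParam (d := d) F p) (Q := P)]
  filter_upwards [hD.mem_nhds hz.2] with w hw using hP w hw

end RiemannianVolume

end CoarseRicci

end

noncomputable section

namespace CoarseRicci

/-! ### Cutoff functions and extension to the whole space -/

section Cutoff

variable {E F : Type} [NormedAddCommGroup E] [InnerProductSpace ℝ E] [FiniteDimensional ℝ E]
  [NormedAddCommGroup F] [NormedSpace ℝ F]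

/-- A smooth bump function at the origin, supported in the unit ball. -/
def unitBump (E : Type) [NormedAddCommGroup E] [InnerProductSpace ℝ E] : ContDiffBump (0 : E) :=
  ⟨1 / 2, 3 / 4, by norm_num, by norm_num⟩

/-- A smooth function that is `1` on the ball of radius `ρ / 2` and vanishes off the ball of radius
`ρ`. -/
def cutoff (z₀ : E) (ρ : ℝ) (z : E) : ℝ := unitBump E (ρ⁻¹ • (z - z₀))

theorem contDiff_cutoff (z₀ : E) (ρ : ℝ) : ContDiff ℝ ∞ (cutoff z₀ ρ) :=
  (unitBump E).contDiff.comp (by fun_prop)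

theorem cutoff_eq_one {z₀ z : E} {ρ : ℝ} (hρ : 0 < ρ) (hz : z ∈ Metric.ball z₀ (ρ / 2)) :
    cutoff z₀ ρ z = 1 := by
  refine (unitBump E).one_of_mem_closedBall ?_
  rw [mem_closedBall_zero_iff, norm_smul, Real.norm_eq_abs, abs_of_pos (by positivity),
    inv_mul_le_iff₀ hρ, ← dist_eq_norm]
  have := (Metric.mem_ball.1 hz).le
  simp only [unitBump]
  linarith

theorem abs_cutoff_le (z₀ z : E) (ρ : ℝ) : |cutoff z₀ ρ z| ≤ 1 := by
  rw [cutoff, abs_of_nonneg (unitBump E).nonneg]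
  exact (unitBump E).le_one

theorem cutoff_eventuallyEq_zero {z₀ z : E} {ρ : ℝ} (hρ : 0 < ρ) (hz : z ∉ Metric.ball z₀ ρ) :
    cutoff z₀ ρ =ᶠ[𝓝 z] 0 := by
  have h1 : {w : E | 3 / 4 * ρ < dist w z₀} ∈ 𝓝 z := by
    refine (isOpen_lt continuous_const (by fun_prop)).mem_nhds ?_
    rw [Metric.mem_ball, not_lt] at hz
    change 3 / 4 * ρ < dist z z₀
    linarith
  filter_upwards [h1] with w hw
  refine (unitBump E).zero_of_le_dist ?_
  rw [dist_zero_right, norm_smul, Real.norm_eq_abs, abs_of_pos (by positivity),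
    le_inv_mul_iff₀ hρ, ← dist_eq_norm]
  have hw' : 3 / 4 * ρ < dist w z₀ := hw
  simp only [unitBump]
  linarith

/-- The constant is independent of `ρ`. The loss `1 / ρ` is recovered when the cutoff multiplies a
first-order Taylor remainder, which is small compared with `ρ` on the ball. -/
theorem exists_norm_fderiv_cutoff_le : ∃ K, 0 ≤ K ∧ ∀ (z₀ : E) (ρ : ℝ), 0 < ρ → ∀ z,
    ‖fderiv ℝ (cutoff z₀ ρ) z‖ ≤ K / ρ := by
  obtain ⟨K, hK⟩ := ((unitBump E).contDiff (n := 1).continuous_fderiv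
    one_ne_zero).bounded_above_of_compact_support ((unitBump E).hasCompactSupport.fderiv ℝ)
  refine ⟨K, (norm_nonneg _).trans (hK 0), fun z₀ ρ hρ z => ?_⟩
  have h1 : HasFDerivAt (cutoff z₀ ρ) ((fderiv ℝ (unitBump E) (ρ⁻¹ • (z - z₀))).comp
      (ρ⁻¹ • ContinuousLinearMap.id ℝ E)) z := by
    have h2 : HasFDerivAt (fun z : E => ρ⁻¹ • (z - z₀)) (ρ⁻¹ • ContinuousLinearMap.id ℝ E) z :=
      ((hasFDerivAt_id z).sub_const z₀).const_smul ρ⁻¹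
    exact HasFDerivAt.comp z
      (((unitBump E).contDiff (n := 1)).differentiable one_ne_zero _).hasFDerivAt h2
  rw [h1.fderiv]
  refine (ContinuousLinearMap.opNorm_comp_le _ _).trans ?_
  rw [div_eq_mul_inv]
  refine mul_le_mul (hK _) ?_ (norm_nonneg _) ((norm_nonneg _).trans (hK 0))
  refine (norm_smul_le ρ⁻¹ (ContinuousLinearMap.id ℝ E)).trans ?_
  rw [Real.norm_eq_abs, abs_of_pos (by positivity)]
  exact mul_le_of_le_one_right (by positivity) ContinuousLinearMap.norm_id_le

theorem exists_ckBound_cutoff_smul (z₀ : E) {ρ : ℝ} (hρ : 0 < ρ) (n : ℕ) :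
    ∃ C, 0 ≤ C ∧ ∀ (K : ℝ) (f : E → F),
      (∀ z ∈ Metric.ball z₀ ρ, ContDiffAt ℝ n f z) →
      (∀ z ∈ Metric.ball z₀ ρ, ∀ k ≤ n, ‖iteratedFDeriv ℝ k f z‖ ≤ K) →
      CkBound n (C * K) (fun z => cutoff z₀ ρ z • f z) := by
  have hb : ∀ i : ℕ, ∃ Ci, ∀ y ∈ Metric.closedBall z₀ ρ, ‖iteratedFDeriv ℝ i (cutoff z₀ ρ) y‖ ≤ Ci :=
    fun i => (isCompact_closedBall z₀ ρ).exists_bound_of_continuousOn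
      ((contDiff_cutoff z₀ ρ).continuous_iteratedFDeriv (by exact_mod_cast le_top)).continuousOn
  choose Ci hCi using hb
  have hCi0 : ∀ i, 0 ≤ Ci i := fun i =>
    (norm_nonneg _).trans (hCi i z₀ (Metric.mem_closedBall_self hρ.le))
  set A := ∑ i ∈ Finset.range (n + 1), Ci i with hA
  have hA0 : 0 ≤ A := Finset.sum_nonneg fun i _ => hCi0 i
  set L : ℝ →L[ℝ] F →L[ℝ] F := ContinuousLinearMap.lsmul ℝ ℝ with hL
  refine ⟨‖L‖ * 2 ^ n * A, by positivity, fun K f hf hK => ?_⟩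
  have hK0 : 0 ≤ K := (norm_nonneg _).trans (hK z₀ (Metric.mem_ball_self hρ) 0 (Nat.zero_le _))
  have hzero : ∀ z ∉ Metric.ball z₀ ρ, (fun z => cutoff z₀ ρ z • f z) =ᶠ[𝓝 z] 0 := fun z hz => by
    exact (cutoff_eventuallyEq_zero hρ hz).mono fun w hw => by
      simp [show cutoff z₀ ρ w = 0 from hw]
  constructor
  · refine contDiff_iff_contDiffAt.2 fun z => ?_
    by_cases hz : z ∈ Metric.ball z₀ ρ
    · exact ((contDiff_cutoff z₀ ρ).of_le (by exact_mod_cast le_top)).contDiffAt.smul (hf z hz)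
    · exact (contDiffAt_const (c := (0 : F))).congr_of_eventuallyEq (hzero z hz)
  · intro j hj z
    by_cases hz : z ∈ Metric.ball z₀ ρ
    · refine norm_iteratedFDeriv_bilinear_le_of_contDiffAt L
        ((contDiff_cutoff z₀ ρ).of_le (by exact_mod_cast le_top)).contDiffAt (hf z hz)
        (fun i hi => ?_) (hK z hz) j hj
      exact (hCi i z (Metric.ball_subset_closedBall hz)).trans
        (Finset.single_le_sum (fun i _ => hCi0 i) (Finset.mem_range.2 (by omega)))
    · rw [((hzero z hz).iteratedFDeriv ℝ j).eq_of_nhds]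
      simp only [Pi.zero_def]
      rw [iteratedFDeriv_fun_zero]
      simp only [Pi.zero_apply, norm_zero]
      positivity

theorem exists_ckBound_extension {z₀ : E} {n : ℕ} {f : E → F} (hf : ContDiffAt ℝ n f z₀) :
    ∃ r, 0 < r ∧ ∃ B, ∃ g : E → F, CkBound n B g ∧ ∀ z ∈ Metric.ball z₀ r, g z = f z := by
  have h1 : ∀ᶠ z in 𝓝 z₀, ContDiffAt ℝ n f z := hf.eventually (by simp)
  have h2 : ∀ i : Fin (n + 1), ∀ᶠ z in 𝓝 z₀,
      ‖iteratedFDeriv ℝ i f z‖ < ‖iteratedFDeriv ℝ i f z₀‖ + 1 := fun i => by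
    have hc : ContinuousAt (iteratedFDeriv ℝ i f) z₀ :=
      (hf.iteratedFDeriv_right (m := 0) (i := i) (by
        rw [zero_add]; exact_mod_cast Nat.lt_succ_iff.1 i.2)).continuousAt
    exact hc.norm.eventually_lt_const (lt_add_one _)
  obtain ⟨ρ, hρ, h⟩ := Metric.eventually_nhds_iff_ball.1 (h1.and (eventually_all.2 h2))
  obtain ⟨C, hC, hCk⟩ := exists_ckBound_cutoff_smul (F := F) z₀ hρ n
  refine ⟨ρ / 2, by positivity, _, _, hCk (∑ i : Fin (n + 1), (‖iteratedFDeriv ℝ i f z₀‖ + 1)) f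
    (fun z hz => (h z hz).1) (fun z hz k hk => ?_), fun z hz => ?_⟩
  · refine ((h z hz).2 ⟨k, by omega⟩).le.trans ?_
    exact Finset.single_le_sum (f := fun i : Fin (n + 1) => ‖iteratedFDeriv ℝ i f z₀‖ + 1)
      (fun i _ => by positivity) (Finset.mem_univ (⟨k, by omega⟩ : Fin (n + 1)))
  · simp [cutoff_eq_one hρ hz]

end Cutoff

section TameExtension

variable {d N : ℕ}

/-- Outside a small ball `P` is replaced by its affine approximation at `z₀`, by cutting off the
Taylor remainder `R`. The injective linear part gives a lower Lipschitz constant `c`, and on a small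
ball the cut-off remainder has Lipschitz constant at most `c / 2`, so the sum remains bi-Lipschitz.
-/
theorem exists_tame_extension {P : EuclideanSpace ℝ (Fin d) → EuclideanSpace ℝ (Fin N)}
    {z₀ : EuclideanSpace ℝ (Fin d)} (hP : ContDiffAt ℝ ∞ P z₀)
    (hev : ∀ᶠ z in 𝓝 z₀, ContDiffAt ℝ ∞ P z)
    (hinj : Function.Injective (fderiv ℝ P z₀)) :
    ∃ r, 0 < r ∧ ∃ Q : EuclideanSpace ℝ (Fin d) → EuclideanSpace ℝ (Fin N), Tame Q ∧
      ∀ z ∈ Metric.ball z₀ r, P z = Q z := by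
  set T := fderiv ℝ P z₀ with hT
  obtain ⟨c₁, hc₁, hanti⟩ := (LinearMap.injective_iff_antilipschitz
    (T : EuclideanSpace ℝ (Fin d) →ₗ[ℝ] EuclideanSpace ℝ (Fin N))).1 hinj
  obtain ⟨K, hK, hcut⟩ := exists_norm_fderiv_cutoff_le (E := EuclideanSpace ℝ (Fin d))
  set R : EuclideanSpace ℝ (Fin d) → EuclideanSpace ℝ (Fin N) := fun z => P z - P z₀ - T (z - z₀)
    with hR
  have hRs : ∀ z, ContDiffAt ℝ ∞ P z → ContDiffAt ℝ ∞ R z := fun z hz =>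
    (hz.sub contDiffAt_const).sub (by fun_prop)
  have hR0 : fderiv ℝ R z₀ = 0 := by
    have h1 : HasFDerivAt R (T - T) z₀ := by
      have h2 : HasFDerivAt (fun z => T (z - z₀)) T z₀ := by
        exact T.hasFDerivAt.comp z₀ ((hasFDerivAt_id z₀).sub_const z₀)
      exact ((hP.differentiableAt (by simp)).hasFDerivAt.sub_const _).sub h2
    rw [h1.fderiv, sub_self]
  set c : ℝ := (c₁ : ℝ)⁻¹ with hc
  have hc0 : 0 < c := by positivity
  -- If `‖fderiv ℝ R‖ < ε`, then `R` is at most `ε * ρ` on the ball, and the cut-off remainder has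
  -- derivative at most `ε + (K / ρ) * (ε * ρ) = ε * (1 + K) = c / 2`.
  set ε : ℝ := c / (2 * (1 + K)) with hε
  have hε0 : 0 < ε := by positivity
  have hcont : ContinuousAt (fderiv ℝ R) z₀ :=
    ((hRs z₀ hP).fderiv_right (m := 0) (by simp)).continuousAt
  have hsmall : ∀ᶠ z in 𝓝 z₀, ‖fderiv ℝ R z‖ < ε := by
    have := hcont.norm
    rw [ContinuousAt, hR0, norm_zero] at this
    exact this.eventually_lt_const hε0
  obtain ⟨ρ₁, hρ₁, h⟩ := Metric.eventually_nhds_iff_ball.1 (hev.and hsmall)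
  set ρ := ρ₁ / 2 with hρdef
  have hρ : 0 < ρ := by positivity
  have hsub : Metric.closedBall z₀ ρ ⊆ Metric.ball z₀ ρ₁ :=
    Metric.closedBall_subset_ball (by rw [hρdef]; linarith)
  have hRball : ∀ z ∈ Metric.ball z₀ ρ₁, DifferentiableAt ℝ R z := fun z hz =>
    (hRs z (h z hz).1).differentiableAt (by simp)
  have hRnorm : ∀ z ∈ Metric.ball z₀ ρ, ‖R z‖ ≤ ε * ρ := fun z hz => by
    have h1 := (convex_ball z₀ ρ₁).norm_image_sub_le_of_norm_fderiv_le (f := R) (C := ε)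
      hRball (fun w hw => (h w hw).2.le) (Metric.mem_ball_self hρ₁)
      (hsub (Metric.ball_subset_closedBall hz))
    have h2 : R z₀ = 0 := by simp [hR]
    rw [h2, sub_zero] at h1
    refine h1.trans ?_
    rw [← dist_eq_norm]
    exact mul_le_mul_of_nonneg_left (Metric.mem_ball.1 hz).le hε0.le
  set g : EuclideanSpace ℝ (Fin d) → EuclideanSpace ℝ (Fin N) := fun z => cutoff z₀ ρ z • R z
    with hg
  have hgCk : ∀ n : ℕ, ∃ B, CkBound n B g := fun n => by
    obtain ⟨C, -, hCk⟩ := exists_ckBound_cutoff_smul (F := EuclideanSpace ℝ (Fin N)) z₀ hρ n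
    have hb : ∀ i : ℕ, ∃ Ci, ∀ y ∈ Metric.closedBall z₀ ρ, ‖iteratedFDeriv ℝ i R y‖ ≤ Ci :=
      fun i => (isCompact_closedBall z₀ ρ).exists_bound_of_continuousOn fun y hy =>
        ((hRs y (h y (hsub hy)).1).iteratedFDeriv_right (m := 0) (i := i) (by
          simp only [zero_add]; exact_mod_cast le_top)).continuousAt.continuousWithinAt
    choose Ci hCi using hb
    refine ⟨_, hCk (∑ i ∈ Finset.range (n + 1), Ci i) R (fun z hz =>
      (hRs z (h z (hsub (Metric.ball_subset_closedBall hz))).1).of_le (by exact_mod_cast le_top))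
      fun z hz k hk => ?_⟩
    refine (hCi k z (Metric.ball_subset_closedBall hz)).trans ?_
    exact Finset.single_le_sum (fun i _ => (norm_nonneg _).trans
      (hCi i z₀ (Metric.mem_closedBall_self hρ.le))) (Finset.mem_range.2 (by omega))
  have hgs : ContDiff ℝ ∞ g := contDiff_infty.2 fun n => (hgCk n).choose_spec.1
  have hgd : ∀ z, ‖fderiv ℝ g z‖ ≤ c / 2 := fun z => by
    by_cases hz : z ∈ Metric.ball z₀ ρ
    · have hz₁ := hsub (Metric.ball_subset_closedBall hz)
      have h1 := ((contDiff_cutoff z₀ ρ).differentiable (by simp) z).hasFDerivAt.smul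
        (hRball z hz₁).hasFDerivAt
      rw [show fderiv ℝ g z = _ from h1.fderiv]
      refine (norm_add_le _ _).trans ?_
      have h2 : ‖cutoff z₀ ρ z • fderiv ℝ R z‖ ≤ 1 * ε := by
        refine (norm_smul_le (cutoff z₀ ρ z) (fderiv ℝ R z)).trans ?_
        exact mul_le_mul (abs_cutoff_le z₀ z ρ) (h z hz₁).2.le (norm_nonneg _) zero_le_one
      have h3 : ‖(fderiv ℝ (cutoff z₀ ρ) z).smulRight (R z)‖ ≤ K / ρ * (ε * ρ) := by
        rw [ContinuousLinearMap.norm_smulRight_apply]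
        exact mul_le_mul (hcut z₀ ρ hρ z) (hRnorm z hz) (norm_nonneg _) (by positivity)
      have h4 : K / ρ * (ε * ρ) = K * ε := by field_simp
      have h5 : c / 2 = ε * (1 + K) := by rw [hε]; field_simp
      linarith
    · have h1 : g =ᶠ[𝓝 z] fun _ => 0 := by
        exact (cutoff_eventuallyEq_zero hρ hz).mono fun w hw => by
          simp [hg, show cutoff z₀ ρ w = 0 from hw]
      rw [h1.fderiv_eq]
      simp only [fderiv_fun_const, Pi.zero_apply, norm_zero]
      positivity
  refine ⟨ρ / 2, by positivity, fun z => P z₀ + T (z - z₀) + g z, ⟨?_, fun n => ?_, ?_⟩, ?_⟩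
  · exact (contDiff_const.add (by fun_prop)).add hgs
  · obtain ⟨B, hB⟩ := hgCk (n + 1)
    have h1 : fderiv ℝ (fun z => P z₀ + T (z - z₀) + g z) = fun z => T + fderiv ℝ g z := by
      ext1 z
      have h2 : HasFDerivAt (fun z => P z₀ + T (z - z₀)) T z := by
        have := (T.hasFDerivAt.comp z ((hasFDerivAt_id z).sub_const z₀)).const_add (P z₀)
        exact this
      exact (h2.add (hgs.differentiable (by simp) z).hasFDerivAt).fderiv
    rw [h1]
    exact ⟨_, (CkBound.const T).add hB.fderiv_right⟩
  · refine ⟨c / 2, by positivity, fun z w => ?_⟩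
    have h1 : ‖g z - g w‖ ≤ c / 2 * ‖z - w‖ :=
      convex_univ.norm_image_sub_le_of_norm_fderiv_le
        (fun x _ => hgs.differentiable (by simp) x) (fun x _ => hgd x) (mem_univ w) (mem_univ z)
    have h2 : c * ‖z - w‖ ≤ ‖T (z - w)‖ := by
      have := hanti.le_mul_dist z w
      rw [dist_eq_norm, dist_eq_norm, ← map_sub] at this
      rw [hc, inv_mul_le_iff₀ (by positivity)]
      exact this
    have h3 : P z₀ + T (z - z₀) + g z - (P z₀ + T (w - z₀) + g w) = T (z - w) + (g z - g w) := by
      have : T (z - w) = T (z - z₀) - T (w - z₀) := by rw [← map_sub]; congr 1; abel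
      rw [this]; abel
    rw [h3]
    have h4 := norm_sub_le_norm_add (T (z - w)) (g z - g w)
    linarith
  · intro z hz
    have : cutoff z₀ ρ z = 1 := cutoff_eq_one hρ hz
    simp only [hg, this, one_smul, hR]
    abel

end TameExtension

end CoarseRicci

end

noncomputable section

namespace CoarseRicci

section Congruence

variable {d N : ℕ} {P Q : EuclideanSpace ℝ (Fin d) → EuclideanSpace ℝ (Fin N)}
  {h k : EuclideanSpace ℝ (Fin d) → ℝ} {z : EuclideanSpace ℝ (Fin d)}

theorem partialDeriv_congr (hk : h =ᶠ[𝓝 z] k) (i : Fin d) :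
    partialDeriv i h =ᶠ[𝓝 z] partialDeriv i k :=
  (hk.fderiv (𝕜 := ℝ)).mono fun w hw => by simp only [partialDeriv, hw]

theorem inducedMetric_congr (hPQ : P =ᶠ[𝓝 z] Q) : inducedMetric P =ᶠ[𝓝 z] inducedMetric Q :=
  (hPQ.fderiv (𝕜 := ℝ)).mono fun w hw => by simp only [inducedMetric_eq_gram, hw]

theorem coordLaplacian_congr (hPQ : P =ᶠ[𝓝 z] Q) (hk : h =ᶠ[𝓝 z] k) :
    coordLaplacian P h z = coordLaplacian Q k z := by
  have hg := inducedMetric_congr hPQ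
  have hgd : ∀ i j l, partialDeriv l (fun w => inducedMetric P w i j) z =
      partialDeriv l (fun w => inducedMetric Q w i j) z := fun i j l =>
    (partialDeriv_congr (hg.mono fun w hw => by simp only [hw]) l).eq_of_nhds
  have h2 : ∀ i j, partialDeriv i (partialDeriv j h) z = partialDeriv i (partialDeriv j k) z :=
    fun i j => (partialDeriv_congr (partialDeriv_congr hk j) i).eq_of_nhds
  simp only [coordLaplacian, covariantHessian, christoffel, hgd, h2, hg.eq_of_nhds,
    (partialDeriv_congr hk _).eq_of_nhds]

end Congruence

/-! ### Models of charts and the intrinsic Laplacian -/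

section ChartModel

variable {d N : ℕ} {M : Type*} [TopologicalSpace M] [ChartedSpace (EuclideanSpace ℝ (Fin d)) M]
  {F : M → EuclideanSpace ℝ (Fin N)} {p : M}
  {P : EuclideanSpace ℝ (Fin d) → EuclideanSpace ℝ (Fin N)} {D : Set (EuclideanSpace ℝ (Fin d))}

/-- `P` extends the local parametrization of the submanifold given by the preferred chart at `p`
from the open set `D` to the whole space. -/
structure ChartModel (F : M → EuclideanSpace ℝ (Fin N)) (p : M)
    (P : EuclideanSpace ℝ (Fin d) → EuclideanSpace ℝ (Fin N))
    (D : Set (EuclideanSpace ℝ (Fin d))) : Prop where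
  tame : Tame P
  isOpen : IsOpen D
  subset : D ⊆ (chartAt (EuclideanSpace ℝ (Fin d)) p).target
  eqOn : ∀ z ∈ D, localParam (d := d) F p z = P z

theorem ChartModel.mono {D' : Set (EuclideanSpace ℝ (Fin d))} (H : ChartModel F p P D)
    (hD' : IsOpen D') (hs : D' ⊆ D) : ChartModel F p P D' :=
  ⟨H.tame, hD', hs.trans H.subset, fun z hz => H.eqOn z (hs hz)⟩

theorem ChartModel.eventuallyEq (H : ChartModel F p P D) {z : EuclideanSpace ℝ (Fin d)}
    (hz : z ∈ D) : localParam (d := d) F p =ᶠ[𝓝 z] P := by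
  filter_upwards [H.isOpen.mem_nhds hz] with w hw using H.eqOn w hw

variable [IsManifold (𝓡 d) ∞ M]

theorem exists_chartModel (hF : IsSmoothEmbedding (𝓡 d) (𝓡 N) ∞ F) (p : M)
    {z₀ : EuclideanSpace ℝ (Fin d)} (hz₀ : z₀ ∈ (chartAt (EuclideanSpace ℝ (Fin d)) p).target) :
    ∃ P r, 0 < r ∧ ChartModel F p P (Metric.ball z₀ r) := by
  have ht := (chartAt (EuclideanSpace ℝ (Fin d)) p).open_target.mem_nhds hz₀
  obtain ⟨r, hr, Q, hQ, hPQ⟩ := exists_tame_extension (contDiffAt_localParam hF.contMDiff p hz₀)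
    (by filter_upwards [ht] with w hw using contDiffAt_localParam hF.contMDiff p hw)
    (injective_fderiv_localParam hF.isImmersion hF.contMDiff p hz₀)
  obtain ⟨r', hr', hb⟩ := Metric.mem_nhds_iff.1 ht
  exact ⟨Q, min r r', lt_min hr hr', hQ, Metric.isOpen_ball,
    (Metric.ball_subset_ball (min_le_right _ _)).trans hb,
    fun z hz => hPQ z (Metric.ball_subset_ball (min_le_left _ _) hz)⟩

variable [MeasurableSpace M] [BorelSpace M]

theorem isFiniteMeasure_riemannianVolume [CompactSpace M]
    (hF : IsSmoothEmbedding (𝓡 d) (𝓡 N) ∞ F) : IsFiniteMeasure (riemannianVolume (d := d) F) := by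
  refine ⟨isCompact_univ.measure_lt_top_of_nhdsWithin fun x _ => ?_⟩
  set φ := chartAt (EuclideanSpace ℝ (Fin d)) x with hφ
  obtain ⟨P, r, hr, H⟩ := exists_chartModel hF x (mem_chart_target _ x)
  refine ⟨φ.symm '' Metric.ball (φ x) r, ?_, ?_⟩
  · rw [nhdsWithin_univ]
    refine (φ.symm.isOpen_image_of_subset_source H.isOpen H.subset).mem_nhds ?_
    exact ⟨φ x, Metric.mem_ball_self hr, φ.left_inv (mem_chart_source _ x)⟩
  · have h1 := riemannianVolume_restrict_image hF.contMDiff x H.isOpen H.subset H.eqOn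
    have h2 := congrArg (fun ν => ν univ) h1
    simp only [Measure.restrict_apply_univ] at h2
    rw [h2, Measure.map_apply_of_aemeasurable (aemeasurable_chartAt_symm x H.isOpen.measurableSet
      H.subset _) MeasurableSet.univ, preimage_univ, Measure.restrict_apply_univ, modelVolume,
      withDensity_apply _ H.isOpen.measurableSet]
    obtain ⟨B, hB⟩ := H.tame.exists_ckBound_volumeDensity 0
    calc ∫⁻ a in Metric.ball (φ x) r, ENNReal.ofReal (volumeDensity P a)
        ≤ ∫⁻ a in Metric.ball (φ x) r, ENNReal.ofReal B :=
          lintegral_mono fun a => ENNReal.ofReal_le_ofReal ((le_abs_self _).trans (hB.norm_le a))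
      _ < ⊤ := by
          rw [setLIntegral_const]
          exact ENNReal.mul_lt_top ENNReal.ofReal_lt_top measure_ball_lt_top

theorem ChartModel.localModel [CompactSpace M] (hF : IsSmoothEmbedding (𝓡 d) (𝓡 N) ∞ F)
    {z₀ : EuclideanSpace ℝ (Fin d)} {r r' : ℝ} (H : ChartModel F p P (Metric.ball z₀ r))
    (hr : r' < r) :
    LocalModel (riemannianVolume (d := d) F) F P (chartAt (EuclideanSpace ℝ (Fin d)) p).symm
      (Metric.ball z₀ r) (Metric.ball z₀ r') := by
  set φ := chartAt (EuclideanSpace ℝ (Fin d)) p with hφ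
  have hU : IsOpen (φ.symm '' Metric.ball z₀ r) :=
    φ.symm.isOpen_image_of_subset_source H.isOpen H.subset
  have hsub : Metric.closedBall z₀ r' ⊆ Metric.ball z₀ r := Metric.closedBall_subset_ball hr
  have hFc : Continuous F := hF.isEmbedding.continuous
  have hK1 : IsCompact (F '' (φ.symm '' Metric.closedBall z₀ r')) :=
    ((isCompact_closedBall z₀ r').image_of_continuousOn
      (φ.continuousOn_symm.mono (hsub.trans H.subset))).image hFc
  have hK2 : IsCompact (F '' (φ.symm '' Metric.ball z₀ r)ᶜ) :=
    hU.isClosed_compl.isCompact.image hFc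
  have hdisj : Disjoint (F '' (φ.symm '' Metric.closedBall z₀ r'))
      (F '' (φ.symm '' Metric.ball z₀ r)ᶜ) := by
    rw [disjoint_image_iff hF.isEmbedding.injective]
    exact (disjoint_compl_right (a := φ.symm '' Metric.ball z₀ r)).mono_left (image_mono hsub)
  -- Global injectivity of `F` enters here: a smaller closed ball and the complement of the larger
  -- one have disjoint compact images, hence a positive distance in the ambient space.
  obtain ⟨a, ha, hab⟩ := Metric.exists_pos_forall_lt_edist hK1 hK2.isClosed hdisj
  refine ⟨measurableSet_ball, aemeasurable_chartAt_symm p measurableSet_ball H.subset _,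
    Metric.ball_subset_ball hr.le, H.eqOn, _, hU.measurableSet,
    riemannianVolume_restrict_image hF.contMDiff p H.isOpen H.subset H.eqOn,
    min a (r - r'), lt_min (by exact_mod_cast ha) (by linarith), fun z hz => ⟨fun y hy => ?_,
      fun w hw => ?_⟩⟩
  · refine (min_le_left _ _).trans ?_
    have h1 := hab (F (φ.symm z)) ⟨_, ⟨z, Metric.ball_subset_closedBall hz, rfl⟩, rfl⟩ (F y)
      ⟨y, hy, rfl⟩
    have h2 : F (φ.symm z) = P z := H.eqOn z (Metric.ball_subset_ball hr.le hz)
    rw [h2, edist_nndist] at h1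
    exact_mod_cast (ENNReal.coe_lt_coe.1 h1).le
  · refine (min_le_right _ _).trans ?_
    rw [Metric.mem_ball, not_lt] at hw
    rw [Metric.mem_ball] at hz
    have := dist_triangle_left w z₀ z
    rw [← dist_eq_norm]
    linarith

/-- The operators on the left do not mention the chart at `p`, so the coordinate expressions on the
right agree for all charts around `x`. -/
theorem tendsto_heatOperator_coordLaplacian [CompactSpace M]
    (hF : IsSmoothEmbedding (𝓡 d) (𝓡 N) ∞ F) {h : M → ℝ} (hh : Measurable h) {B : ℝ}
    (hB : ∀ y, |h y| ≤ B) {x : M} (hhx : ContMDiffAt (𝓡 d) 𝓘(ℝ, ℝ) 2 h x)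
    (hx : x ∈ (chartAt (EuclideanSpace ℝ (Fin d)) p).source) :
    Tendsto (fun t => heatOperator (chordalDist F) (riemannianVolume (d := d) F) t h x) (𝓝[>] 0)
      (𝓝 (coordLaplacian (localParam (d := d) F p)
        (fun z => h ((chartAt (EuclideanSpace ℝ (Fin d)) p).symm z))
        (chartAt (EuclideanSpace ℝ (Fin d)) p x))) := by
  have := isFiniteMeasure_riemannianVolume hF
  set φ := chartAt (EuclideanSpace ℝ (Fin d)) p with hφ
  obtain ⟨P, r, hr, H⟩ := exists_chartModel hF p (φ.map_source hx)
  have hhz : ContDiffAt ℝ (2 : ℕ) (fun z => h (φ.symm z)) (φ x) := by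
    refine contMDiffAt_iff_contDiffAt.1 (ContMDiffAt.comp (φ x) (I' := 𝓡 d) (g := h) ?_
      ((contMDiffAt_chartAt_symm p (φ.map_source hx)).of_le (by norm_cast)))
    rw [φ.left_inv hx]
    exact hhx
  obtain ⟨r₁, hr₁, B', h', hh', heq⟩ := exists_ckBound_extension hhz
  have hr₂ : 0 < min r r₁ := lt_min hr hr₁
  have H' : ChartModel F p P (Metric.ball (φ x) (min r r₁)) :=
    H.mono Metric.isOpen_ball (Metric.ball_subset_ball (min_le_left _ _))
  have hL := H'.localModel hF (half_lt_self hr₂)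
  have h1 := hL.tendsto_heatOperator (B := max B B') H.tame hF.isEmbedding.continuous.measurable hh
    (fun y => (hB y).trans (le_max_left _ _)) (hh'.mono_right (le_max_right _ _))
    (fun w hw => (heq w (Metric.ball_subset_ball (min_le_right _ _) hw)).symm)
    (Metric.mem_ball_self (half_pos hr₂))
  rw [← hφ, φ.left_inv hx] at h1
  rwa [coordLaplacian_congr (H.eventuallyEq (Metric.mem_ball_self hr)) (k := h')]
  filter_upwards [Metric.ball_mem_nhds (φ x) hr₁] with w hw using (heq w hw).symm

/-- The Laplacian can be computed in any chart. -/
theorem laplacian_eq [CompactSpace M] (hF : IsSmoothEmbedding (𝓡 d) (𝓡 N) ∞ F) {h : M → ℝ}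
    (hh : ContMDiff (𝓡 d) 𝓘(ℝ, ℝ) 2 h) {x : M}
    (hx : x ∈ (chartAt (EuclideanSpace ℝ (Fin d)) p).source) :
    laplacian (d := d) F h x = coordLaplacian (localParam (d := d) F p)
        (fun z => h ((chartAt (EuclideanSpace ℝ (Fin d)) p).symm z))
        (chartAt (EuclideanSpace ℝ (Fin d)) p x) := by
  obtain ⟨B, hB⟩ := isCompact_univ.exists_bound_of_continuousOn hh.continuous.continuousOn
  have hB' : ∀ y, |h y| ≤ B := fun y => hB y (mem_univ y)
  -- Both expressions are limits of the same heat operators; no transformation law of Christoffel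
  -- symbols is needed.
  exact tendsto_nhds_unique
    (tendsto_heatOperator_coordLaplacian hF hh.continuous.measurable hB' hh.contMDiffAt
      (mem_chart_source _ x))
    (tendsto_heatOperator_coordLaplacian hF hh.continuous.measurable hB' hh.contMDiffAt hx)

theorem ChartModel.laplacian_eq [CompactSpace M] (hF : IsSmoothEmbedding (𝓡 d) (𝓡 N) ∞ F)
    (H : ChartModel F p P D) {h : M → ℝ} (hh : ContMDiff (𝓡 d) 𝓘(ℝ, ℝ) 2 h)
    {h' : EuclideanSpace ℝ (Fin d) → ℝ}
    (heq : ∀ w ∈ D, h ((chartAt (EuclideanSpace ℝ (Fin d)) p).symm w) = h' w) :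
    ∀ z ∈ D, laplacian (d := d) F h ((chartAt (EuclideanSpace ℝ (Fin d)) p).symm z) =
      coordLaplacian P h' z := by
  intro z hz
  rw [CoarseRicci.laplacian_eq hF hh (p := p) ((chartAt _ p).map_target (H.subset hz)),
    (chartAt _ p).right_inv (H.subset hz)]
  refine coordLaplacian_congr (H.eventuallyEq hz) ?_
  filter_upwards [H.isOpen.mem_nhds hz] with w hw using heq w hw

/-- By definition the chart used for the Laplacian changes with the point, perhaps discontinuously.
Near `x` it is recomputed in the fixed chart at `x`, where the model bounds apply. -/
theorem contMDiff_laplacian [CompactSpace M] (hF : IsSmoothEmbedding (𝓡 d) (𝓡 N) ∞ F) {h : M → ℝ}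
    {n : ℕ} (hh : ContMDiff (𝓡 d) 𝓘(ℝ, ℝ) (n + 2 : ℕ) h) :
    ContMDiff (𝓡 d) 𝓘(ℝ, ℝ) n (laplacian (d := d) F h) := by
  intro x
  set φ := chartAt (EuclideanSpace ℝ (Fin d)) x with hφ
  obtain ⟨P, r, hr, H⟩ := exists_chartModel hF x (mem_chart_target _ x)
  have hle : ∀ m : ℕ, (m : WithTop ℕ∞) ≤ (∞ : WithTop ℕ∞) := fun m => by exact_mod_cast le_top
  have hhz : ContDiffAt ℝ (n + 2 : ℕ) (fun z => h (φ.symm z)) (φ x) :=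
    contMDiffAt_iff_contDiffAt.1 (ContMDiffAt.comp (φ x) (I' := 𝓡 d) (g := h) hh.contMDiffAt
      ((contMDiffAt_chartAt_symm x (mem_chart_target _ x)).of_le (hle (n + 2))))
  obtain ⟨r₁, hr₁, B', h', hh', heq⟩ := exists_ckBound_extension hhz
  have H' : ChartModel F x P (Metric.ball (φ x) (min r r₁)) :=
    H.mono Metric.isOpen_ball (Metric.ball_subset_ball (min_le_left _ _))
  have h1 := H'.laplacian_eq hF (hh.of_le (by exact_mod_cast Nat.le_add_left 2 n))
    (fun w hw => (heq w (Metric.ball_subset_ball (min_le_right _ _) hw)).symm)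
  obtain ⟨B₂, hB₂⟩ := exists_ckBound_coordLaplacian H.tame n hh'
  have h2 : ContMDiffAt (𝓡 d) 𝓘(ℝ, ℝ) n (fun y => coordLaplacian P h' (φ y)) x :=
    ContMDiffAt.comp x (g := coordLaplacian P h')
      (contMDiffAt_iff_contDiffAt.2 hB₂.1.contDiffAt)
      ((contMDiffAt_chartAt x (mem_chart_source _ x)).of_le (hle n))
  refine h2.congr_of_eventuallyEq ?_
  have hc : ContinuousAt φ x := φ.continuousAt (mem_chart_source _ x)
  filter_upwards [hc.preimage_mem_nhds (Metric.ball_mem_nhds (φ x) (lt_min hr hr₁)),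
    φ.open_source.mem_nhds (mem_chart_source _ x)] with y hy hys
  have := h1 (φ y) hy
  rwa [φ.left_inv hys] at this

theorem ChartModel.iteratedCarreDuChamp_eq [CompactSpace M]
    (hF : IsSmoothEmbedding (𝓡 d) (𝓡 N) ∞ F) (H : ChartModel F p P D) {f : M → ℝ}
    (hf : ContMDiff (𝓡 d) 𝓘(ℝ, ℝ) 5 f) {f' : EuclideanSpace ℝ (Fin d) → ℝ}
    (heq : ∀ w ∈ D, f ((chartAt (EuclideanSpace ℝ (Fin d)) p).symm w) = f' w) :
    ∀ z ∈ D, iteratedCarreDuChamp (laplacian (d := d) F) f f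
        ((chartAt (EuclideanSpace ℝ (Fin d)) p).symm z) =
      iteratedCarreDuChamp (coordLaplacian P) f' f' z := by
  have hf3 : ContMDiff (𝓡 d) 𝓘(ℝ, ℝ) 3 f := hf.of_le (by norm_cast)
  have hf2 : ContMDiff (𝓡 d) 𝓘(ℝ, ℝ) 2 f := hf.of_le (by norm_cast)
  have hff : ContMDiff (𝓡 d) 𝓘(ℝ, ℝ) 5 (fun y => f y * f y) := hf.mul hf
  have hL : ContMDiff (𝓡 d) 𝓘(ℝ, ℝ) 3 (laplacian (d := d) F f) :=
    contMDiff_laplacian hF (n := 3) hf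
  have hLff : ContMDiff (𝓡 d) 𝓘(ℝ, ℝ) 3 (laplacian (d := d) F fun y => f y * f y) :=
    contMDiff_laplacian hF (n := 3) hff
  have hLf : ContMDiff (𝓡 d) 𝓘(ℝ, ℝ) 3 (fun y => laplacian (d := d) F f y * f y) := hL.mul hf3
  have hΓ : ContMDiff (𝓡 d) 𝓘(ℝ, ℝ) 3 (carreDuChamp (laplacian (d := d) F) f f) := by
    have : carreDuChamp (laplacian (d := d) F) f f = fun y =>
        1 / 2 * (laplacian (d := d) F (fun y => f y * f y) y - laplacian (d := d) F f y * f y -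
          f y * laplacian (d := d) F f y) := rfl
    rw [this]
    exact contMDiff_const.mul ((hLff.sub hLf).sub (hf3.mul hL))
  have e1 := H.laplacian_eq hF hf2 heq
  have e2 := H.laplacian_eq hF (hff.of_le (by norm_cast)) (h' := fun w => f' w * f' w)
    (fun w hw => by simp only [heq w hw])
  have e3 := H.laplacian_eq hF (hLf.of_le (by norm_cast))
    (h' := fun w => coordLaplacian P f' w * f' w) (fun w hw => by simp only [heq w hw, e1 w hw])
  have e4 := H.laplacian_eq hF (hL.of_le (by norm_cast)) (h' := coordLaplacian P f') e1
  have e5 := H.laplacian_eq hF (hΓ.of_le (by norm_cast))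
    (h' := carreDuChamp (coordLaplacian P) f' f')
    (fun w hw => by simp only [carreDuChamp, heq w hw, e1 w hw, e2 w hw])
  intro z hz
  rw [iteratedCarreDuChamp_self, iteratedCarreDuChamp_self, e5 z hz, e3 z hz, e4 z hz, e1 z hz,
    heq z hz]

end ChartModel

end CoarseRicci

end

noncomputable section

namespace CoarseRicci

/-! ### Graph coordinates over tangent planes, with uniform bounds -/

section GraphCoordinates

variable {d N : ℕ} {P : EuclideanSpace ℝ (Fin d) → EuclideanSpace ℝ (Fin N)}

/-- The coordinates on the tangent plane `range e` of the orthogonal projection to it. -/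
def planeCoord (e : EuclideanSpace ℝ (Fin d) →ₗᵢ[ℝ] EuclideanSpace ℝ (Fin N)) :
    EuclideanSpace ℝ (Fin N) →L[ℝ] EuclideanSpace ℝ (Fin d) :=
  ContinuousLinearMap.adjoint e.toContinuousLinearMap

theorem inner_planeCoord (e : EuclideanSpace ℝ (Fin d) →ₗᵢ[ℝ] EuclideanSpace ℝ (Fin N))
    (v : EuclideanSpace ℝ (Fin d)) (y : EuclideanSpace ℝ (Fin N)) :
    inner ℝ v (planeCoord e y) = inner ℝ (e v) y :=
  ContinuousLinearMap.adjoint_inner_right _ _ _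

theorem planeCoord_apply_self (e : EuclideanSpace ℝ (Fin d) →ₗᵢ[ℝ] EuclideanSpace ℝ (Fin N))
    (v : EuclideanSpace ℝ (Fin d)) : planeCoord e (e v) = v :=
  ext_inner_left ℝ fun w => by rw [inner_planeCoord, e.inner_map_map]

theorem norm_planeCoord_le (e : EuclideanSpace ℝ (Fin d) →ₗᵢ[ℝ] EuclideanSpace ℝ (Fin N)) :
    ‖planeCoord e‖ ≤ 1 := by
  rw [planeCoord, LinearIsometryEquiv.norm_map]
  exact e.norm_toContinuousLinearMap_le

/-- The projection is isometric on the plane itself, so at the base point passing to graph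
coordinates keeps the lower bound of the differential. -/
theorem norm_planeCoord_fderiv {e : EuclideanSpace ℝ (Fin d) →ₗᵢ[ℝ] EuclideanSpace ℝ (Fin N)}
    {T : EuclideanSpace ℝ (Fin d) →L[ℝ] EuclideanSpace ℝ (Fin N)} (he : range e = range T)
    (v : EuclideanSpace ℝ (Fin d)) : ‖planeCoord e (T v)‖ = ‖T v‖ := by
  have : T v ∈ range e := he ▸ mem_range_self v
  obtain ⟨a, ha⟩ := this
  rw [← ha, planeCoord_apply_self, e.norm_map]

theorem exists_linearIsometry_range_eq
    {T : EuclideanSpace ℝ (Fin d) →L[ℝ] EuclideanSpace ℝ (Fin N)} (hT : Function.Injective T) :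
    ∃ e : EuclideanSpace ℝ (Fin d) →ₗᵢ[ℝ] EuclideanSpace ℝ (Fin N), range e = range T := by
  set S := LinearMap.range (T : EuclideanSpace ℝ (Fin d) →ₗ[ℝ] EuclideanSpace ℝ (Fin N)) with hS
  have hd : Module.finrank ℝ S = d := by
    rw [hS, LinearMap.finrank_range_of_inj hT, finrank_euclideanSpace_fin]
  set b := (stdOrthonormalBasis ℝ S).reindex (finCongr hd)
  refine ⟨S.subtypeₗᵢ.comp b.repr.symm.toLinearIsometry, ?_⟩
  ext y
  constructor
  · rintro ⟨v, rfl⟩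
    obtain ⟨w, hw⟩ := (b.repr.symm v).2
    exact ⟨w, hw⟩
  · rintro ⟨v, rfl⟩
    refine ⟨b.repr ⟨T v, v, rfl⟩, ?_⟩
    simp

theorem isInvertible_of_injective {L : EuclideanSpace ℝ (Fin d) →L[ℝ] EuclideanSpace ℝ (Fin d)}
    (hL : Function.Injective L) : ∃ e : EuclideanSpace ℝ (Fin d) ≃L[ℝ] EuclideanSpace ℝ (Fin d),
      (e : EuclideanSpace ℝ (Fin d) →L[ℝ] EuclideanSpace ℝ (Fin d)) = L := by
  refine ⟨(LinearEquiv.ofInjectiveEndo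
    (L : EuclideanSpace ℝ (Fin d) →ₗ[ℝ] EuclideanSpace ℝ (Fin d)) hL).toContinuousLinearEquiv, ?_⟩
  ext v : 1
  simp

theorem contDiffAt_planeCoord (hP : Tame P) (z : EuclideanSpace ℝ (Fin d))
    (e : EuclideanSpace ℝ (Fin d) →ₗᵢ[ℝ] EuclideanSpace ℝ (Fin N)) :
    ContDiff ℝ ∞ fun w => planeCoord e (P w - P z) :=
  (planeCoord e).contDiff.comp (hP.contDiff.sub contDiff_const)

theorem hasFDerivAt_planeCoord (hP : Tame P) (z : EuclideanSpace ℝ (Fin d))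
    (e : EuclideanSpace ℝ (Fin d) →ₗᵢ[ℝ] EuclideanSpace ℝ (Fin N)) (w : EuclideanSpace ℝ (Fin d)) :
    HasFDerivAt (fun w => planeCoord e (P w - P z)) ((planeCoord e).comp (fderiv ℝ P w)) w :=
  (planeCoord e).hasFDerivAt.comp w
    ((hP.contDiff.differentiable (by simp) w).hasFDerivAt.sub_const _)

/-- The derivatives of the projection of `P` to its tangent planes are bounded. -/
theorem exists_ckBound_planeCoord_fderiv (hP : Tame P) (n : ℕ) :
    ∃ B, 0 ≤ B ∧ ∀ e : EuclideanSpace ℝ (Fin d) →ₗᵢ[ℝ] EuclideanSpace ℝ (Fin N),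
      CkBound n B fun w => (planeCoord e).comp (fderiv ℝ P w) := by
  obtain ⟨B, hB⟩ := hP.bound n
  refine ⟨B, hB.nonneg, fun e => ?_⟩
  have h1 := hB.clm_comp (ContinuousLinearMap.compL ℝ (EuclideanSpace ℝ (Fin d))
    (EuclideanSpace ℝ (Fin N)) (EuclideanSpace ℝ (Fin d)) (planeCoord e))
  refine h1.mono_right (mul_le_of_le_one_left hB.nonneg ?_)
  refine ContinuousLinearMap.opNorm_le_bound _ zero_le_one fun T => ?_
  exact (ContinuousLinearMap.opNorm_comp_le _ _).trans (by gcongr; exact norm_planeCoord_le e)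

theorem exists_norm_iteratedFDeriv_planeCoord_le (hP : Tame P) (n : ℕ) :
    ∃ D, 1 ≤ D ∧ ∀ (z : EuclideanSpace ℝ (Fin d))
      (e : EuclideanSpace ℝ (Fin d) →ₗᵢ[ℝ] EuclideanSpace ℝ (Fin N)) (w : EuclideanSpace ℝ (Fin d))
      (j : ℕ), 1 ≤ j → j ≤ n → ‖iteratedFDeriv ℝ j (fun w => planeCoord e (P w - P z)) w‖ ≤ D := by
  obtain ⟨B, hB0, hB⟩ := exists_ckBound_planeCoord_fderiv hP n
  refine ⟨max 1 B, le_max_left _ _, fun z e w j h1 hj => ?_⟩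
  obtain ⟨i, rfl⟩ := Nat.exists_eq_add_of_le' h1
  rw [← norm_iteratedFDeriv_fderiv]
  have h2 : fderiv ℝ (fun w => planeCoord e (P w - P z)) =
      fun w => (planeCoord e).comp (fderiv ℝ P w) :=
    funext fun w => (hasFDerivAt_planeCoord hP z e w).fderiv
  rw [h2]
  exact ((hB e).2 i (by omega) w).trans (le_max_right _ _)

/-- Graph coordinates over the tangent plane exist. -/
theorem exists_graph_coordinates (hP : Tame P) (z : EuclideanSpace ℝ (Fin d)) :
    ∃ (e : EuclideanSpace ℝ (Fin d) →ₗᵢ[ℝ] EuclideanSpace ℝ (Fin N))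
      (u : EuclideanSpace ℝ (Fin d) → EuclideanSpace ℝ (Fin d)),
      range e = range (fderiv ℝ P z) ∧ ContDiffAt ℝ ∞ u 0 ∧ u 0 = z ∧
      (∀ᶠ w in 𝓝 0, planeCoord e (P (u w) - P z) = w) ∧
      ∀ᶠ w in 𝓝 z, u (planeCoord e (P w - P z)) = w := by
  obtain ⟨e, he⟩ := exists_linearIsometry_range_eq (hP.injective_fderiv z)
  have hinj : Function.Injective ((planeCoord e).comp (fderiv ℝ P z)) := by
    refine (injective_iff_map_eq_zero _).2 fun v hv => ?_
    have h1 := norm_planeCoord_fderiv he v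
    rw [ContinuousLinearMap.comp_apply] at hv
    rw [hv, norm_zero] at h1
    exact (injective_iff_map_eq_zero _).1 (hP.injective_fderiv z) v (norm_eq_zero.1 h1.symm)
  obtain ⟨E, hE⟩ := isInvertible_of_injective hinj
  have hc := (contDiffAt_planeCoord hP z e).contDiffAt (x := z)
  have hd := hasFDerivAt_planeCoord hP z e z
  rw [← hE] at hd
  have h0 : planeCoord e (P z - P z) = 0 := by rw [sub_self, map_zero]
  have hs := hc.hasStrictFDerivAt' hd (by simp)
  refine ⟨e, hc.localInverse hd (by simp), he, ?_, ?_, ?_, ?_⟩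
  · have := hc.to_localInverse hd (by simp)
    rwa [h0] at this
  · have := hc.localInverse_apply_image hd (by simp)
    rwa [h0] at this
  · have := hs.eventually_right_inverse
    rwa [h0] at this
  · exact hs.eventually_left_inverse

/-- The derivatives of graph coordinates over the tangent planes are bounded. -/
theorem exists_norm_iteratedFDeriv_graph_coordinates_le (hP : Tame P) (n : ℕ) :
    ∃ D, 1 ≤ D ∧ ∀ (z : EuclideanSpace ℝ (Fin d))
      (e : EuclideanSpace ℝ (Fin d) →ₗᵢ[ℝ] EuclideanSpace ℝ (Fin N))
      (u : EuclideanSpace ℝ (Fin d) → EuclideanSpace ℝ (Fin d)),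
      range e = range (fderiv ℝ P z) → ContDiffAt ℝ ∞ u 0 → u 0 = z →
      (∀ᶠ w in 𝓝 0, planeCoord e (P (u w) - P z) = w) →
      ∀ j, 1 ≤ j → j ≤ n → ‖iteratedFDeriv ℝ j u 0‖ ≤ D := by
  obtain ⟨c, hc, hlow⟩ := hP.lower_fderiv
  obtain ⟨B, hB0, hB⟩ := exists_ckBound_planeCoord_fderiv hP n
  -- A compact set of invertible maps containing the differential of the projected parametrization
  -- at every base point. Inversion is smooth near it, with derivatives bounded on it.
  set K : Set (EuclideanSpace ℝ (Fin d) →L[ℝ] EuclideanSpace ℝ (Fin d)) :=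
    Metric.closedBall 0 B ∩ ⋂ u, {T | c * ‖u‖ ≤ ‖T u‖} with hKdef
  have hK : IsCompact K := (isCompact_closedBall 0 B).inter_right
    (isClosed_iInter fun u => isClosed_le continuous_const (by fun_prop))
  have hKc : ∀ T ∈ K, ContDiffAt ℝ ∞ ContinuousLinearMap.inverse T := fun T hT => by
    obtain ⟨E, hE⟩ := isInvertible_of_injective (L := T) (by
      refine (injective_iff_map_eq_zero _).2 fun u hu => ?_
      have := mem_iInter.1 hT.2 u
      rw [Set.mem_ofPred_eq, hu, norm_zero] at this
      exact norm_eq_zero.1 (le_antisymm (nonpos_of_mul_nonpos_right this hc) (norm_nonneg u)))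
    rw [← hE]
    exact contDiffAt_map_inverse E
  have hb : ∀ i : ℕ, ∃ Ci, ∀ T ∈ K, ‖iteratedFDeriv ℝ i (ContinuousLinearMap.inverse :
      (EuclideanSpace ℝ (Fin d) →L[ℝ] EuclideanSpace ℝ (Fin d)) → _) T‖ ≤ Ci :=
    fun i => hK.exists_bound_of_continuousOn fun T hT =>
      ((hKc T hT).iteratedFDeriv_right (m := 0) (i := i) (by
        rw [zero_add]; exact_mod_cast le_top)).continuousAt.continuousWithinAt
  choose Ci hCi using hb
  set C := ∑ i ∈ Finset.range (n + 1), |Ci i| with hC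
  have hC0 : 0 ≤ C := Finset.sum_nonneg fun i _ => abs_nonneg _
  set B₁ := max 1 B with hB₁
  have hB₁1 : 1 ≤ B₁ := le_max_left _ _
  set A := n.factorial * C * B₁ ^ n with hA
  have hA0 : 0 ≤ A := by positivity
  -- A bootstrap: near zero `Du` is the inverse of `G (u w)`, where `G` is the projected
  -- differential of `P`. Its derivatives of order `m` involve those of `u` only up to order `m`, so
  -- they bound the derivative of `u` of order `m + 1`.
  have key : ∀ m ≤ n, ∃ D, 1 ≤ D ∧ ∀ (z : EuclideanSpace ℝ (Fin d))
      (e : EuclideanSpace ℝ (Fin d) →ₗᵢ[ℝ] EuclideanSpace ℝ (Fin N))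
      (u : EuclideanSpace ℝ (Fin d) → EuclideanSpace ℝ (Fin d)),
      range e = range (fderiv ℝ P z) → ContDiffAt ℝ ∞ u 0 → u 0 = z →
      (∀ᶠ w in 𝓝 0, planeCoord e (P (u w) - P z) = w) →
      ∀ j, 1 ≤ j → j ≤ m → ‖iteratedFDeriv ℝ j u 0‖ ≤ D := by
    intro m
    induction m with
    | zero => exact fun _ => ⟨1, le_rfl, fun z e u _ _ _ _ j h1 h2 => by omega⟩
    | succ m ih =>
      intro hm
      obtain ⟨D, hD1, hD⟩ := ih (by omega)
      refine ⟨max D (m.factorial * A * D ^ m), le_max_of_le_left hD1, ?_⟩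
      intro z e u he hu hu0 huw j h1 hj
      rcases Nat.lt_or_ge j (m + 1) with hlt | hge
      · exact (hD z e u he hu hu0 huw j h1 (by omega)).trans (le_max_left _ _)
      obtain rfl : j = m + 1 := le_antisymm hj hge
      refine le_trans ?_ (le_max_right _ _)
      set G : EuclideanSpace ℝ (Fin d) → EuclideanSpace ℝ (Fin d) →L[ℝ] EuclideanSpace ℝ (Fin d) :=
        fun w => (planeCoord e).comp (fderiv ℝ P w) with hG
      have hGK : G z ∈ K := by
        refine ⟨by simpa using (hB e).norm_le z, mem_iInter.2 fun v => ?_⟩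
        change c * ‖v‖ ≤ ‖planeCoord e (fderiv ℝ P z v)‖
        rw [norm_planeCoord_fderiv he]
        exact hlow z v
      have hGs : ContDiff ℝ n G := (hB e).1
      have hinvG : ContDiffAt ℝ n (ContinuousLinearMap.inverse ∘ G) z :=
        ((hKc _ hGK).of_le (by exact_mod_cast le_top)).comp z hGs.contDiffAt
      have hinvGb : ∀ i ≤ n, ‖iteratedFDeriv ℝ i (ContinuousLinearMap.inverse ∘ G) z‖ ≤ A :=
        norm_iteratedFDeriv_comp_le_of_bound ((hKc _ hGK).of_le (by exact_mod_cast le_top))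
          hGs.contDiffAt hB₁1 (fun i hi => ((hCi i _ hGK).trans (le_abs_self _)).trans
            (Finset.single_le_sum (f := fun i => |Ci i|) (fun i _ => abs_nonneg _)
              (Finset.mem_range.2 (by omega))))
          (fun i _ hi => ((hB e).2 i hi z).trans (le_max_right _ _))
      have hud : ∀ᶠ w in 𝓝 0, DifferentiableAt ℝ u w := by
        filter_upwards [(hu.of_le (m := 1) (by norm_cast)).eventually (by simp)] with w hw
        exact hw.differentiableAt one_ne_zero
      have hDu : fderiv ℝ u =ᶠ[𝓝 0] (ContinuousLinearMap.inverse ∘ G) ∘ u := by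
        filter_upwards [hud, huw.eventually_nhds] with w hw hww
        have h3 : HasFDerivAt (fun w => planeCoord e (P (u w) - P z))
            ((G (u w)).comp (fderiv ℝ u w)) w :=
          (hasFDerivAt_planeCoord hP z e (u w)).comp w hw.hasFDerivAt
        have h4 : (fun w => planeCoord e (P (u w) - P z)) =ᶠ[𝓝 w] id := hww
        have h5 := (h3.congr_of_eventuallyEq h4.symm).unique (hasFDerivAt_id w)
        -- In equal finite dimensions a right inverse is also a left inverse.
        have h6 : (fderiv ℝ u w).comp (G (u w)) = ContinuousLinearMap.id ℝ _ := by
          have h7 := congrArg (fun T : EuclideanSpace ℝ (Fin d) →L[ℝ] EuclideanSpace ℝ (Fin d) =>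
            (T : EuclideanSpace ℝ (Fin d) →ₗ[ℝ] EuclideanSpace ℝ (Fin d))) h5
          have h8 := (LinearMap.comp_eq_id_comm ℝ _).1 h7
          ext v : 1
          exact congrArg (fun T => T v) h8
        simp only [Function.comp_apply]
        exact (ContinuousLinearMap.inverse_eq h5 h6).symm
      rw [← norm_iteratedFDeriv_fderiv, (hDu.iteratedFDeriv ℝ m).eq_of_nhds]
      have hmn : (m : WithTop ℕ∞) ≤ n := by exact_mod_cast (by omega : m ≤ n)
      refine norm_iteratedFDeriv_comp_le_of_bound (g := ContinuousLinearMap.inverse ∘ G)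
        (by rw [hu0]; exact hinvG.of_le hmn)
        (hu.of_le (by exact_mod_cast le_top)) hD1 (fun i hi => ?_) (fun i h1 hi => ?_) m le_rfl
      · rw [hu0]
        exact hinvGb i (by omega)
      · exact hD z e u he hu hu0 huw i h1 hi
  exact key n le_rfl

end GraphCoordinates

end CoarseRicci

end

noncomputable section

namespace CoarseRicci

/-! ### Comparison of the `Cⁿ` norm with derivatives in charts -/

section Jets

variable {d N : ℕ} {M : Type*} [TopologicalSpace M] [ChartedSpace (EuclideanSpace ℝ (Fin d)) M]
  {F : M → EuclideanSpace ℝ (Fin N)} {p : M}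
  {P : EuclideanSpace ℝ (Fin d) → EuclideanSpace ℝ (Fin N)} {D : Set (EuclideanSpace ℝ (Fin d))}

theorem enorm_iteratedFDeriv_le_cNorm {n k : ℕ} {f : M → ℝ} {x : M}
    {ψ : EuclideanSpace ℝ (Fin d) → M} (hψ : IsTangentGraph F x ψ) (hk : k ≤ n) :
    ‖iteratedFDeriv ℝ k (fun w => f (ψ w)) 0‖ₑ ≤ cNorm (d := d) F n f :=
  (le_iSup₂ (f := fun ψ (_ : IsTangentGraph F x ψ) =>
    ‖iteratedFDeriv ℝ k (fun w => f (ψ w)) 0‖ₑ) ψ hψ).trans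
    (le_iSup₂ (f := fun x (k : Fin (n + 1)) => jetSize (d := d) F f k x) x ⟨k, by omega⟩)

variable [IsManifold (𝓡 d) ∞ M]

theorem ChartModel.range_mfderiv (hF : ContMDiff (𝓡 d) (𝓡 N) ∞ F) (H : ChartModel F p P D)
    {z : EuclideanSpace ℝ (Fin d)} (hz : z ∈ D) :
    range (mfderiv (𝓡 d) (𝓡 N) F ((chartAt (EuclideanSpace ℝ (Fin d)) p).symm z)) =
      range (fderiv ℝ P z) := by
  set φ := chartAt (EuclideanSpace ℝ (Fin d)) p with hφ
  have hzt := H.subset hz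
  have hx := φ.map_target hzt
  have hFd : ∀ y, MDifferentiableAt (𝓡 d) (𝓡 N) F y := fun y =>
    hF.contMDiffAt.mdifferentiableAt (by simp)
  have hφd : MDifferentiableAt (𝓡 d) (𝓡 d) φ (φ.symm z) :=
    (contMDiffAt_chartAt p hx).mdifferentiableAt (by simp)
  have hφsd : MDifferentiableAt (𝓡 d) (𝓡 d) φ.symm z :=
    (contMDiffAt_chartAt_symm p hzt).mdifferentiableAt (by simp)
  have hPd : MDifferentiableAt (𝓡 d) (𝓡 N) P (φ (φ.symm z)) :=
    (H.tame.contDiff.differentiable (by simp) _).mdifferentiableAt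
  have h1 : mfderiv (𝓡 d) (𝓡 N) F (φ.symm z) =
      (mfderiv (𝓡 d) (𝓡 N) P (φ (φ.symm z))).comp (mfderiv (𝓡 d) (𝓡 d) φ (φ.symm z)) := by
    rw [← mfderiv_comp (φ.symm z) hPd hφd]
    refine Filter.EventuallyEq.mfderiv_eq ?_
    have hc : ContinuousAt φ (φ.symm z) := φ.continuousAt hx
    have hD : D ∈ 𝓝 (φ (φ.symm z)) := by
      rw [φ.right_inv hzt]
      exact H.isOpen.mem_nhds hz
    filter_upwards [hc.preimage_mem_nhds hD, φ.open_source.mem_nhds hx] with y hy hys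
    have := H.eqOn (φ y) hy
    rwa [localParam, ← hφ, φ.left_inv hys] at this
  have h2 : mfderiv (𝓡 d) (𝓡 N) P z =
      (mfderiv (𝓡 d) (𝓡 N) F (φ.symm z)).comp (mfderiv (𝓡 d) (𝓡 d) φ.symm z) := by
    rw [← mfderiv_comp z (hFd _) hφsd]
    exact (H.eventuallyEq hz).symm.mfderiv_eq
  rw [φ.right_inv hzt] at h1
  rw [← mfderiv_eq_fderiv]
  refine Subset.antisymm ?_ ?_
  · rintro _ ⟨v, rfl⟩
    rw [h1]
    exact ⟨mfderiv (𝓡 d) (𝓡 d) φ (φ.symm z) v, rfl⟩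
  · rintro _ ⟨v, rfl⟩
    rw [h2]
    exact ⟨mfderiv (𝓡 d) (𝓡 d) φ.symm z v, rfl⟩

theorem ChartModel.isTangentGraph (hF : ContMDiff (𝓡 d) (𝓡 N) ∞ F) (H : ChartModel F p P D)
    {z : EuclideanSpace ℝ (Fin d)} (hz : z ∈ D)
    {e : EuclideanSpace ℝ (Fin d) →ₗᵢ[ℝ] EuclideanSpace ℝ (Fin N)}
    {u : EuclideanSpace ℝ (Fin d) → EuclideanSpace ℝ (Fin d)} (he : range e = range (fderiv ℝ P z))
    (hu : ContDiffAt ℝ ∞ u 0) (hu0 : u 0 = z)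
    (hright : ∀ᶠ w in 𝓝 0, planeCoord e (P (u w) - P z) = w) :
    IsTangentGraph F ((chartAt (EuclideanSpace ℝ (Fin d)) p).symm z)
      fun w => (chartAt (EuclideanSpace ℝ (Fin d)) p).symm (u w) := by
  set φ := chartAt (EuclideanSpace ℝ (Fin d)) p with hφ
  refine ⟨congrArg φ.symm hu0, ?_, e, ?_, ?_⟩
  · refine ContMDiffAt.comp (0 : EuclideanSpace ℝ (Fin d)) (g := φ.symm) (I' := 𝓡 d) ?_
      (contMDiffAt_iff_contDiffAt.2 hu)
    rw [hu0]
    exact contMDiffAt_chartAt_symm p (H.subset hz)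
  · rw [H.range_mfderiv hF hz, he]
  · have hc : ContinuousAt u 0 := hu.continuousAt
    filter_upwards [hright, hc.preimage_mem_nhds (by rw [hu0]; exact H.isOpen.mem_nhds hz)]
      with w hw hwD v
    have e1 : F (φ.symm (u w)) = P (u w) := H.eqOn _ hwD
    have e2 : F (φ.symm z) = P z := H.eqOn _ hz
    rw [e1, e2, ← inner_planeCoord, hw]

/-- Without this the supremum in `jetSize` could be empty, and a bound on the norm would say nothing
about `f`. -/
theorem ChartModel.exists_isTangentGraph (hF : ContMDiff (𝓡 d) (𝓡 N) ∞ F)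
    (H : ChartModel F p P D) {z : EuclideanSpace ℝ (Fin d)} (hz : z ∈ D) :
    ∃ ψ : EuclideanSpace ℝ (Fin d) → M,
      IsTangentGraph F ((chartAt (EuclideanSpace ℝ (Fin d)) p).symm z) ψ := by
  obtain ⟨e, u, he, hu, hu0, hright, -⟩ := exists_graph_coordinates H.tame z
  exact ⟨_, H.isTangentGraph hF hz he hu hu0 hright⟩

/-- The derivatives of a function in a chart are controlled by its `Cⁿ` norm. -/
theorem ChartModel.exists_norm_iteratedFDeriv_le (hF : ContMDiff (𝓡 d) (𝓡 N) ∞ F)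
    (H : ChartModel F p P D) (n : ℕ) :
    ∃ C, 0 ≤ C ∧ ∀ (f : M → ℝ) (K : ℝ≥0), ContMDiff (𝓡 d) 𝓘(ℝ, ℝ) n f →
      cNorm (d := d) F n f ≤ K → ∀ z ∈ D, ∀ k ≤ n,
      ‖iteratedFDeriv ℝ k (fun w => f ((chartAt (EuclideanSpace ℝ (Fin d)) p).symm w)) z‖ ≤
        C * K := by
  obtain ⟨A, hA1, hA⟩ := exists_norm_iteratedFDeriv_planeCoord_le H.tame n
  refine ⟨n.factorial * A ^ n, by positivity, fun f K hf hK z hz k hk => ?_⟩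
  set φ := chartAt (EuclideanSpace ℝ (Fin d)) p with hφ
  obtain ⟨e, u, he, hu, hu0, hright, hleft⟩ := exists_graph_coordinates H.tame z
  have hle : (n : WithTop ℕ∞) ≤ (∞ : WithTop ℕ∞) := by exact_mod_cast le_top
  have hψ := H.isTangentGraph hF hz he hu hu0 hright
  have hfψ : ContDiffAt ℝ n (fun w => f (φ.symm (u w))) 0 :=
    contMDiffAt_iff_contDiffAt.1 (hf.contMDiffAt.comp (0 : EuclideanSpace ℝ (Fin d))
      (hψ.2.1.of_le hle))
  have heq : (fun w => f (φ.symm w)) =ᶠ[𝓝 z]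
      (fun w => f (φ.symm (u w))) ∘ fun w => planeCoord e (P w - P z) := by
    filter_upwards [hleft] with w hw
    simp only [Function.comp_apply, hw]
  have h0 : planeCoord e (P z - P z) = 0 := by rw [sub_self, map_zero]
  rw [(heq.iteratedFDeriv ℝ k).eq_of_nhds]
  refine (norm_iteratedFDeriv_comp_le_of_bound (C := K) (D := A) (n := n) (by rwa [h0])
    ((contDiffAt_planeCoord H.tame z e).of_le hle).contDiffAt hA1 (fun i hi => ?_)
    (fun i h1 hi => hA z e z i h1 hi) k hk).trans (le_of_eq (by ring))
  rw [h0]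
  have := (enorm_iteratedFDeriv_le_cNorm (f := f) hψ hi).trans hK
  rw [enorm_le_coe] at this
  exact_mod_cast this

/-- The `Cⁿ` norm is finite near a point. -/
theorem ChartModel.exists_jetSize_le (hF : ContMDiff (𝓡 d) (𝓡 N) ∞ F)
    (H : ChartModel F p P D) {n : ℕ} {f : M → ℝ} {B : ℝ} (hB0 : 0 ≤ B)
    (hf : ContMDiff (𝓡 d) 𝓘(ℝ, ℝ) n f)
    (hB : ∀ z ∈ D, ∀ k ≤ n,
      ‖iteratedFDeriv ℝ k (fun w => f ((chartAt (EuclideanSpace ℝ (Fin d)) p).symm w)) z‖ ≤ B) :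
    ∃ C : ℝ≥0, ∀ x ∈ (chartAt (EuclideanSpace ℝ (Fin d)) p).source,
      chartAt (EuclideanSpace ℝ (Fin d)) p x ∈ D → ∀ k ≤ n, jetSize (d := d) F f k x ≤ C := by
  obtain ⟨A, hA1, hA⟩ := exists_norm_iteratedFDeriv_graph_coordinates_le H.tame n
  refine ⟨⟨n.factorial * B * A ^ n, by positivity⟩, fun x hx hxD k hk => ?_⟩
  set φ := chartAt (EuclideanSpace ℝ (Fin d)) p with hφ
  refine iSup₂_le fun ψ hψ => ?_
  obtain ⟨hψ0, hψs, e, he, hew⟩ := hψ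
  have hle : (n : WithTop ℕ∞) ≤ (∞ : WithTop ℕ∞) := by exact_mod_cast le_top
  set u : EuclideanSpace ℝ (Fin d) → EuclideanSpace ℝ (Fin d) := fun w => φ (ψ w) with hu
  have hu0 : u 0 = φ x := by rw [hu]; simp only [hψ0]
  have hus : ContDiffAt ℝ ∞ u 0 := by
    refine contMDiffAt_iff_contDiffAt.1 (ContMDiffAt.comp (0 : EuclideanSpace ℝ (Fin d)) (g := φ)
      (I' := 𝓡 d) ?_ hψs)
    rw [hψ0]
    exact contMDiffAt_chartAt p hx
  have hsrc : ∀ᶠ w in 𝓝 (0 : EuclideanSpace ℝ (Fin d)), ψ w ∈ φ.source :=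
    hψs.continuousAt.preimage_mem_nhds (by rw [hψ0]; exact φ.open_source.mem_nhds hx)
  have hFx : F x = P (φ x) := by
    have := H.eqOn _ hxD
    rwa [localParam, ← hφ, φ.left_inv hx] at this
  have huw : ∀ᶠ w in 𝓝 0, planeCoord e (P (u w) - P (φ x)) = w := by
    filter_upwards [hew, hsrc, hus.continuousAt.preimage_mem_nhds
      (by rw [hu0]; exact H.isOpen.mem_nhds hxD)] with w hw hws hwD
    refine ext_inner_left ℝ fun v => ?_
    have := H.eqOn _ hwD
    rw [hu, localParam, ← hφ, φ.left_inv hws] at this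
    rw [inner_planeCoord, ← hw v, this, hFx]
  have hrange : range e = range (fderiv ℝ P (φ x)) := by
    rw [← H.range_mfderiv hF hxD, ← hφ, φ.left_inv hx, he]
  have hfz : ContDiffAt ℝ n (fun w => f (φ.symm w)) (u 0) := by
    rw [hu0]
    exact contMDiffAt_iff_contDiffAt.1 (hf.contMDiffAt.comp (φ x)
      ((contMDiffAt_chartAt_symm p (φ.map_source hx)).of_le hle))
  have heq : (fun w => f (ψ w)) =ᶠ[𝓝 0] (fun w => f (φ.symm w)) ∘ u := by
    filter_upwards [hsrc] with w hw
    simp only [Function.comp_apply, hu, φ.left_inv hw]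
  rw [(heq.iteratedFDeriv ℝ k).eq_of_nhds]
  refine enorm_le_coe.2 (NNReal.coe_le_coe.1 ?_)
  have := norm_iteratedFDeriv_comp_le_of_bound (C := B) (D := A) (n := n) hfz (hus.of_le hle) hA1
    (fun i hi => by rw [hu0]; exact hB _ hxD i hi)
    (fun i h1 hi => hA (φ x) e u hrange hus hu0 huw i h1 hi) k hk
  exact this

theorem abs_le_of_cNorm_le (hF : IsSmoothEmbedding (𝓡 d) (𝓡 N) ∞ F) {f : M → ℝ} {K : ℝ≥0} {n : ℕ}
    (hK : cNorm (d := d) F n f ≤ K) (x : M) : |f x| ≤ K := by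
  obtain ⟨P, r, hr, H⟩ := exists_chartModel hF x (mem_chart_target _ x)
  obtain ⟨ψ, hψ⟩ := H.exists_isTangentGraph hF.contMDiff (Metric.mem_ball_self hr)
  rw [(chartAt _ x).left_inv (mem_chart_source _ x)] at hψ
  have h1 := (enorm_iteratedFDeriv_le_cNorm (f := f) hψ (Nat.zero_le n)).trans hK
  rw [enorm_le_coe] at h1
  have h2 : ‖iteratedFDeriv ℝ 0 (fun w => f (ψ w)) 0‖ ≤ K := by exact_mod_cast h1
  rwa [norm_iteratedFDeriv_zero, hψ.1, Real.norm_eq_abs] at h2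

/-- Any tangent graph, read in a chart, is a local inverse of the projected parametrization, so
`ChartModel.exists_jetSize_le` bounds all of them near each point. Compactness makes the bound
global. -/
theorem cNorm_lt_top [CompactSpace M] (hF : IsSmoothEmbedding (𝓡 d) (𝓡 N) ∞ F) {n : ℕ} {f : M → ℝ}
    (hf : ContMDiff (𝓡 d) 𝓘(ℝ, ℝ) n f) : cNorm (d := d) F n f < ⊤ := by
  have hloc : ∃ C : ℝ≥0, ∀ x ∈ (univ : Set M), ∀ k ≤ n, jetSize (d := d) F f k x ≤ C := by
    refine isCompact_univ.induction_on (p := fun s : Set M => ∃ C : ℝ≥0, ∀ x ∈ s, ∀ k ≤ n,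
      jetSize (d := d) F f k x ≤ C) ⟨0, by simp⟩ ?_ ?_ ?_
    · rintro s t hst ⟨C, hC⟩
      exact ⟨C, fun x hx => hC x (hst hx)⟩
    · rintro s t ⟨C, hC⟩ ⟨C', hC'⟩
      refine ⟨max C C', fun x hx k hk => ?_⟩
      rcases hx with hx | hx
      · exact (hC x hx k hk).trans (by exact_mod_cast le_max_left C C')
      · exact (hC' x hx k hk).trans (by exact_mod_cast le_max_right C C')
    · intro x _
      set φ := chartAt (EuclideanSpace ℝ (Fin d)) x with hφ
      obtain ⟨P, r, hr, H⟩ := exists_chartModel hF x (mem_chart_target _ x)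
      have hle : (n : WithTop ℕ∞) ≤ (∞ : WithTop ℕ∞) := by exact_mod_cast le_top
      have hz : ContDiffAt ℝ n (fun w => f (φ.symm w)) (φ x) :=
        contMDiffAt_iff_contDiffAt.1 (hf.contMDiffAt.comp (φ x)
          ((contMDiffAt_chartAt_symm x (mem_chart_target _ x)).of_le hle))
      obtain ⟨r₁, hr₁, B, g, hg, heq⟩ := exists_ckBound_extension hz
      have H' : ChartModel F x P (Metric.ball (φ x) (min r r₁)) :=
        H.mono Metric.isOpen_ball (Metric.ball_subset_ball (min_le_left _ _))
      obtain ⟨C, hC⟩ := H'.exists_jetSize_le hF.contMDiff hg.nonneg hf (fun z hz k hk => by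
        have h1 : (fun w => f (φ.symm w)) =ᶠ[𝓝 z] g := by
          filter_upwards [Metric.isOpen_ball.mem_nhds hz] with w hw
          exact (heq w (Metric.ball_subset_ball (min_le_right _ _) hw)).symm
        rw [(h1.iteratedFDeriv ℝ k).eq_of_nhds]
        exact hg.2 k hk z)
      refine ⟨φ.source ∩ φ ⁻¹' Metric.ball (φ x) (min r r₁), ?_, C, fun y hy => hC y hy.1 hy.2⟩
      rw [nhdsWithin_univ]
      have hc : ContinuousAt φ x := φ.continuousAt (mem_chart_source _ x)
      exact inter_mem (φ.open_source.mem_nhds (mem_chart_source _ x))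
        (hc.preimage_mem_nhds (Metric.ball_mem_nhds _ (lt_min hr hr₁)))
  obtain ⟨C, hC⟩ := hloc
  refine lt_of_le_of_lt (iSup₂_le fun x k => ?_) (ENNReal.coe_lt_top (r := C))
  exact hC x (mem_univ x) k (by omega)

end Jets

end CoarseRicci

end

noncomputable section

namespace CoarseRicci

/-! ### Local estimates and compactness -/

section Uniform

variable {d N : ℕ} {M : Type*} [TopologicalSpace M] [ChartedSpace (EuclideanSpace ℝ (Fin d)) M]
  [IsManifold (𝓡 d) ∞ M] [CompactSpace M] [MeasurableSpace M] [BorelSpace M]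
  {F : M → EuclideanSpace ℝ (Fin N)}

/-- The function is cut off in the chart at `x`. The model estimate compares the Laplacian with the
model heat operator up to `√t`, and localization compares the latter with the true one up to `t ≤
√t`. The bound on `Γ₂` of the Laplacian alone is recorded for use with `t > 1`. -/
theorem exists_local_iteratedCarreDuChamp_estimate (hF : IsSmoothEmbedding (𝓡 d) (𝓡 N) ∞ F)
    (x : M) : ∃ s ∈ 𝓝 x, ∃ C, 0 ≤ C ∧ ∀ (f : M → ℝ) (K : ℝ≥0), ContMDiff (𝓡 d) 𝓘(ℝ, ℝ) 5 f →
      cNorm (d := d) F 5 f ≤ K → (∀ y, |f y| ≤ K) → ∀ y ∈ s,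
      |iteratedCarreDuChamp (laplacian (d := d) F) f f y| ≤ C * K ^ 2 ∧
      ∀ t : ℝ, 0 < t → t ≤ 1 → |iteratedCarreDuChamp (laplacian (d := d) F) f f y -
        iteratedCarreDuChamp (heatOperator (chordalDist F) (riemannianVolume (d := d) F) t) f f y| ≤
          C * K ^ 2 * √t := by
  have := isFiniteMeasure_riemannianVolume hF
  set φ := chartAt (EuclideanSpace ℝ (Fin d)) x with hφ
  obtain ⟨P, r, hr, H⟩ := exists_chartModel hF x (mem_chart_target _ x)
  have hball : ∀ c : ℝ, c ≤ 1 → ChartModel F x P (Metric.ball (φ x) (c * r)) := fun c hc =>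
    H.mono Metric.isOpen_ball (Metric.ball_subset_ball (mul_le_of_le_one_left hr.le hc))
  -- On the ball of radius `r / 2` the cutoff equals one; two further halvings accommodate the two
  -- applications of the operator.
  have H₁ := (hball (1 / 2) (by norm_num)).localModel hF (r' := 1 / 4 * r) (by linarith)
  have H₂ := (hball (1 / 4) (by norm_num)).localModel hF (r' := 1 / 8 * r) (by linarith)
  obtain ⟨C₁, hC₁, hjet⟩ := H.exists_norm_iteratedFDeriv_le hF.contMDiff 5
  obtain ⟨C₂, hC₂, hcut⟩ := exists_ckBound_cutoff_smul (F := ℝ) (φ x) hr 5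
  obtain ⟨C₃, hC₃, hmodel⟩ := exists_model_estimate H.tame
  obtain ⟨C₄, hC₄, hcomp⟩ := H₁.exists_abs_iteratedCarreDuChamp_sub_le H.tame
    hF.isEmbedding.continuous.measurable H₂
  -- The summand `1` makes `A * K` a bound for `|f|` on the whole submanifold as well as for the
  -- derivatives of the cut-off function.
  set A := C₂ * C₁ + 1 with hA
  have hA0 : 0 ≤ A := by positivity
  have hle : ∀ m : ℕ, (m : WithTop ℕ∞) ≤ (∞ : WithTop ℕ∞) := fun m => by exact_mod_cast le_top
  refine ⟨φ.source ∩ φ ⁻¹' Metric.ball (φ x) (1 / 8 * r), ?_, (C₃ + C₄) * A ^ 2, by positivity, ?_⟩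
  · have hc : ContinuousAt φ x := φ.continuousAt (mem_chart_source _ x)
    exact inter_mem (φ.open_source.mem_nhds (mem_chart_source _ x))
      (hc.preimage_mem_nhds (Metric.ball_mem_nhds _ (by positivity)))
  intro f K hf hK hfK y hy
  have hK0 : (0 : ℝ) ≤ K := K.2
  have hf' := (hcut (C₁ * K) (fun w => f (φ.symm w)) (fun z hz => contMDiffAt_iff_contDiffAt.1
    (hf.contMDiffAt.comp z ((contMDiffAt_chartAt_symm x (H.subset hz)).of_le (hle 5))))
    (hjet f K hf hK)).mono_right (show C₂ * (C₁ * K) ≤ A * K by rw [hA]; nlinarith)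
  set f' : EuclideanSpace ℝ (Fin d) → ℝ := fun z => cutoff (φ x) r z • f (φ.symm z) with hf'def
  have heq : ∀ w ∈ Metric.ball (φ x) (1 / 2 * r), f (φ.symm w) = f' w := fun w hw => by
    have : cutoff (φ x) r w = 1 := cutoff_eq_one hr (by rwa [one_div_mul_eq_div] at hw)
    simp only [hf'def, this, one_smul]
  have hyD : φ y ∈ Metric.ball (φ x) (1 / 2 * r) :=
    Metric.ball_subset_ball (by linarith) hy.2
  have hΓ := (hball (1 / 2) (by norm_num)).iteratedCarreDuChamp_eq hF hf heq (φ y) hyD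
  rw [← hφ, φ.left_inv hy.1] at hΓ
  obtain ⟨hm1, hm2⟩ := hmodel (A * K) f' hf' (φ y)
  have hAK : (A * K) ^ 2 = A ^ 2 * K ^ 2 := mul_pow _ _ _
  have hAK0 : 0 ≤ A ^ 2 * (K : ℝ) ^ 2 := by positivity
  refine ⟨?_, fun t ht ht1 => ?_⟩
  · rw [hΓ]
    refine hm1.trans ?_
    rw [hAK]
    nlinarith [mul_nonneg hC₄ hAK0]
  · have h1 := hm2 t ht
    have h2 := hcomp t ht ht1 (A * K) f f' hf.continuous.measurable hf'.1.continuous.measurable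
      (fun y => (hfK y).trans (by rw [hA]; nlinarith [mul_nonneg (mul_nonneg hC₂ hC₁) hK0]))
      (fun w => hf'.norm_le w) heq (φ y) hy.2
    rw [← hφ, φ.left_inv hy.1] at h2
    rw [hΓ]
    have h3 : t ≤ √t := by
      rw [Real.le_sqrt ht.le ht.le]
      nlinarith
    have h4 : C₄ * (A * K) ^ 2 * t ≤ C₄ * (A * K) ^ 2 * √t := by gcongr
    have h5 := abs_sub_le (iteratedCarreDuChamp (coordLaplacian P) f' f' (φ y))
      (iteratedCarreDuChamp (modelHeat P t) f' f' (φ y))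
      (iteratedCarreDuChamp (heatOperator (chordalDist F) (riemannianVolume (d := d) F) t) f f y)
    rw [abs_sub_comm] at h2
    calc _ ≤ C₃ * (A * K) ^ 2 * √t + C₄ * (A * K) ^ 2 * √t := by linarith
      _ = _ := by rw [hAK]; ring

theorem exists_abs_iteratedCarreDuChamp_sub_heatOperator_le
    (hF : IsSmoothEmbedding (𝓡 d) (𝓡 N) ∞ F) :
    ∃ C, 0 ≤ C ∧ ∀ (f : M → ℝ) (K : ℝ≥0), ContMDiff (𝓡 d) 𝓘(ℝ, ℝ) 5 f →
      cNorm (d := d) F 5 f ≤ K → ∀ t : ℝ, 0 < t → ∀ x,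
      |iteratedCarreDuChamp (laplacian (d := d) F) f f x -
        iteratedCarreDuChamp (heatOperator (chordalDist F) (riemannianVolume (d := d) F) t) f f x| ≤
          C * K ^ 2 * √t := by
  have hglob : ∃ C, 0 ≤ C ∧ ∀ (f : M → ℝ) (K : ℝ≥0), ContMDiff (𝓡 d) 𝓘(ℝ, ℝ) 5 f →
      cNorm (d := d) F 5 f ≤ K → (∀ y, |f y| ≤ K) → ∀ y ∈ (univ : Set M),
      |iteratedCarreDuChamp (laplacian (d := d) F) f f y| ≤ C * K ^ 2 ∧
      ∀ t : ℝ, 0 < t → t ≤ 1 → |iteratedCarreDuChamp (laplacian (d := d) F) f f y -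
        iteratedCarreDuChamp (heatOperator (chordalDist F) (riemannianVolume (d := d) F) t) f f y| ≤
          C * K ^ 2 * √t := by
    have hmono : ∀ {C C' : ℝ} {K : ℝ≥0} {a : ℝ} {b : ℝ → ℝ}, C ≤ C' →
        (a ≤ C * K ^ 2 ∧ ∀ t, 0 < t → t ≤ 1 → b t ≤ C * K ^ 2 * √t) →
        (a ≤ C' * K ^ 2 ∧ ∀ t, 0 < t → t ≤ 1 → b t ≤ C' * K ^ 2 * √t) := fun hCC h =>
      ⟨h.1.trans (by gcongr), fun t h0 h1 => (h.2 t h0 h1).trans (by gcongr)⟩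
    refine isCompact_univ.induction_on (p := fun s : Set M => ∃ C, 0 ≤ C ∧
      ∀ (f : M → ℝ) (K : ℝ≥0), ContMDiff (𝓡 d) 𝓘(ℝ, ℝ) 5 f →
      cNorm (d := d) F 5 f ≤ K → (∀ y, |f y| ≤ K) → ∀ y ∈ s,
      |iteratedCarreDuChamp (laplacian (d := d) F) f f y| ≤ C * K ^ 2 ∧
      ∀ t : ℝ, 0 < t → t ≤ 1 → |iteratedCarreDuChamp (laplacian (d := d) F) f f y -
        iteratedCarreDuChamp (heatOperator (chordalDist F) (riemannianVolume (d := d) F) t) f f y| ≤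
          C * K ^ 2 * √t) ⟨0, le_rfl, by simp⟩ ?_ ?_ ?_
    · rintro s s' hss ⟨C, hC0, hC⟩
      exact ⟨C, hC0, fun f K h1 h2 h3 y hy => hC f K h1 h2 h3 y (hss hy)⟩
    · rintro s s' ⟨C, hC0, hC⟩ ⟨C', hC0', hC'⟩
      refine ⟨max C C', le_max_of_le_left hC0, fun f K h1 h2 h3 y hy => ?_⟩
      rcases hy with hy | hy
      · exact hmono (le_max_left _ _) (hC f K h1 h2 h3 y hy)
      · exact hmono (le_max_right _ _) (hC' f K h1 h2 h3 y hy)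
    · intro x _
      obtain ⟨s, hs, h⟩ := exists_local_iteratedCarreDuChamp_estimate hF x
      exact ⟨s, by rwa [nhdsWithin_univ], h⟩
  obtain ⟨C, hC0, hC⟩ := hglob
  -- The `36` comes from the crude bound on `Γ₂` of the heat operator, which together with `1 ≤ √t`
  -- handles `t > 1`.
  refine ⟨C + 36, by positivity, fun f K hf hK t ht x => ?_⟩
  have hfK := abs_le_of_cNorm_le hF hK
  obtain ⟨h1, h2⟩ := hC f K hf hK hfK x (mem_univ x)
  rcases le_or_gt t 1 with ht1 | ht1
  · refine (h2 t ht ht1).trans ?_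
    gcongr
    linarith
  · have h3 := abs_iteratedCarreDuChamp_heatOperator_le (ρ := chordalDist F)
      (μ := riemannianVolume (d := d) F) hfK ht x
    have h4 : 1 ≤ √t := Real.one_le_sqrt.2 ht1.le
    have h5 : 36 * (K : ℝ) ^ 2 / t ^ 2 ≤ 36 * K ^ 2 :=
      div_le_self (by positivity) (one_le_pow₀ ht1.le)
    calc _ ≤ C * (K : ℝ) ^ 2 + 36 * K ^ 2 := (abs_sub _ _).trans (by linarith)
      _ = (C + 36) * K ^ 2 * 1 := by ring
      _ ≤ _ := by gcongr

end Uniform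

end CoarseRicci

end
open CoarseRicci in
theorem theorem1p4 {d N : ℕ} {M : Type*} [TopologicalSpace M]
    [ChartedSpace (EuclideanSpace ℝ (Fin d)) M] [IsManifold (𝓡 d) ∞ M] [CompactSpace M]
    [MeasurableSpace M] [BorelSpace M]
    (F : M → EuclideanSpace ℝ (Fin N)) (hF : IsSmoothEmbedding (𝓡 d) (𝓡 N) ∞ F) :
    ∃ C : ℝ≥0 → ℝ, ∀ f : M → ℝ, ContMDiff (𝓡 d) 𝓘(ℝ, ℝ) 5 f →
      cNorm (d := d) F 5 f < ⊤ ∧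
      ∀ K : ℝ≥0, cNorm (d := d) F 5 f ≤ K → ∀ t : ℝ, 0 < t →
        BddAbove (range fun x =>
          |iteratedCarreDuChamp (laplacian (d := d) F) f f x
            - iteratedCarreDuChamp
                (heatOperator (chordalDist F) (riemannianVolume (d := d) F) t) f f x|) ∧
        ⨆ x, |iteratedCarreDuChamp (laplacian (d := d) F) f f x
            - iteratedCarreDuChamp
                (heatOperator (chordalDist F) (riemannianVolume (d := d) F) t) f f x|
          < C K * √t := by
  obtain ⟨C, hC0, hC⟩ := exists_abs_iteratedCarreDuChamp_sub_heatOperator_le hF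
  -- Adding `1` makes the inequality strict, also when `K = 0`.
  refine ⟨fun K => C * (K : ℝ) ^ 2 + 1, fun f hf => ⟨cNorm_lt_top hF hf, fun K hK t ht => ?_⟩⟩
  have hbd := hC f K hf hK t ht
  refine ⟨⟨_, forall_mem_range.2 hbd⟩, ?_⟩
  have hs : 0 < √t := Real.sqrt_pos.2 ht
  -- Nonnegativity of the bound covers an empty `M`, where the real supremum is zero.
  refine lt_of_le_of_lt (Real.iSup_le hbd (by positivity)) ?_
  exact mul_lt_mul_of_pos_right (lt_add_one _) hs
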